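/- **Setting.** Let $d,d_1,K\ge 0$ be integers with $d_1\ge 2d+1$. Let $f:\mathbb R\to\mathbb R$ be $2\pi$-periodic and $d_1$ times continuously differentiable except at points $\xi_1,\dots,\xi_K$ (and their translates by $2\pi\mathbb Z$), where all $f^{(l)}$, $0\le l\le d_1$, have one-sided limits; put $A_{l,j}=f^{(l)}(\xi_j^+)-f^{(l)}(\xi_j^-)$, $\omega_j=e^{-\imath\xi_j}$, $c_k(u)=\frac1{2\pi}\int_{-\pi}^{\pi}u(x)e^{-\imath kx}\,dx$. Distances between jumps are measured on the circle $\mathbb R/2\pi\mathbb Z$ and written $|\cdot|$. Suppose that $$J_1\le|A_{0,j}|\le J_2,\qquad |\xi_i-\xi_j|\ge J_3\ (i\ne j),\qquad \Bigl|2\pi(\imath k)c_k(f)-\sum_{j}A_{0,j}\omega_j^k\Bigr|\le \frac Tk\quad(k\ge1),$$ with $J_1>0$ and $0<J_3\le\pi$. Let $V_l(x;\xi)$ be the $2\pi$-periodic function equal to $-\frac{(2\pi)^l}{(l+1)!}B_{l+1}\bigl(\frac{x-\xi}{2\pi}\bigr)$ for $\xi\le x<\xi+2\pi$ ($B_n$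 the Bernoulli polynomials). **Initial estimates.** With $r_k=2\pi(\imath k)c_k(f)$ consider the system $\sum_{l=0}^{K-1}r_{M+i+l}\,q_l=-r_{M+K+i}$, $0\le i<K$. Its solution (when unique) yields the $K$ roots, counted with multiplicity, of $z^K+\sum_{l<K}q_lz^l$, and the negatives of the arguments of these roots are the initial estimates of the jumps. **Localization.** Let $\Psi(x)=e^{-1/(1-x^2)}$ for $|x|<1$ and $0$ otherwise, $\Delta=\int_{-1}^1\Psi$. For a real number $\widehat\xi_j$, an initial estimate of $\xi_j$, let $g_j$ be the $C^\infty$ bump $g_j(x)=\frac1{s\Delta}\int_{\widehat\xi_j-r/2}^{\widehat\xi_j+r/2}\Psi\bigl(\frac{x-\tau}{s}\bigr)d\tau$ on $[\widehat\xi_j-\pi,\widehat\xi_j+\pi]$, extended $2\pi$-periodically, with $s=\frac13(E-\frac t2)$, $r=\frac23(E+t)$, $E=J_3$, $t=\frac23J_3$; it equals $1$ at distance $\le\frac13J_3$ from $\widehat\xi_j$ and vanishes at distance $\ge\frac79J_3$. Put $h_j=f g_j$ and $$\widetilde c_k=\sum_{i=-2M}^{2M}c_i(f)\,c_{k-i}(g_j).$$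 **Resolution.** With $\widetilde r_k=2\pi(\imath k)^{d+1}\widetilde c_k$ let $q_M^d(z)=\sum_{m=0}^{d+1}(-1)^m\binom{d+1}{m}\widetilde r_{M+m}z^{d+1-m}$, let $\widetilde\omega_j$ be a root of $q^d_M$ closest to the unit circle, $\widetilde\xi_j=-\arg\widetilde\omega_j$, and let $\widetilde A_{0,j},\dots,\widetilde A_{d,j}$ solve $\widetilde r_k\widetilde\omega_j^{-k}=\sum_{l=0}^d(\imath k)^{d-l}\widetilde A_{l,j}$, $k=M,\dots,M+d$. **Constants.** Let $R^*$ be a constant such that at least one of the following holds: (i) $|c_k(f-\sum_{i=1}^K\sum_{l=0}^{d_1}A_{l,i}V_l(\cdot;\xi_i))|\le R^*k^{-d_1-2}$ for all $k\ge1$, and $|c_0(f)|\le R^*$; (ii) $|c_k(h_j-\sum_{l=0}^{d_1}A_{l,j}V_l(\cdot;\xi_j))|\le R^*k^{-d_1-2}$ for all $k\ge1$. Put $$\widehat{R^*}=R^*+\frac{J_2+T}{J_3^{d_1+1}},\qquad H=\max\Bigl(1,\sum_{l=0}^{d}|A_{l,j}|\Bigr)+\max\Bigl(1,\sum_{l=d+1}^{d_1}|A_{l,j}|\Bigr)+\widehat{R^*}.$$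 **Theorem.** The generalized Laguerre polynomial $\mathcal L_d^{(1)}(x)=\sum_{m=0}^d\binom{d+1}{d-m}\frac{(-x)^m}{m!}$ has $d$ simple real roots $\phi_1,\dots,\phi_d$ with $|\phi_1|<\dots<|\phi_d|$. There are positive constants $C_1,\dots,C_5$ depending only on $d,d_1,K,J_1$, and a number $M_0$ depending only on $d,d_1,K,J_1,J_2,J_3,T$, such that: (a) For every $M\ge M_0$ the system for the initial estimates has a unique solution and, in a suitable order, the initial estimates $\widehat\xi_j$ satisfy $|\widehat\xi_j-\xi_j|\le\frac29J_3$ for all $j$. (In particular they fulfil the conditions required in (b).) (b) For every $j$, every $\widehat\xi_j$ with $|\widehat\xi_j-\xi_j|\le\frac13J_3$ and $|\widehat\xi_j-\xi_i|\ge\frac79J_3$ for all $i\neq j$, every such $R^*$, and every integer $M>C_5H$: 1. The points $y_0=\omega_j$, $y_i=\omega_j/(1-\phi_i/M)$ ($1\le i\le d$) lie on the ray from $0$ through $\omega_j$, $|y_i|\ge1$, and $|y_i-y_{i'}|\ge C_1M^{-1}$ for $i\neq i'$. 2. $q^d_M$ has exactly $d+1$ roots with multiplicity; listing them with $|\kappa_0|\le\dots\le|\kappa_d|$,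 one has $|\kappa_i-y_i|\le C_2HM^{-2}$ for $1\le i\le d$ and $|\kappa_0-\omega_j|\le C_3HM^{-d-2}$. 3. $|\widetilde\omega_j-\omega_j|\le C_3HM^{-d-2}$ and $|\widetilde\xi_j-\xi_j|\le C_3HM^{-d-2}$. 4. The linear system for $\widetilde A_{l,j}$ has exactly one solution, and $|\widetilde A_{l,j}-A_{l,j}|\le C_4H^2M^{l-d-1}$ for $0\le l\le d$. -/

import Mathlib

open scoped Real Topology

noncomputable section

namespace PiecewiseFourier

open Polynomial Filter

/-- The `k`-th Fourier coefficient `(1 / 2π) ∫_{-π}^{π} u(x) e^{-ikx} dx`. -/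
def fc (u : ℝ → ℝ) (k : ℤ) : ℂ :=
  (1 / (2 * π : ℂ)) * ∫ x in (-π)..π, (u x : ℂ) * Complex.exp (-(Complex.I * k * x))

/-- Distance of two points of the circle `ℝ / 2πℤ`, each given by a real representative. -/
def circDist (x y : ℝ) : ℝ := ‖((x - y : ℝ) : AddCircle (2 * π))‖

/-- The point `ω = e^{-iξ}` of the unit circle. -/
def node (ξ : ℝ) : ℂ := Complex.exp (-(Complex.I * ξ))

/-- `f` is a `2π`-periodic function that is `d₁` times continuously differentiable away from the
points `ξ j` (and their translates by multiples of `2π`); at `ξ j` all derivatives of order at most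
`d₁` have one-sided limits, and `A l j` is the jump of the `l`-th derivative at `ξ j`. -/
structure HasJumps {K : ℕ} (d₁ : ℕ) (f : ℝ → ℝ) (ξ : Fin K → ℝ) (A : ℕ → Fin K → ℝ) : Prop where
  periodic : Function.Periodic f (2 * π)
  smooth : ContDiffOn ℝ d₁ f {x | ∀ (j : Fin K) (n : ℤ), x ≠ ξ j + n * (2 * π)}
  jump : ∀ l ≤ d₁, ∀ j : Fin K, ∃ a b : ℝ,
    Tendsto (iteratedDeriv l f) (𝓝[<] (ξ j)) (𝓝 a) ∧
    Tendsto (iteratedDeriv l f) (𝓝[>] (ξ j)) (𝓝 b) ∧ A l j = b - a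

/-- The `2π`-periodic piecewise polynomial `V_n(x; ξ)`, which equals
`-(2π)^n / (n+1)! * B_{n+1}((x - ξ) / 2π)` for `ξ ≤ x < ξ + 2π`; its `n`-th derivative has a unit
jump at `ξ`. -/
def sawtooth (n : ℕ) (ξ x : ℝ) : ℝ :=
  -((2 * π) ^ n / (Nat.factorial (n + 1) : ℝ)) *
    bernoulliFun (n + 1) (Int.fract ((x - ξ) / (2 * π)))

/-- The piecewise polynomial `Φ` with jumps `A l j`, `l ≤ n`, at the points `ξ j`. -/
def singularPart {K : ℕ} (n : ℕ) (ξ : Fin K → ℝ) (A : ℕ → Fin K → ℝ) (x : ℝ) : ℝ :=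
  ∑ j : Fin K, ∑ l ∈ Finset.range (n + 1), A l j * sawtooth l (ξ j) x

/-- `|c_k(u - Φ)| ≤ R k^{-d₁-2}` for all `k ≥ 1`, with `Φ` the singular part of order `d₁`. -/
def SmoothPartBound {K : ℕ} (d₁ : ℕ) (u : ℝ → ℝ) (ξ : Fin K → ℝ) (A : ℕ → Fin K → ℝ)
    (R : ℝ) : Prop :=
  ∀ k : ℕ, 1 ≤ k → ‖fc (fun x => u x - singularPart d₁ ξ A x) k‖ ≤ R / (k : ℝ) ^ (d₁ + 2)

/-! ### The bump -/

/-- The standard `C^∞` mollifier. -/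
def mollifier (x : ℝ) : ℝ := if |x| < 1 then Real.exp (-1 / (1 - x ^ 2)) else 0

/-- The bump `g_{E,t}` centred at the origin: the indicator function of `[-r/2, r/2]` convolved
with the mollifier scaled to `[-s, s]` and normalised, where `s = (E - t/2)/3`, `r = 2(E + t)/3`. -/
def bump (E t x : ℝ) : ℝ :=
  1 / (((E - t / 2) / 3) * ∫ y in (-1)..1, mollifier y) *
    ∫ τ in (-((E + t) / 3))..((E + t) / 3), mollifier ((x - τ) / ((E - t / 2) / 3))

/-- The bump `g_{E,t}` centred at `c`, viewed on the circle `ℝ / 2πℤ`. -/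
def circleBump (E t c x : ℝ) : ℝ := bump E t (toIocMod Real.two_pi_pos (-π) (x - c))

/-- The bump of the localization step around the initial estimate `c`, for jump separation `J₃`:
`E = J₃` and `t = 2 J₃ / 3`. -/
def locBump (J₃ c : ℝ) : ℝ → ℝ := circleBump J₃ (2 * (J₃ / 3)) c

/-- The truncated convolution `∑_{|i| ≤ 2M} c_i(f) c_{k-i}(g)`. -/
def truncConv (f g : ℝ → ℝ) (M : ℕ) (k : ℤ) : ℂ :=
  ∑ i ∈ Finset.Icc (-(2 * (M : ℤ))) (2 * (M : ℤ)), fc f i * fc g (k - i)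

/-! ### Resolution of a single jump from (approximate) Fourier coefficients `c` -/

/-- `r_k = 2π (ik)^{d+1} c_k`. -/
def scaledCoeff (d : ℕ) (c : ℤ → ℂ) (k : ℕ) : ℂ :=
  2 * π * (Complex.I * k) ^ (d + 1) * c k

/-- `q_M(z) = ∑_{j=0}^{d+1} (-1)^j binom(d+1, j) r_{M+j} z^{d+1-j}`. -/
def eliminant (d : ℕ) (c : ℤ → ℂ) (M : ℕ) : ℂ[X] :=
  ∑ j ∈ Finset.range (d + 2),
    C ((-1) ^ j * (Nat.choose (d + 1) j : ℂ) * scaledCoeff d c (M + j)) * X ^ (d + 1 - j)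

/-- `w` is a root of `q` which is closest to the unit circle. -/
def IsClosestRoot (q : ℂ[X]) (w : ℂ) : Prop :=
  w ∈ q.roots ∧ ∀ z ∈ q.roots, |‖w‖ - 1| ≤ |‖z‖ - 1|

/-- `B` solves `r_k w^{-k} = ∑_{l=0}^{d} (ik)^{d-l} B_l` for `k = M, …, M + d`. -/
def SolvesMagnitudes (d : ℕ) (c : ℤ → ℂ) (M : ℕ) (w : ℂ) (B : Fin (d + 1) → ℂ) : Prop :=
  ∀ k ∈ Finset.Icc M (M + d),
    scaledCoeff d c k * w ^ (-(k : ℤ)) =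
      ∑ l : Fin (d + 1), (Complex.I * k) ^ (d - (l : ℕ)) * B l

/-! ### Initial estimates (Prony's method) -/

/-- `q` solves `∑_{l < K} r_{M+i+l} q_l = -r_{M+K+i}` for `i = 0, …, K-1`, with
`r_k = 2π (ik) c_k`. -/
def SolvesProny (K : ℕ) (c : ℤ → ℂ) (M : ℕ) (q : Fin K → ℂ) : Prop :=
  ∀ i : Fin K, ∑ l : Fin K, scaledCoeff 0 c (M + i + l) * q l = -scaledCoeff 0 c (M + K + i)

/-- `X^K + ∑_{l < K} q_l X^l`. -/
def pronyPoly (K : ℕ) (q : Fin K → ℂ) : ℂ[X] := X ^ K + ∑ l : Fin K, C (q l) * X ^ (l : ℕ)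

/-! ### Quantities in the error bounds -/

/-- The generalized Laguerre polynomial `∑_{m=0}^{n} binom(n+α, n-m) (-x)^m / m!`. -/
def laguerre (α n : ℕ) : ℝ[X] :=
  ∑ m ∈ Finset.range (n + 1),
    C ((Nat.choose (n + α) (n - m) : ℝ) * (-1) ^ m / (Nat.factorial m : ℝ)) * X ^ m

/-- The points `y_0 = ω` and `y_i = ω / (1 - φ_i / M)`, `i = 1, …, d`. -/
def modelRoot {d : ℕ} (φ : Fin d → ℝ) (w : ℂ) (M : ℕ) : Fin (d + 1) → ℂ :=
  Fin.cons w (fun i => w / (1 - ((φ i / M : ℝ) : ℂ)))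

/-- `H = A* + A** + R`, where `A* = max(1, ∑_{l ≤ d} |a_l|)` and
`A** = max(1, ∑_{d < l ≤ d₁} |a_l|)`. -/
def sizeH (d d₁ : ℕ) (a : ℕ → ℝ) (R : ℝ) : ℝ :=
  max 1 (∑ l ∈ Finset.range (d + 1), |a l|) + max 1 (∑ l ∈ Finset.Ioc d d₁, |a l|) + R

end PiecewiseFourier

end

open PiecewiseFourier

/-!
The argument has three largely independent parts.

*A single jump.* Suppose `c k` agrees with the Fourier coefficients
`∑ l, A l * w ^ k / (2π (ik)^(l+1))` of a piecewise polynomial with one discontinuity up to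
`O(H / M ^ (d₁ + 2))` on the window `M, …, M + d + 1`. Multiplying by `2π (ik)^(d+1) w ^ (-k)` gives a
sequence which, up to a negligible error, is a combination of the powers `k ^ (d - l)`, so that each
difference gains a factor `1 / M` (`exists_diffBound_demod`). The value of the eliminant at
`w / (1 - x / M)` is a combination of such differences (`eval_eliminant`). Its leading part is a
multiple of `x * L(x)`, with `L` the Laguerre polynomial with parameter `1`; hence the eliminant is
small at the model roots, and much smaller at `w` itself, where its value is a single difference of
order `d + 1`, which kills the polynomial part. A polynomial that is small at as many separated points
as its degree has one root close to each of them (`exists_perm_norm_sub_le`). This gives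
`exists_eliminant_roots_near`. The zeros of `L` are real, positive and simple by Rolle's theorem applied
to Rodrigues' formula (`exists_roots_laguerre`). For the magnitudes, the coefficients of a polynomial
are bounded by its differences at one point, so that the linear system is invertible with good bounds
(`exists_magnitudes`).

*Localization.* The coefficients of the bump of width `J` decay like `J / (1 + J |m|) ^ N`, uniformly in
`J`, and by Poisson summation all their moments at a point of the plateau, or off the support, agree
with those of the constant `1`, or `0` (`tsum_moment_bumpCoeff`). Expanding `(k - m) ^ (-n)` into powers
of `m / k`, one finds that multiplication by the bump either preserves the Fourier coefficients of a
sawtooth function or destroys them, up to `O((J k) ^ (-P))` for every `P`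
(`exists_norm_fc_sawtooth_mul_sub_le`). When the hypothesis concerns the global smooth part, the
magnitudes at the other jumps enter the error. They are bounded polynomially in `M` by applying the
same estimate with bumps centred at all the jumps and absorbing (`exists_forall_abs_jump_le`). Finally,
`M > C₅ H` forces `(J₃ M) ^ 2 ≥ M`, because `H ≥ J₁ / J₃ ^ (d₁ + 1)`; so a large power of `J₃ M` beats
every power of `M` and of `1 / J₃` (`exists_localization`).

*Initial estimates.* The numbers `2π (ik) c_k` form an exponential sum up to noise `T / k`. Inverting a
Vandermonde matrix with separated nodes shows that the Prony polynomial is small at all the points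
`node (ξ j)`, and the same estimate for the homogeneous system shows that it is determined uniquely;
its roots are then located as above (`exists_initial_estimates`).
-/

noncomputable section

namespace PiecewiseFourier

open Polynomial Filter

/-! ### Sequences with decaying finite differences -/

/-- On the window `M, …, M + D`, the differences of `f` of order `m ≤ D` are at most `B / M ^ m`:
the discrete counterpart of a symbol estimate, satisfied by `k ^ s` with `B` of order `M ^ s`. -/
def DiffBound (M D : ℕ) (B : ℝ) (f : ℕ → ℂ) : Prop :=
  ∀ m i, m + i ≤ D → ‖(fwdDiff 1)^[m] f (M + i)‖ ≤ B / (M : ℝ) ^ m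

namespace DiffBound

variable {M D : ℕ} {B B' : ℝ} {f g : ℕ → ℂ}

lemma nonneg (h : DiffBound M D B f) : 0 ≤ B := by
  have := h 0 0 (Nat.zero_le _)
  simp only [pow_zero, div_one] at this
  exact (norm_nonneg _).trans this

lemma mono (h : DiffBound M D B f) (hB : B ≤ B') : DiffBound M D B' f := fun m i hmi =>
  (h m i hmi).trans (by gcongr)

lemma add (hf : DiffBound M D B f) (hg : DiffBound M D B' g) :
    DiffBound M D (B + B') (fun k => f k + g k) := by
  intro m i hmi
  have : (fwdDiff 1)^[m] (fun k => f k + g k) = (fwdDiff 1)^[m] f + (fwdDiff 1)^[m] g :=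
    fwdDiff_iter_add 1 f g m
  rw [this, add_div]
  exact (norm_add_le _ _).trans (add_le_add (hf m i hmi) (hg m i hmi))

lemma const_mul (hf : DiffBound M D B f) (a : ℂ) :
    DiffBound M D (‖a‖ * B) (fun k => a * f k) := by
  intro m i hmi
  have : (fwdDiff 1)^[m] (fun k => a * f k) = a • (fwdDiff 1)^[m] f :=
    fwdDiff_iter_const_smul 1 a f m
  rw [this, mul_div_assoc, Pi.smul_apply, smul_eq_mul, norm_mul]
  exact mul_le_mul_of_nonneg_left (hf m i hmi) (norm_nonneg _)

lemma zero : DiffBound M D 0 (fun _ => 0) := by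
  intro m i _
  have : (fwdDiff 1)^[m] (fun _ : ℕ => (0 : ℂ)) = 0 := by
    have := fwdDiff_iter_const_smul (M := ℕ) 1 (0 : ℂ) (fun _ => (0 : ℂ)) m
    rw [zero_smul, zero_smul] at this
    exact this
  simp [this]

lemma sum {ι : Type*} (s : Finset ι) {b : ι → ℝ} {F : ι → ℕ → ℂ}
    (h : ∀ i ∈ s, DiffBound M D (b i) (F i)) :
    DiffBound M D (∑ i ∈ s, b i) (fun k => ∑ i ∈ s, F i k) := by
  classical
  induction s using Finset.induction_on with
  | empty => simpa using zero
  | insert a s ha ih =>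
    simp only [Finset.sum_insert ha]
    exact (h a (by simp)).add (ih fun i hi => h i (by simp [hi]))

lemma shift (h : DiffBound M (D + 1) B f) : DiffBound M D B (fun k => f (k + 1)) := by
  intro m i hmi
  have := h m (i + 1) (by omega)
  rwa [← add_assoc, ← fwdDiff_iter_comp_add] at this

lemma diff (h : DiffBound M (D + 1) B f) : DiffBound M D (B / M) (fwdDiff 1 f) := by
  intro m i hmi
  have := h (m + 1) i (by omega)
  rw [Function.iterate_succ_apply] at this
  refine this.trans_eq ?_
  rw [pow_succ', div_div]

lemma mul_aux (m : ℕ) : ∀ {D : ℕ} {B B' : ℝ} {f g : ℕ → ℂ}, DiffBound M D B f →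
    DiffBound M D B' g → ∀ i, m + i ≤ D →
    ‖(fwdDiff 1)^[m] (fun k => f k * g k) (M + i)‖ ≤ 2 ^ m * (B * B') / (M : ℝ) ^ m := by
  induction m with
  | zero =>
    intro D B B' f g hf hg i hi
    have h1 := hf 0 i hi
    have h2 := hg 0 i hi
    simp only [Function.iterate_zero, id_eq, pow_zero, div_one, one_mul, norm_mul] at *
    exact mul_le_mul h1 h2 (norm_nonneg _) hf.nonneg
  | succ m ih =>
    intro D B B' f g hf hg i hi
    obtain ⟨D, rfl⟩ : ∃ D', D = D' + 1 := ⟨D - 1, by omega⟩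
    have hfun : fwdDiff 1 (fun k => f k * g k) =
        (fun k => f (k + 1) * fwdDiff 1 g k) + (fun k => fwdDiff 1 f k * g k) := by
      funext k
      simp only [fwdDiff, Pi.add_apply]
      ring
    have hg' : DiffBound M D B' g := fun m i h => hg m i (by omega)
    have h1 := ih hf.shift hg.diff i (by omega)
    have h2 := ih hf.diff hg' i (by omega)
    rw [Function.iterate_succ_apply, hfun, fwdDiff_iter_add, Pi.add_apply]
    refine (norm_add_le _ _).trans ((add_le_add h1 h2).trans_eq ?_)
    rw [pow_succ (M : ℝ), mul_comm ((M : ℝ) ^ m), ← div_div]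
    ring

/-- The discrete Leibniz rule. -/
lemma mul (hf : DiffBound M D B f) (hg : DiffBound M D B' g) :
    DiffBound M D (2 ^ D * (B * B')) (fun k => f k * g k) := by
  intro m i hmi
  refine (mul_aux m hf hg i hmi).trans ?_
  have := mul_nonneg hf.nonneg hg.nonneg
  gcongr
  · norm_num
  · omega

lemma const (a : ℂ) : DiffBound M D ‖a‖ (fun _ => a) := by
  intro m i _
  cases m with
  | zero => simp
  | succ m =>
    rw [Function.iterate_succ_apply, fwdDiff_const]
    have := zero (M := M) (D := m + i) m i le_rfl
    rw [zero_div] at this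
    exact this.trans (by positivity)

/-- A sequence which is merely small satisfies the difference bounds at the cost of `M ^ D`. -/
lemma of_norm_le (hM : 1 ≤ M) {ε : ℝ} (h : ∀ i ≤ D, ‖f (M + i)‖ ≤ ε) :
    DiffBound M D (2 ^ D * ε * (M : ℝ) ^ D) f := by
  have hM' : (1 : ℝ) ≤ M := by exact_mod_cast hM
  have hε : 0 ≤ ε := (norm_nonneg _).trans (h 0 (Nat.zero_le _))
  have key : ∀ m i, m + i ≤ D → ‖(fwdDiff 1)^[m] f (M + i)‖ ≤ 2 ^ m * ε := by
    intro m
    induction m with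
    | zero => intro i hi; simpa using h i (by omega)
    | succ m ih =>
      intro i hi
      rw [Function.iterate_succ_apply', fwdDiff]
      have h1 := ih (i + 1) (by omega)
      have h2 := ih i (by omega)
      calc _ ≤ 2 ^ m * ε + 2 ^ m * ε := (norm_sub_le _ _).trans (add_le_add h1 h2)
        _ = _ := by ring
  intro m i hmi
  rw [le_div_iff₀ (by positivity)]
  refine mul_le_mul ((key m i hmi).trans ?_) ?_ (by positivity) (by positivity)
  · gcongr
    · norm_num
    · omega
  · exact pow_le_pow_right₀ hM' (by omega)

lemma natCast (hM : 1 ≤ M) : DiffBound M D ((D + 1) * M) (fun k => (k : ℂ)) := by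
  have hM' : (1 : ℝ) ≤ M := by exact_mod_cast hM
  intro m i hmi
  have hd : fwdDiff 1 (fun k : ℕ => (k : ℂ)) = fun _ => 1 := by
    funext k; simp [fwdDiff]
  rcases m with _ | m
  · simp only [Function.iterate_zero, id_eq, pow_zero, div_one, Complex.norm_natCast]
    have : (i : ℝ) ≤ D := by exact_mod_cast (by omega : i ≤ D)
    push_cast
    nlinarith [(Nat.cast_nonneg i : (0 : ℝ) ≤ i)]
  · rw [Function.iterate_succ_apply, hd]
    have := const (M := M) (D := D) 1 m i (by omega)
    refine this.trans ?_
    rw [pow_succ', ← div_div, norm_one]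
    gcongr
    rw [mul_div_assoc, div_self (by positivity), mul_one]
    have := (Nat.cast_nonneg D : (0 : ℝ) ≤ D)
    linarith

end DiffBound

lemma fwdDiff_iter_inv (m k : ℕ) (hk : 1 ≤ k) :
    (fwdDiff 1)^[m] (fun k : ℕ => ((k : ℂ))⁻¹) k =
      (-1) ^ m * (m.factorial : ℂ) / ∏ t ∈ Finset.range (m + 1), ((k : ℂ) + t) := by
  induction m generalizing k with
  | zero => simp
  | succ m ih =>
    have hne : ∀ n : ℕ, ((k : ℂ) + n) ≠ 0 := fun n => by
      exact_mod_cast (by omega : k + n ≠ 0)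
    rw [Function.iterate_succ_apply', fwdDiff, ih k hk, ih (k + 1) (by omega)]
    set P : ℂ := ∏ t ∈ Finset.range m, ((k : ℂ) + (t + 1 : ℕ)) with hP
    have hP0 : P ≠ 0 := Finset.prod_ne_zero_iff.2 fun t _ => hne _
    have e1 : ∏ t ∈ Finset.range (m + 1), (((k + 1 : ℕ) : ℂ) + t) = P * (k + (m + 1 : ℕ)) := by
      rw [hP, Finset.prod_range_succ]
      congr 1
      · refine Finset.prod_congr rfl fun t _ => ?_
        push_cast; ring
      · push_cast; ring
    have e2 : ∏ t ∈ Finset.range (m + 1), ((k : ℂ) + t) = P * k := by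
      rw [hP, Finset.prod_range_succ']
      simp
    have e3 : ∏ t ∈ Finset.range (m + 1 + 1), ((k : ℂ) + t) = P * k * (k + (m + 1 : ℕ)) := by
      rw [Finset.prod_range_succ, e2]
    have h0 := hne 0
    have h1 := hne (m + 1)
    rw [e1, e2, e3, Nat.factorial_succ]
    simp only [Nat.cast_zero, add_zero] at h0
    field_simp
    push_cast
    ring

lemma DiffBound.inv {M : ℕ} (D : ℕ) (hM : 1 ≤ M) :
    DiffBound M D (D.factorial * (M : ℝ)⁻¹) (fun k => ((k : ℂ))⁻¹) := by
  have hM' : (1 : ℝ) ≤ M := by exact_mod_cast hM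
  intro m i hmi
  rw [fwdDiff_iter_inv m (M + i) (by omega), norm_div, norm_mul, norm_pow, norm_neg, norm_one,
    one_pow, one_mul, Complex.norm_natCast, norm_prod]
  have h1 : (M : ℝ) ^ (m + 1) ≤ ∏ t ∈ Finset.range (m + 1), ‖((M + i : ℕ) : ℂ) + t‖ := by
    calc (M : ℝ) ^ (m + 1) = ∏ _t ∈ Finset.range (m + 1), (M : ℝ) := by simp
      _ ≤ _ := by
        refine Finset.prod_le_prod (fun _ _ => by positivity) fun t _ => ?_
        rw [← Nat.cast_add, Complex.norm_natCast]
        exact_mod_cast (by omega : M ≤ M + i + t)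
  calc _ ≤ (m.factorial : ℝ) / (M : ℝ) ^ (m + 1) := by gcongr
    _ ≤ (D.factorial : ℝ) / (M : ℝ) ^ (m + 1) := by
      gcongr; omega
    _ = _ := by rw [pow_succ']; field_simp

lemma exists_diffBound_zpow (D : ℕ) (s : ℤ) :
    ∃ C : ℝ, 0 < C ∧ ∀ M : ℕ, 1 ≤ M → DiffBound M D (C * (M : ℝ) ^ s) (fun k => (k : ℂ) ^ s) := by
  have key : ∀ (n : ℕ) (ε : ℤ) (F : ℕ → ℂ) (c : ℝ), 0 < c →
      (∀ M : ℕ, 1 ≤ M → DiffBound M D (c * (M : ℝ) ^ ε) F) →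
      ∃ C : ℝ, 0 < C ∧ ∀ M : ℕ, 1 ≤ M →
        DiffBound M D (C * (M : ℝ) ^ (ε * n)) (fun k => F k ^ n) := by
    intro n ε F c hc h
    induction n with
    | zero =>
      refine ⟨1, one_pos, fun M hM => ?_⟩
      simpa using DiffBound.const (M := M) (D := D) 1
    | succ n ih =>
      obtain ⟨C, hC, hn⟩ := ih
      refine ⟨2 ^ D * (C * c), by positivity, fun M hM => ?_⟩
      have hM0 : (M : ℝ) ≠ 0 := by positivity
      have := (hn M hM).mul (h M hM)
      simp only [pow_succ]
      refine this.mono (le_of_eq ?_)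
      push_cast
      rw [mul_add, mul_one, zpow_add₀ hM0]
      ring
  obtain ⟨n, rfl | rfl⟩ := s.eq_nat_or_neg
  · obtain ⟨C, hC, h⟩ := key n 1 (fun k => (k : ℂ)) (D + 1) (by positivity)
      (fun M hM => by simpa using DiffBound.natCast hM)
    exact ⟨C, hC, fun M hM => by simpa using h M hM⟩
  · obtain ⟨C, hC, h⟩ := key n (-1) (fun k => (k : ℂ)⁻¹) D.factorial
      (by exact_mod_cast D.factorial_pos) (fun M hM => by simpa using DiffBound.inv D hM)
    exact ⟨C, hC, fun M hM => by simpa using h M hM⟩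

/-- `k ^ d` has the same differences as a monomial has derivatives, up to lower order. -/
lemma exists_fwdDiff_iter_pow_sub_le (D n d : ℕ) :
    ∃ C : ℝ, 0 < C ∧ ∀ M : ℕ, 1 ≤ M → ∀ i, n + i ≤ D →
      ‖(fwdDiff 1)^[n] (fun k : ℕ => (k : ℂ) ^ d) (M + i) -
        (d.descFactorial n : ℂ) * (M : ℂ) ^ ((d : ℤ) - n)‖ ≤ C * (M : ℝ) ^ ((d : ℤ) - n - 1) := by
  induction n generalizing d with
  | zero =>
    induction d with
    | zero => exact ⟨1, one_pos, fun M hM i _ => by simp⟩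
    | succ d ih =>
      obtain ⟨C, hC, h⟩ := ih
      refine ⟨(D + 1) * C + D, by positivity, fun M hM i hi => ?_⟩
      have hM' : (1 : ℝ) ≤ M := by exact_mod_cast hM
      have hM0 : (M : ℝ) ≠ 0 := by positivity
      have hMc : (M : ℂ) ≠ 0 := by exact_mod_cast hM0
      have hiD : (i : ℝ) ≤ D := by exact_mod_cast (by omega : i ≤ D)
      have hh := h M hM i hi
      simp only [Function.iterate_zero, id_eq, Nat.descFactorial_zero, Nat.cast_one, one_mul,
        Nat.cast_zero, sub_zero, zpow_natCast] at hh ⊢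
      have e : ((M + i : ℕ) : ℂ) ^ (d + 1) - (M : ℂ) ^ (d + 1) =
          ((M + i : ℕ) : ℂ) * (((M + i : ℕ) : ℂ) ^ d - (M : ℂ) ^ d) + i * (M : ℂ) ^ d := by
        push_cast; ring
      rw [e]
      have h1 : ‖((M + i : ℕ) : ℂ)‖ ≤ (D + 1) * M := by
        rw [Complex.norm_natCast]; push_cast
        nlinarith [(Nat.cast_nonneg i : (0 : ℝ) ≤ i)]
      have hz : (M : ℝ) * (M : ℝ) ^ ((d : ℤ) - 1) = (M : ℝ) ^ d := by
        rw [← zpow_one_add₀ hM0]; simp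
      calc _ ≤ ((D + 1) * M) * (C * (M : ℝ) ^ ((d : ℤ) - 1)) + D * (M : ℝ) ^ d := by
            refine (norm_add_le _ _).trans (add_le_add ?_ ?_)
            · rw [norm_mul]; gcongr
            · rw [norm_mul, norm_pow, Complex.norm_natCast, Complex.norm_natCast]; gcongr
        _ = ((D + 1) * C) * (M * (M : ℝ) ^ ((d : ℤ) - 1)) + D * (M : ℝ) ^ d := by ring
        _ = _ := by rw [hz]; simp [add_mul]
  | succ n ih =>
    rcases d with _ | d
    · refine ⟨1, one_pos, fun M hM i _ => ?_⟩
      rw [Function.iterate_succ_apply]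
      simp only [pow_zero, fwdDiff_const]
      have := DiffBound.zero (M := M) (D := n + i) n i le_rfl
      rw [zero_div] at this
      have h0 := norm_le_zero_iff.1 this
      rw [h0]
      simp
      positivity
    · obtain ⟨C, hC, h⟩ := ih d
      choose c hc hcb using fun t : ℕ => exists_diffBound_zpow D t
      refine ⟨(d + 1) * C + ∑ t ∈ Finset.range d, ((d + 1).choose t : ℝ) * c t, ?_,
        fun M hM i hi => ?_⟩
      · have : 0 ≤ ∑ t ∈ Finset.range d, ((d + 1).choose t : ℝ) * c t :=
          Finset.sum_nonneg fun t _ => mul_nonneg (by positivity) (hc t).le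
        positivity
      have hM' : (1 : ℝ) ≤ M := by exact_mod_cast hM
      have hM0 : (M : ℝ) ≠ 0 := by positivity
      have hdiff : fwdDiff 1 (fun k : ℕ => (k : ℂ) ^ (d + 1)) =
          ((d + 1 : ℂ) • fun k : ℕ => (k : ℂ) ^ d) +
            fun k : ℕ => ∑ t ∈ Finset.range d, ((d + 1).choose t : ℂ) * (k : ℂ) ^ (t : ℤ) := by
        funext k
        simp only [fwdDiff, Pi.add_apply, Pi.smul_apply, smul_eq_mul, zpow_natCast]
        push_cast
        rw [add_pow, Finset.sum_range_succ, Finset.sum_range_succ]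
        simp only [one_pow, mul_one, Nat.choose_self, Nat.cast_one, Nat.choose_succ_self_right]
        have : ∑ t ∈ Finset.range d, (k : ℂ) ^ t * ((d + 1).choose t : ℂ) =
          ∑ t ∈ Finset.range d, ((d + 1).choose t : ℂ) * (k : ℂ) ^ t :=
          Finset.sum_congr rfl fun t _ => mul_comm _ _
        rw [this]
        push_cast
        ring
      have hR := DiffBound.sum (Finset.range d)
        (fun t _ => (hcb t M hM).const_mul ((d + 1).choose t : ℂ)) n i (by omega)
      have hh := h M hM i (by omega)
      rw [Function.iterate_succ_apply, hdiff, fwdDiff_iter_add, fwdDiff_iter_const_smul,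
        Pi.add_apply, Pi.smul_apply, Nat.succ_descFactorial_succ, smul_eq_mul]
      have e1 : ((d + 1 : ℕ) : ℤ) - ((n + 1 : ℕ) : ℤ) = (d : ℤ) - n := by push_cast; ring
      rw [e1]
      set X := (fwdDiff 1)^[n] (fun k : ℕ => (k : ℂ) ^ d) (M + i)
      set Y := (fwdDiff 1)^[n]
        (fun k : ℕ => ∑ t ∈ Finset.range d, ((d + 1).choose t : ℂ) * (k : ℂ) ^ (t : ℤ)) (M + i)
      have e2 : (d + 1 : ℂ) * X + Y - (((d + 1) * d.descFactorial n : ℕ) : ℂ) * (M : ℂ) ^ ((d : ℤ) - n)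
          = (d + 1 : ℂ) * (X - (d.descFactorial n : ℂ) * (M : ℂ) ^ ((d : ℤ) - n)) + Y := by
        push_cast; ring
      rw [e2, add_mul _ _ ((M : ℝ) ^ ((d : ℤ) - n - 1))]
      refine (norm_add_le _ _).trans (add_le_add ?_ (hR.trans ?_))
      · rw [norm_mul, mul_assoc]
        have : ‖(d + 1 : ℂ)‖ = d + 1 := by
          rw [← Nat.cast_add_one, Complex.norm_natCast]; push_cast; rfl
        rw [this]
        gcongr
      · rw [Finset.sum_div, Finset.sum_mul]
        refine Finset.sum_le_sum fun t ht => ?_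
        have ht : t < d := Finset.mem_range.1 ht
        rw [Complex.norm_natCast, mul_assoc, mul_div_assoc, mul_div_assoc]
        have h3 : (M : ℝ) ^ (t : ℤ) / (M : ℝ) ^ n ≤ (M : ℝ) ^ ((d : ℤ) - n - 1) := by
          rw [← zpow_natCast (M : ℝ) n, ← zpow_sub₀ hM0]
          exact zpow_le_zpow_right₀ hM' (by omega)
        have := (hc t).le
        gcongr

lemma fwdDiff_iter_natCast_comp (f : ℂ → ℂ) (n k : ℕ) :
    (fwdDiff 1)^[n] (fun k : ℕ => f k) k = (fwdDiff 1)^[n] f (k : ℂ) := by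
  induction n generalizing k with
  | zero => rfl
  | succ n ih =>
    rw [Function.iterate_succ_apply', Function.iterate_succ_apply', fwdDiff, fwdDiff, ih, ih]
    push_cast
    rfl

lemma fwdDiff_iter_zpow_eq_zero {n s : ℕ} (h : s < n) (k : ℕ) :
    (fwdDiff 1)^[n] (fun k : ℕ => (k : ℂ) ^ (s : ℤ)) k = 0 := by
  simp only [zpow_natCast]
  rw [fwdDiff_iter_natCast_comp (fun z => z ^ s), fwdDiff_iter_pow_eq_zero_of_lt h]
  rfl

/-- The coefficients of a polynomial are controlled by its differences at one point. -/
lemma exists_coeff_le_of_fwdDiff_le (d : ℕ) :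
    ∃ C : ℝ, 0 < C ∧ ∀ M : ℕ, 1 ≤ M → ∀ (B : ℝ) (a : ℕ → ℂ),
      (∀ n ≤ d, ‖(fwdDiff 1)^[n] (fun k : ℕ => ∑ t ∈ Finset.range (d + 1), a t * (k : ℂ) ^ t) M‖ ≤
        B / (M : ℝ) ^ n) → ∀ t ≤ d, ‖a t‖ ≤ C * (B / (M : ℝ) ^ t) := by
  induction d with
  | zero =>
    refine ⟨1, one_pos, fun M hM B a h t ht => ?_⟩
    obtain rfl : t = 0 := by omega
    simpa using h 0 le_rfl
  | succ d ih =>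
    obtain ⟨C, hC, hd⟩ := ih
    obtain ⟨c, hc, hpow⟩ := exists_diffBound_zpow (d + 1) (d + 1 : ℕ)
    refine ⟨1 + C * (1 + c), by positivity, fun M hM B a h => ?_⟩
    have hM' : (1 : ℝ) ≤ M := by exact_mod_cast hM
    have hM0 : (M : ℝ) ≠ 0 := by positivity
    have hB : 0 ≤ B := by
      have := h 0 (by omega)
      simp only [pow_zero, div_one] at this
      exact (norm_nonneg _).trans this
    set p : ℕ → ℂ := fun k => ∑ t ∈ Finset.range (d + 1), a t * (k : ℂ) ^ t with hp
    have hsplit : (fun k : ℕ => ∑ t ∈ Finset.range (d + 1 + 1), a t * (k : ℂ) ^ t) =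
        p + a (d + 1) • fun k : ℕ => (k : ℂ) ^ ((d + 1 : ℕ) : ℤ) := by
      funext k
      rw [Finset.sum_range_succ, Pi.add_apply, Pi.smul_apply, zpow_natCast, smul_eq_mul]
    rw [hsplit] at h
    have htop : ‖a (d + 1)‖ ≤ B / (M : ℝ) ^ (d + 1) := by
      have h1 := h (d + 1) le_rfl
      have hz : (fwdDiff 1)^[d + 1] p M = 0 := by
        have := fwdDiff_iter_sum_mul_pow_eq_zero (R := ℂ) (n := d + 1) a
        rw [hp, fwdDiff_iter_natCast_comp (fun z => ∑ t ∈ Finset.range (d + 1), a t * z ^ t), this]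
        rfl
      have hf : (fwdDiff 1)^[d + 1] (fun k : ℕ => (k : ℂ) ^ ((d + 1 : ℕ) : ℤ)) M =
          ((d + 1).factorial : ℂ) := by
        simp only [zpow_natCast]
        rw [fwdDiff_iter_natCast_comp (fun z => z ^ (d + 1)), fwdDiff_iter_eq_factorial]
        simp
      rw [fwdDiff_iter_add, fwdDiff_iter_const_smul, Pi.add_apply, Pi.smul_apply, hz, hf, zero_add,
        smul_eq_mul, norm_mul, Complex.norm_natCast] at h1
      refine le_trans ?_ h1
      exact le_mul_of_one_le_right (norm_nonneg _) (by exact_mod_cast (d + 1).factorial_pos)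
    have hlow : ∀ n ≤ d, ‖(fwdDiff 1)^[n] p M‖ ≤ ((1 + c) * B) / (M : ℝ) ^ n := by
      intro n hn
      have h1 := h n (by omega)
      have h2 := hpow M hM n 0 (by omega)
      rw [fwdDiff_iter_add, fwdDiff_iter_const_smul, Pi.add_apply, Pi.smul_apply] at h1
      set q := (fwdDiff 1)^[n] (fun k : ℕ => (k : ℂ) ^ ((d + 1 : ℕ) : ℤ)) (M + 0) with hq
      rw [add_zero] at hq
      rw [← hq] at h1
      have h3 : ‖a (d + 1) • q‖ ≤ c * B / (M : ℝ) ^ n := by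
        rw [smul_eq_mul, norm_mul]
        refine (mul_le_mul htop h2 (norm_nonneg _) (by positivity)).trans_eq ?_
        rw [zpow_natCast]
        field_simp
      calc _ = ‖((fwdDiff 1)^[n] p M + a (d + 1) • q) - a (d + 1) • q‖ := by ring_nf
        _ ≤ B / (M : ℝ) ^ n + c * B / (M : ℝ) ^ n :=
          (norm_sub_le _ _).trans (add_le_add h1 h3)
        _ = _ := by ring
    intro t ht
    rcases Nat.lt_or_ge d t with h' | h'
    · obtain rfl : t = d + 1 := by omega
      refine htop.trans (le_mul_of_one_le_left (by positivity) ?_)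
      nlinarith
    · refine (hd M hM _ a hlow t h').trans ?_
      have : 0 ≤ B / (M : ℝ) ^ t := by positivity
      calc _ = (C * (1 + c)) * (B / (M : ℝ) ^ t) := by ring
        _ ≤ _ := by gcongr; linarith

/-- Expansion of `(1 - (1 - h) E) ^ D` in powers of `h`, where `E` is the shift: applied to `ρ` it
turns the alternating binomial sum into differences of lower and lower order. -/
lemma sum_choose_mul_pow_eq_fwdDiff (ρ : ℕ → ℂ) (M D : ℕ) (h : ℂ) :
    ∑ m ∈ Finset.range (D + 1), (-1) ^ m * (D.choose m : ℂ) * ρ (M + m) * (1 - h) ^ m =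
      ∑ j ∈ Finset.range (D + 1),
        (D.choose j : ℂ) * h ^ j * (-1) ^ (D - j) * (fwdDiff 1)^[D - j] ρ (M + j) := by
  let S : Module.End ℂ (ℕ → ℂ) := LinearMap.funLeft ℂ ℂ (· + 1)
  have hS : ∀ (m : ℕ) (σ : ℕ → ℂ) (k : ℕ), (S ^ m) σ k = σ (k + m) := by
    intro m
    induction m with
    | zero => intro σ k; simp
    | succ m ih =>
      intro σ k
      rw [pow_succ, Module.End.mul_apply, ih]
      simp [S, LinearMap.funLeft_apply, add_assoc]
  have hΔ : ∀ (m : ℕ) (σ : ℕ → ℂ), ((S - 1) ^ m) σ = (fwdDiff 1)^[m] σ := by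
    intro m
    induction m with
    | zero => intro σ; simp
    | succ m ih =>
      intro σ
      rw [pow_succ, Module.End.mul_apply, ih, Function.iterate_succ_apply]
      rfl
  have e1 : ((1 : ℂ[X]) - C (1 - h) * X) ^ D = ∑ m ∈ Finset.range (D + 1),
      C ((-1) ^ m * (D.choose m : ℂ) * (1 - h) ^ m) * X ^ m := by
    rw [sub_eq_neg_add, add_pow]
    refine Finset.sum_congr rfl fun m _ => ?_
    simp only [map_mul, map_pow, map_neg, map_one, map_natCast, map_sub, one_pow]
    rw [neg_pow, mul_pow]
    ring
  have e2 : ((1 : ℂ[X]) - C (1 - h) * X) ^ D = ∑ j ∈ Finset.range (D + 1),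
      C ((D.choose j : ℂ) * h ^ j * (-1) ^ (D - j)) * (X ^ j * (X - 1) ^ (D - j)) := by
    have : (1 : ℂ[X]) - C (1 - h) * X = C h * X + -(X - 1) := by
      rw [map_sub, map_one]; ring
    rw [this, add_pow]
    refine Finset.sum_congr rfl fun j _ => ?_
    simp only [map_mul, map_pow, map_neg, map_one, map_natCast]
    rw [neg_pow (X - 1 : ℂ[X]), mul_pow]
    ring
  have hA : ∀ (a : ℂ) (p : ℂ[X]), (aeval S (C a * p)) ρ M = a * (aeval S p) ρ M := by
    intro a p
    rw [C_mul', map_smul, LinearMap.smul_apply, Pi.smul_apply, smul_eq_mul]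
  have e3 := congrFun (LinearMap.congr_fun (congrArg (aeval S) (e1.symm.trans e2)) ρ) M
  rw [map_sum, map_sum, LinearMap.sum_apply, LinearMap.sum_apply, Finset.sum_apply,
    Finset.sum_apply] at e3
  simp only [hA] at e3
  simp only [map_mul, map_pow, map_sub, map_one, aeval_X, Module.End.mul_apply, hS, hΔ] at e3
  rw [← e3]
  refine Finset.sum_congr rfl fun m _ => by ring

/-! ### Zeros of the Laguerre polynomials -/

lemma hasDerivAt_exp_neg_mul_eval (P : ℝ[X]) (x : ℝ) :
    HasDerivAt (fun x => Real.exp (-x) * P.eval x)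
      (-(Real.exp (-x) * (P - derivative P).eval x)) x := by
  have h := ((hasDerivAt_id x).neg.exp).mul (P.hasDerivAt x)
  refine h.congr_deriv ?_
  simp only [eval_sub]
  change Real.exp (-x) * -1 * eval x P + Real.exp (-x) * eval x (derivative P) = _
  ring

/-- Rolle's theorem for `e^{-x} P(x)`. -/
lemma exists_root_sub_derivative (P : ℝ[X]) {a b : ℝ} (hab : a < b)
    (h : Real.exp (-a) * P.eval a = Real.exp (-b) * P.eval b) :
    ∃ t ∈ Set.Ioo a b, (P - derivative P).eval t = 0 := by
  obtain ⟨t, ht, h0⟩ := exists_hasDerivAt_eq_zero hab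
    (fun x _ => (hasDerivAt_exp_neg_mul_eval P x).continuousAt.continuousWithinAt) h
    (fun x _ => hasDerivAt_exp_neg_mul_eval P x)
  refine ⟨t, ht, ?_⟩
  have := (Real.exp_pos (-t)).ne'
  simpa [this] using h0

/-- Rolle's theorem for `e^{-x} P(x)` on a half-line, where the second zero is at infinity. -/
lemma exists_root_sub_derivative_gt (P : ℝ[X]) (hdeg : 0 < P.degree) (hlead : 0 ≤ P.leadingCoeff)
    {a : ℝ} (ha : P.eval a = 0) : ∃ t, a < t ∧ (P - derivative P).eval t = 0 := by
  have htop := P.tendsto_atTop_of_leadingCoeff_nonneg hdeg hlead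
  have hF : Tendsto (fun x => Real.exp (-x) * P.eval x) atTop (𝓝 0) := by
    refine (P.tendsto_div_exp_atTop).congr fun x => ?_
    rw [Real.exp_neg]; field_simp
  have hpos : ∀ᶠ x in atTop, 0 < P.eval x := htop.eventually_gt_atTop 0
  obtain ⟨x₁, h₁, hx₁⟩ := (hpos.and (eventually_gt_atTop a)).exists
  have hF₁ : 0 < Real.exp (-x₁) * P.eval x₁ := mul_pos (Real.exp_pos _) h₁
  obtain ⟨x₂, ⟨h₂, hlt⟩, hx₂⟩ :=
    ((hpos.and (hF.eventually_lt_const hF₁)).and (eventually_gt_atTop x₁)).exists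
  have hF₂ : 0 < Real.exp (-x₂) * P.eval x₂ := mul_pos (Real.exp_pos _) h₂
  have hcont : ContinuousOn (fun x => Real.exp (-x) * P.eval x) (Set.Icc a x₁) := fun x _ =>
    (hasDerivAt_exp_neg_mul_eval P x).continuousAt.continuousWithinAt
  obtain ⟨x₀, hx₀, he⟩ := intermediate_value_Icc hx₁.le hcont
    (show Real.exp (-x₂) * P.eval x₂ ∈ _ from ⟨by simp only [ha, mul_zero]; exact hF₂.le, hlt.le⟩)
  obtain ⟨t, ht, h0⟩ := exists_root_sub_derivative P (hx₀.2.trans_lt hx₂) he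
  exact ⟨t, hx₀.1.trans_lt ht.1, h0⟩

lemma exists_strictMono_roots_sub_derivative (P : ℝ[X]) (hdeg : 0 < P.degree)
    (hlead : 0 ≤ P.leadingCoeff) {n : ℕ} (s : Fin (n + 1) → ℝ) (hs : StrictMono s)
    (h : ∀ i, P.eval (s i) = 0) :
    ∃ t : Fin (n + 1) → ℝ, StrictMono t ∧ (∀ i, s 0 < t i) ∧
      ∀ i, (P - derivative P).eval (t i) = 0 := by
  have key : ∀ i, ∃ t, s i < t ∧ (∀ i', i < i' → t < s i') ∧ (P - derivative P).eval t = 0 := by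
    intro i
    by_cases hi : i = Fin.last n
    · obtain ⟨t, ht, h0⟩ := exists_root_sub_derivative_gt P hdeg hlead (h i)
      exact ⟨t, ht, fun i' hi' => absurd hi' (by rw [hi]; exact not_lt.2 (Fin.le_last _)), h0⟩
    · have hlt : (i : ℕ) < n := Fin.val_lt_last hi
      have hi1 : i < (⟨i + 1, by omega⟩ : Fin (n + 1)) := by
        rw [Fin.lt_def]; simp
      obtain ⟨t, ht, h0⟩ := exists_root_sub_derivative P (hs hi1) (by rw [h, h]; simp)
      refine ⟨t, ht.1, fun i' hi' => ht.2.trans_le (hs.monotone ?_), h0⟩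
      rw [Fin.le_def]
      exact hi'
  choose t ht1 ht2 ht3 using key
  exact ⟨t, fun i i' hii => (ht2 i i' hii).trans (ht1 i'),
    fun i => (hs.monotone (Fin.zero_le i)).trans_lt (ht1 i), ht3⟩

/-- The operator `(1 - d/dx) ^ j` applied to `x ^ N`, i.e. up to sign `e^x (e^{-x} x^N)^{(j)}`. -/
def rodrigues (N j : ℕ) : ℝ[X] := ((1 - derivative : Module.End ℝ ℝ[X]) ^ j) (X ^ N)

lemma rodrigues_succ (N j : ℕ) :
    rodrigues N (j + 1) = rodrigues N j - derivative (rodrigues N j) := by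
  rw [rodrigues, pow_succ', Module.End.mul_apply]
  rfl

lemma rodrigues_eq_sum (N j : ℕ) :
    rodrigues N j = ∑ k ∈ Finset.range (j + 1),
      C ((-1) ^ k * (j.choose k : ℝ) * (N.descFactorial k : ℝ)) * X ^ (N - k) := by
  have h : ((1 : ℝ[X]) - X) ^ j = ∑ k ∈ Finset.range (j + 1),
      C ((-1) ^ k * (j.choose k : ℝ)) * X ^ k := by
    rw [sub_eq_neg_add, add_pow]
    refine Finset.sum_congr rfl fun k _ => ?_
    simp only [map_mul, map_pow, map_neg, map_one, map_natCast, one_pow]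
    rw [neg_pow]
    ring
  have hA : aeval (derivative : Module.End ℝ ℝ[X]) ((1 - X) ^ j : ℝ[X]) = (1 - derivative) ^ j := by
    rw [map_pow (aeval _), map_sub (aeval _), map_one, aeval_X]
  rw [rodrigues, ← hA, h, map_sum, LinearMap.sum_apply]
  refine Finset.sum_congr rfl fun k _ => ?_
  have h1 : (derivative ^ k : Module.End ℝ ℝ[X]) (X ^ N : ℝ[X]) =
      C (N.descFactorial k : ℝ) * X ^ (N - k) := by
    rw [Module.End.pow_apply]
    simpa using iterate_derivative_X_pow_eq_natCast_mul (R := ℝ) N k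
  rw [C_mul', map_smul, LinearMap.smul_apply, map_pow (aeval _), aeval_X, h1, smul_eq_C_mul, ← mul_assoc,
    ← C_mul]

lemma rodrigues_degree_leadingCoeff (N j : ℕ) :
    (rodrigues N j).degree = N ∧ (rodrigues N j).leadingCoeff = 1 := by
  induction j with
  | zero => simp [rodrigues]
  | succ j ih =>
    have hne : rodrigues N j ≠ 0 := by
      intro h; rw [h] at ih; simp at ih
    have hlt := degree_derivative_lt hne
    rw [rodrigues_succ]
    exact ⟨(degree_sub_eq_left_of_degree_lt hlt).trans ih.1,
      (leadingCoeff_sub_of_degree_lt hlt).trans ih.2⟩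

lemma rodrigues_eval_zero {N j : ℕ} (h : j < N) : (rodrigues N j).eval 0 = 0 := by
  rw [rodrigues_eq_sum, eval_finsetSum]
  refine Finset.sum_eq_zero fun k hk => ?_
  have : N - k ≠ 0 := by have := Finset.mem_range.1 hk; omega
  simp [this]

/-- Each application of `1 - d/dx` gains one positive root: between `0` and the first root, between
consecutive roots, and after the last one. -/
lemma exists_pos_roots_rodrigues (N j : ℕ) (h : j ≤ N) :
    ∃ t : Fin j → ℝ, StrictMono t ∧ (∀ i, 0 < t i) ∧ ∀ i, (rodrigues N j).eval (t i) = 0 := by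
  induction j with
  | zero => exact ⟨Fin.elim0, fun i => i.elim0, fun i => i.elim0, fun i => i.elim0⟩
  | succ j ih =>
    obtain ⟨t, ht, hpos, h0⟩ := ih (by omega)
    obtain ⟨hd, hl⟩ := rodrigues_degree_leadingCoeff N j
    have hmono : StrictMono (Fin.cons 0 t : Fin (j + 1) → ℝ) := by
      intro i i' hii
      induction i' using Fin.cases with
      | zero => exact absurd hii (Fin.not_lt_zero i)
      | succ i' =>
        induction i using Fin.cases with
        | zero => simpa using hpos i'
        | succ i => simpa using ht (Fin.succ_lt_succ_iff.1 hii)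
    obtain ⟨u, hu, hupos, hu0⟩ := exists_strictMono_roots_sub_derivative (rodrigues N j)
      (by rw [hd]; exact_mod_cast (by omega : 0 < N)) (by rw [hl]; exact zero_le_one)
      (Fin.cons 0 t) hmono (fun i => by
        refine Fin.cases ?_ (fun i => ?_) i
        · simpa using rodrigues_eval_zero (by omega)
        · simpa using h0 i)
    exact ⟨u, hu, fun i => by simpa using hupos i, fun i => by rw [rodrigues_succ]; exact hu0 i⟩

/-- Rodrigues' formula for the Laguerre polynomials with parameter `1`. -/
lemma rodrigues_eq_laguerre (d : ℕ) :
    rodrigues (d + 1) d = C ((-1) ^ d * (d.factorial : ℝ)) * X * laguerre 1 d := by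
  rw [rodrigues_eq_sum, laguerre, Finset.mul_sum, ← Finset.sum_range_reflect]
  refine Finset.sum_congr rfl fun m hm => ?_
  have hm : m ≤ d := by have := Finset.mem_range.1 hm; omega
  have e1 : d + 1 - 1 - m = d - m := by omega
  have e2 : d + 1 - (d - m) = m + 1 := by omega
  rw [e1, e2]
  have e3 : ((-1 : ℝ)) ^ (d - m) = (-1) ^ d * (-1) ^ m := by
    obtain ⟨r, rfl⟩ := Nat.exists_eq_add_of_le hm
    rw [Nat.add_sub_cancel_left, pow_add]
    have : ((-1 : ℝ) ^ m) * (-1) ^ m = 1 := by rw [← mul_pow]; simp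
    linear_combination (-((-1 : ℝ) ^ r)) * this
  have e4 : (d.choose (d - m) : ℝ) * ((d + 1).descFactorial (d - m) : ℝ) =
      d.factorial * ((d + 1).choose (d - m) / m.factorial) := by
    rw [Nat.descFactorial_eq_factorial_mul_choose]
    have hc := Nat.choose_mul_factorial_mul_factorial (n := d) (k := d - m) (by omega)
    rw [Nat.sub_sub_self hm] at hc
    have hc' : (d.choose (d - m) : ℝ) * (d - m).factorial * m.factorial = d.factorial := by
      exact_mod_cast hc
    have : (m.factorial : ℝ) ≠ 0 := by exact_mod_cast m.factorial_ne_zero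
    push_cast
    field_simp
    linear_combination ((d + 1).choose (d - m) : ℝ) * hc'
  have e5 : (-1 : ℝ) ^ (d - m) * (d.choose (d - m) : ℝ) * ((d + 1).descFactorial (d - m) : ℝ) =
      (-1) ^ d * d.factorial * (((d + 1).choose (d - m) : ℝ) * (-1) ^ m / m.factorial) := by
    rw [mul_assoc, e4, e3]
    ring
  rw [e5, map_mul _ ((-1) ^ d * (d.factorial : ℝ))]
  ring

/-- The Laguerre polynomial `L_d^{(1)}` has `d` simple roots, all positive. -/
lemma exists_roots_laguerre (d : ℕ) :
    ∃ φ : Fin d → ℝ, StrictMono φ ∧ (∀ i, 0 < φ i) ∧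
      (laguerre 1 d).roots = Finset.univ.val.map φ := by
  obtain ⟨φ, hφ, hpos, h0⟩ := exists_pos_roots_rodrigues (d + 1) d (by omega)
  refine ⟨φ, hφ, hpos, ?_⟩
  have hne : laguerre 1 d ≠ 0 := by
    intro h
    have := (rodrigues_degree_leadingCoeff (d + 1) d).2
    rw [rodrigues_eq_laguerre, h] at this
    simp at this
  have hdeg : (laguerre 1 d).natDegree ≤ d := by
    refine natDegree_sum_le_of_forall_le _ _ fun m hm => ?_
    exact (natDegree_C_mul_X_pow_le _ _).trans (by have := Finset.mem_range.1 hm; omega)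
  symm
  refine Multiset.eq_of_le_of_card_le ?_ ?_
  · rw [Multiset.le_iff_subset (Finset.univ.nodup.map hφ.injective)]
    intro x hx
    obtain ⟨i, -, rfl⟩ := Multiset.mem_map.1 hx
    rw [mem_roots hne]
    have := h0 i
    rw [rodrigues_eq_laguerre] at this
    have hf : (d.factorial : ℝ) ≠ 0 := by exact_mod_cast d.factorial_ne_zero
    simpa [hf, (hpos i).ne'] using this
  · simpa using (card_roots' _).trans hdeg

/-- The leading part of the differenced sequence vanishes at the roots of the Laguerre
polynomial. -/
lemma sum_choose_descFactorial_eq_laguerre (d : ℕ) (x : ℝ) :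
    ∑ j ∈ Finset.range (d + 2),
      ((d + 1).choose j : ℝ) * x ^ j * (-1) ^ (d + 1 - j) * (d.descFactorial (d + 1 - j) : ℝ) =
      (-1) ^ d * d.factorial * x * (laguerre 1 d).eval x := by
  rw [Finset.sum_range_succ', laguerre, eval_finsetSum, Finset.mul_sum]
  rw [Nat.sub_zero, Nat.descFactorial_of_lt (Nat.lt_succ_self d)]
  simp only [Nat.cast_zero, mul_zero, add_zero]
  refine Finset.sum_congr rfl fun m hm => ?_
  have hm : m ≤ d := by have := Finset.mem_range.1 hm; omega
  have e1 : d + 1 - (m + 1) = d - m := by omega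
  have e3 : ((-1 : ℝ)) ^ (d - m) = (-1) ^ d * (-1) ^ m := by
    obtain ⟨r, rfl⟩ := Nat.exists_eq_add_of_le hm
    rw [Nat.add_sub_cancel_left, pow_add]
    have : ((-1 : ℝ) ^ m) * (-1) ^ m = 1 := by rw [← mul_pow]; simp
    linear_combination (-((-1 : ℝ) ^ r)) * this
  have e4 : (d.descFactorial (d - m) : ℝ) = d.factorial / m.factorial := by
    have := Nat.factorial_mul_descFactorial (n := d) (k := d - m) (by omega)
    rw [Nat.sub_sub_self hm] at this
    have hm0 : (m.factorial : ℝ) ≠ 0 := by exact_mod_cast m.factorial_ne_zero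
    rw [eq_div_iff hm0, mul_comm]
    exact_mod_cast this
  have e5 : (d + 1).choose (m + 1) = (d + 1).choose (d - m) := by
    rw [← Nat.choose_symm (by omega : m + 1 ≤ d + 1), e1]
  rw [e1, e3, e4, e5]
  simp only [eval_mul, eval_C, eval_pow, eval_X]
  ring

/-! ### Locating the roots of a polynomial that is small at separated points -/

/-- If `∏ₖ |yᵢ - κₖ|` is small for each of `n` separated points `yᵢ`, then every `yᵢ` has its own
`κₖ`; the remaining factors are bounded below, so that the distance is linear in the product. -/
lemma exists_perm_norm_sub_le {n : ℕ} (y κ : Fin n → ℂ) {s : ℝ} (hs : 0 < s)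
    (hsep : ∀ i i', i ≠ i' → s ≤ ‖y i - y i'‖) (e : Fin n → ℝ)
    (he : ∀ i, ∏ k, ‖y i - κ k‖ ≤ e i) (hsmall : ∀ i, e i < (s / 4) ^ n) :
    ∃ σ : Equiv.Perm (Fin n), ∀ i, ‖κ (σ i) - y i‖ < s / 4 ∧
      ‖κ (σ i) - y i‖ ≤ e i / (s / 2) ^ (n - 1) := by
  have h1 : ∀ i, ∃ k, ‖κ k - y i‖ < s / 4 := by
    intro i
    by_contra! h
    have : (s / 4) ^ n ≤ ∏ k, ‖y i - κ k‖ := by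
      calc (s / 4) ^ n = ∏ _k : Fin n, s / 4 := by
            rw [Finset.prod_const, Finset.card_univ, Fintype.card_fin]
        _ ≤ _ := Finset.prod_le_prod (fun _ _ => by positivity)
          fun k _ => by rw [norm_sub_rev]; exact h k
    exact absurd (this.trans (he i)) (not_le.2 (hsmall i))
  choose σ hσ using h1
  have hinj : Function.Injective σ := by
    intro i i' h
    by_contra hne
    have h2 := hsep i i' hne
    have h3 := hσ i
    have h4 := hσ i'
    rw [← h] at h4
    have : ‖y i - y i'‖ ≤ ‖κ (σ i) - y i'‖ + ‖κ (σ i) - y i‖ := by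
      have := norm_sub_le (κ (σ i) - y i') (κ (σ i) - y i)
      simpa using this
    linarith
  refine ⟨Equiv.ofBijective σ (Finite.injective_iff_bijective.1 hinj), fun i => ⟨hσ i, ?_⟩⟩
  rw [Equiv.ofBijective_apply, le_div_iff₀ (by positivity)]
  refine le_trans ?_ (he i)
  rw [← Finset.mul_prod_erase _ _ (Finset.mem_univ (σ i)), norm_sub_rev]
  refine mul_le_mul_of_nonneg_left ?_ (norm_nonneg _)
  have hcard : (Finset.univ.erase (σ i)).card = n - 1 := by simp
  rw [← hcard, ← Finset.prod_const]
  refine Finset.prod_le_prod (fun _ _ => by positivity) fun k hk => ?_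
  obtain ⟨i', rfl⟩ := (Finite.injective_iff_surjective.1 hinj) k
  have hne : i ≠ i' := by
    rintro rfl; simp at hk
  have h2 := hsep i i' hne
  have h3 := hσ i'
  have : ‖y i - y i'‖ ≤ ‖y i - κ (σ i')‖ + ‖κ (σ i') - y i'‖ := norm_sub_le_norm_sub_add_norm_sub _ _ _
  linarith

lemma norm_eval_eq_mul_prod_roots {n : ℕ} (q : ℂ[X]) (κ : Fin n → ℂ)
    (hκ : q.roots = Finset.univ.val.map κ) (y : ℂ) :
    ‖q.eval y‖ = ‖q.leadingCoeff‖ * ∏ k, ‖y - κ k‖ := by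
  conv_lhs => rw [(IsAlgClosed.splits q).eq_prod_roots]
  rw [hκ, eval_mul, eval_C, norm_mul, Multiset.map_map, eval_multiset_prod, Multiset.map_map]
  congr 1
  change ‖∏ k, _‖ = _
  rw [norm_prod]
  simp

lemma exists_eq_map_univ {α : Type*} {n : ℕ} (s : Multiset α) (h : s.card = n) :
    ∃ κ : Fin n → α, s = Finset.univ.val.map κ := by
  obtain ⟨l, rfl⟩ := Quot.exists_rep s
  have hl : l.length = n := h
  subst hl
  refine ⟨l.get, ?_⟩
  rw [Fin.univ_val_map, List.ofFn_get]
  rfl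

/-- If `κ` is enumerated by increasing modulus, and the moduli of nearby points `y` increase in
steps that exceed twice the distance, then the matching of the two lists is the identity. -/
lemma perm_eq_one_of_monotone {n : ℕ} (y κ : Fin n → ℂ) {s : ℝ}
    (hy : ∀ i i', i < i' → s ≤ ‖y i'‖ - ‖y i‖) (hs : 0 < s) (hκ : Monotone fun i => ‖κ i‖)
    (σ : Equiv.Perm (Fin n)) (hσ : ∀ i, ‖κ (σ i) - y i‖ < s / 4) : σ = 1 := by
  have hmono : StrictMono σ := by
    intro i i' hii
    by_contra h
    have h1 := hκ (not_lt.1 h)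
    simp only at h1
    have h2 := hy i i' hii
    have h3 := abs_le.1 (abs_norm_sub_norm_le (κ (σ i)) (y i))
    have h4 := abs_le.1 (abs_norm_sub_norm_le (κ (σ i')) (y i'))
    have h5 := hσ i
    have h6 := hσ i'
    linarith [h3.1, h3.2, h4.1, h4.2]
  have : (StrictMono.orderIsoOfSurjective σ hmono σ.surjective) = OrderIso.refl _ :=
    Subsingleton.elim _ _
  ext i
  have h := congrArg (fun f : Fin n ≃o Fin n => f i) this
  simp only [StrictMono.coe_orderIsoOfSurjective, OrderIso.refl_apply] at h
  simp [h]

/-! ### Points of the unit circle and circular distance -/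

lemma norm_node (ξ : ℝ) : ‖node ξ‖ = 1 := by
  rw [node, ← mul_neg, ← Complex.ofReal_neg, mul_comm, Complex.norm_exp_ofReal_mul_I]

lemma node_ne_zero (ξ : ℝ) : node ξ ≠ 0 := Complex.exp_ne_zero _

lemma circDist_eq_abs (x y : ℝ) : ∃ n : ℤ, circDist x y = |x - y - n * (2 * π)| ∧
    |x - y - n * (2 * π)| ≤ π := by
  refine ⟨round ((2 * π)⁻¹ * (x - y)), ?_, ?_⟩
  · rw [circDist, AddCircle.norm_eq]
  · have := AddCircle.norm_le_half_period (2 * π) (x := ((x - y : ℝ) : AddCircle (2 * π)))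
      Real.two_pi_pos.ne'
    rw [AddCircle.norm_eq, abs_of_pos Real.two_pi_pos] at this
    linarith

lemma circDist_comm (x y : ℝ) : circDist x y = circDist y x := by
  rw [circDist, circDist, ← norm_neg, ← AddCircle.coe_neg, neg_sub]

/-- The chord between two points of the circle controls the arc. -/
lemma circDist_le_norm_node_sub (x y : ℝ) : circDist x y ≤ π / 2 * ‖node x - node y‖ := by
  obtain ⟨n, h, hle⟩ := circDist_eq_abs x y
  rw [h]
  set t := x - y - n * (2 * π) with ht
  have hxy : node x - node y = node x * -(Complex.exp (Complex.I * (t : ℝ)) - 1) := by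
    have h1 : node x * Complex.exp (Complex.I * (t : ℝ)) = node y := by
      rw [node, node, ← Complex.exp_add, Complex.exp_eq_exp_iff_exists_int]
      refine ⟨-n, ?_⟩
      rw [ht]; push_cast; ring
    rw [mul_neg, mul_sub, h1]; ring
  rw [hxy, norm_mul, norm_node, one_mul, norm_neg, Complex.norm_exp_I_mul_ofReal_sub_one]
  have h1 : 2 / π * |t / 2| ≤ |Real.sin (t / 2)| := by
    have h2 : |t / 2| ≤ π / 2 := by rw [abs_div, abs_two]; linarith
    exact Real.mul_abs_le_abs_sin h2
  rw [Real.norm_eq_abs, abs_mul, abs_two]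
  rw [abs_div, abs_two] at h1
  have hπ := Real.pi_pos
  have : |t| / π ≤ |Real.sin (t / 2)| := by
    refine le_trans (le_of_eq ?_) h1
    field_simp
  rw [div_le_iff₀ hπ] at this
  linarith

lemma circDist_neg_arg_le (w : ℂ) (ξ : ℝ) : circDist (-w.arg) ξ ≤ π * ‖w - node ξ‖ := by
  have hπ := Real.pi_pos
  have h1 := circDist_le_norm_node_sub (-w.arg) ξ
  have h2 : node (-w.arg) = Complex.exp (w.arg * Complex.I) := by
    rw [node]; congr 1; push_cast; ring
  have h3 : ‖node (-w.arg) - w‖ = |1 - ‖w‖| := by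
    have : node (-w.arg) - w = ((1 - ‖w‖ : ℝ) : ℂ) * Complex.exp (w.arg * Complex.I) := by
      conv_lhs => rw [h2]; enter [2]; rw [← Complex.norm_mul_exp_arg_mul_I w]
      push_cast; ring
    rw [this, norm_mul, Complex.norm_exp_ofReal_mul_I, mul_one, Complex.norm_real, Real.norm_eq_abs]
  have h4 : |1 - ‖w‖| ≤ ‖w - node ξ‖ := by
    have := abs_norm_sub_norm_le (node ξ) w
    rwa [norm_node, norm_sub_rev] at this
  have h5 : ‖node (-w.arg) - node ξ‖ ≤ ‖node (-w.arg) - w‖ + ‖w - node ξ‖ :=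
    norm_sub_le_norm_sub_add_norm_sub _ _ _
  nlinarith

/-! ### The demodulated coefficients of a single jump -/

lemma fwdDiff_iter_congr {f g : ℕ → ℂ} {n k : ℕ} (h : ∀ i ≤ n, f (k + i) = g (k + i)) :
    (fwdDiff 1)^[n] f k = (fwdDiff 1)^[n] g k := by
  rw [fwdDiff_iter_eq_sum_shift, fwdDiff_iter_eq_sum_shift]
  refine Finset.sum_congr rfl fun i hi => ?_
  have := Finset.mem_range.1 hi
  simp only [smul_eq_mul, mul_one]
  rw [h i (by omega)]

lemma DiffBound.congr {M D : ℕ} {B : ℝ} {f g : ℕ → ℂ} (h : DiffBound M D B f)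
    (hfg : ∀ i ≤ D, f (M + i) = g (M + i)) : DiffBound M D B g := by
  intro m i hmi
  rw [← fwdDiff_iter_congr (f := f)]
  · exact h m i hmi
  · intro j hj
    rw [add_assoc]
    exact hfg _ (by omega)

lemma DiffBound.of_le {M D D' : ℕ} {B : ℝ} {f : ℕ → ℂ} (h : DiffBound M D B f) (hD : D' ≤ D) :
    DiffBound M D' B f := fun m i hmi => h m i (hmi.trans hD)

/-- The `k`-th Fourier coefficient of the piecewise polynomial with jumps `A l`, `l ≤ n`, at the
point `w` of the unit circle. -/
def jumpCoeff (n : ℕ) (A : ℕ → ℝ) (w : ℂ) (k : ℤ) : ℂ :=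
  ∑ l ∈ Finset.range (n + 1), (A l : ℂ) * (w ^ k / (2 * π * (Complex.I * k) ^ (l + 1)))

/-- The coefficients `r_k` with the factor `w ^ k` removed. -/
def demod (d : ℕ) (c : ℤ → ℂ) (w : ℂ) (k : ℕ) : ℂ := scaledCoeff d c k * (w ^ k)⁻¹

/-- The part of the symbol of a jump with the magnitudes `A l`, `l < a`. -/
def jumpSymbol (d a : ℕ) (A : ℕ → ℝ) (k : ℕ) : ℂ :=
  ∑ l ∈ Finset.range a, (A l * Complex.I ^ ((d : ℤ) - l)) * (k : ℂ) ^ ((d : ℤ) - l)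

lemma scaled_jumpCoeff (d n : ℕ) (A : ℕ → ℝ) {w : ℂ} (hw : w ≠ 0) {k : ℕ} (hk : 1 ≤ k) :
    2 * π * (Complex.I * k) ^ (d + 1) * jumpCoeff n A w k * (w ^ k)⁻¹ =
      jumpSymbol d (n + 1) A k := by
  have hk0 : (k : ℂ) ≠ 0 := by exact_mod_cast (by omega : k ≠ 0)
  have hIk : Complex.I * (k : ℂ) ≠ 0 := mul_ne_zero Complex.I_ne_zero hk0
  have hπ : (π : ℂ) ≠ 0 := by exact_mod_cast Real.pi_ne_zero
  have hwk : w ^ k ≠ 0 := pow_ne_zero _ hw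
  rw [jumpCoeff, jumpSymbol, Finset.mul_sum, Finset.sum_mul]
  refine Finset.sum_congr rfl fun l _ => ?_
  rw [mul_assoc (A l : ℂ) (Complex.I ^ ((d : ℤ) - l)), ← mul_zpow]
  have e : (Complex.I * (k : ℂ)) ^ ((d : ℤ) - l) =
      (Complex.I * k) ^ (d + 1) / (Complex.I * k) ^ (l + 1) := by
    have : (d : ℤ) - l = ((d + 1 : ℕ) : ℤ) - ((l + 1 : ℕ) : ℤ) := by push_cast; ring
    rw [this, zpow_sub₀ hIk, zpow_natCast, zpow_natCast]
  rw [e]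
  have h2 := pow_ne_zero (l + 1) hIk
  rw [zpow_natCast, Int.cast_natCast]
  field_simp

/-- Once the magnitudes of order less than `a` are removed, the demodulated coefficients behave
like `k ^ (d - a)`. -/
lemma exists_diffBound_demod (d d₁ : ℕ) (hd : 2 * d + 1 ≤ d₁) (C₀ : ℝ) (hC₀ : 0 < C₀) :
    ∃ C : ℝ, 0 < C ∧ ∀ (w : ℂ) (A : ℕ → ℝ) (H : ℝ) (c : ℤ → ℂ) (M : ℕ), ‖w‖ = 1 → 0 ≤ H →
      (∀ l ≤ d₁, |A l| ≤ H) → 1 ≤ M →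
      (∀ i ≤ d + 1, ‖c (M + i : ℕ) - jumpCoeff d₁ A w (M + i : ℕ)‖ ≤ C₀ * H / (M : ℝ) ^ (d₁ + 2)) →
      ∀ a ≤ d + 1, DiffBound M (d + 1) (C * H * (M : ℝ) ^ ((d : ℤ) - a))
        (fun k => demod d c w k - jumpSymbol d a A k) := by
  choose b hb hpow using fun l : ℕ => exists_diffBound_zpow (d + 1) ((d : ℤ) - l)
  refine ⟨2 ^ (d + 1) * (2 * π * (d + 2) ^ (d + 1) * C₀) + ∑ l ∈ Finset.range (d₁ + 1), b l,
    ?_, fun w A H c M hw hH hA hM hc a ha => ?_⟩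
  · have : 0 ≤ ∑ l ∈ Finset.range (d₁ + 1), b l := Finset.sum_nonneg fun l _ => (hb l).le
    positivity
  have hM' : (1 : ℝ) ≤ M := by exact_mod_cast hM
  have hM0 : (M : ℝ) ≠ 0 := by positivity
  have hw0 : w ≠ 0 := by intro h; rw [h, norm_zero] at hw; exact zero_ne_one hw
  have hrough : DiffBound M (d + 1)
      (2 ^ (d + 1) * (2 * π * ((d + 2) * M) ^ (d + 1) * (C₀ * H / (M : ℝ) ^ (d₁ + 2))) *
        (M : ℝ) ^ (d + 1))
      (fun k => demod d c w k - jumpSymbol d (d₁ + 1) A k) := by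
    refine DiffBound.of_norm_le hM fun i hi => ?_
    have h1 : demod d c w (M + i) - jumpSymbol d (d₁ + 1) A (M + i) =
        2 * π * (Complex.I * (M + i : ℕ)) ^ (d + 1) *
          (c (M + i : ℕ) - jumpCoeff d₁ A w (M + i : ℕ)) * (w ^ (M + i))⁻¹ := by
      rw [← scaled_jumpCoeff d d₁ A hw0 (by omega : 1 ≤ M + i), demod, scaledCoeff]
      ring
    rw [h1, norm_mul, norm_mul, norm_mul, norm_mul, norm_inv, norm_pow, norm_pow, norm_mul, hw,
      Complex.norm_I, Complex.norm_natCast, Complex.norm_real, Real.norm_eq_abs,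
      abs_of_pos Real.pi_pos, Complex.norm_ofNat, one_pow, inv_one, mul_one, one_mul]
    have h2 : ((M + i : ℕ) : ℝ) ≤ (d + 2) * M := by
      have : (i : ℝ) ≤ d + 1 := by exact_mod_cast hi
      push_cast
      nlinarith
    have := hc i hi
    have hπ := Real.pi_pos
    gcongr
  have htail : DiffBound M (d + 1) (∑ l ∈ Finset.Ico a (d₁ + 1), b l * H * (M : ℝ) ^ ((d : ℤ) - a))
      (fun k => ∑ l ∈ Finset.Ico a (d₁ + 1),
        (A l * Complex.I ^ ((d : ℤ) - l)) * (k : ℂ) ^ ((d : ℤ) - l)) := by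
    refine DiffBound.sum _ fun l hl => ?_
    obtain ⟨hl1, hl2⟩ := Finset.mem_Ico.1 hl
    refine ((hpow l M hM).const_mul _).mono ?_
    rw [norm_mul, norm_zpow, Complex.norm_I, one_zpow, mul_one, Complex.norm_real,
      Real.norm_eq_abs]
    have h1 := hA l (by omega)
    have h2 : (M : ℝ) ^ ((d : ℤ) - l) ≤ (M : ℝ) ^ ((d : ℤ) - a) :=
      zpow_le_zpow_right₀ hM' (by omega)
    have := (hb l).le
    calc _ ≤ H * (b l * (M : ℝ) ^ ((d : ℤ) - a)) := by gcongr
      _ = _ := by ring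
  have hsum := hrough.add htail
  refine (hsum.congr (g := fun k => demod d c w k - jumpSymbol d a A k) fun i _ => ?_).mono ?_
  · simp only [jumpSymbol]
    rw [← Finset.sum_range_add_sum_Ico _ (by omega : a ≤ d₁ + 1)]
    ring
  · rw [add_mul _ _ H, add_mul _ _ ((M : ℝ) ^ ((d : ℤ) - a))]
    refine add_le_add ?_ ?_
    · have h1 : (M : ℝ) ^ (d + 1) / (M : ℝ) ^ (d₁ + 2) * (M : ℝ) ^ (d + 1) ≤
          (M : ℝ) ^ ((d : ℤ) - a) := by
        rw [← zpow_natCast, ← zpow_natCast, ← zpow_sub₀ hM0, ← zpow_add₀ hM0]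
        exact zpow_le_zpow_right₀ hM' (by push_cast; omega)
      have hπ := Real.pi_pos
      calc _ = 2 ^ (d + 1) * (2 * π * (d + 2) ^ (d + 1) * C₀) * H *
            ((M : ℝ) ^ (d + 1) / (M : ℝ) ^ (d₁ + 2) * (M : ℝ) ^ (d + 1)) := by
            rw [mul_pow]; ring
        _ ≤ _ := by gcongr
    · rw [← Finset.sum_mul, ← Finset.sum_mul]
      have : ∑ l ∈ Finset.Ico a (d₁ + 1), b l ≤ ∑ l ∈ Finset.range (d₁ + 1), b l := by
        refine Finset.sum_le_sum_of_subset_of_nonneg ?_ fun l _ _ => (hb l).le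
        intro l hl
        exact Finset.mem_range.2 (Finset.mem_Ico.1 hl).2
      gcongr

/-! ### Values of the eliminant -/

lemma eval_eliminant (d : ℕ) (c : ℤ → ℂ) (M : ℕ) {w : ℂ} (hw : w ≠ 0) {h : ℂ} (hh : 1 - h ≠ 0) :
    (eliminant d c M).eval (w / (1 - h)) = w ^ (M + d + 1) * ((1 - h) ^ (d + 1))⁻¹ *
      ∑ j ∈ Finset.range (d + 2), ((d + 1).choose j : ℂ) * h ^ j * (-1) ^ (d + 1 - j) *
        (fwdDiff 1)^[d + 1 - j] (demod d c w) (M + j) := by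
  rw [← sum_choose_mul_pow_eq_fwdDiff, eliminant, eval_finsetSum, Finset.mul_sum]
  refine Finset.sum_congr rfl fun m hm => ?_
  have hm : m ≤ d + 1 := by have := Finset.mem_range.1 hm; omega
  have hp := pow_ne_zero (M + m) hw
  have hq := pow_ne_zero (d + 1) hh
  have hr := pow_ne_zero (d + 1 - m) hh
  have e1 : w ^ (M + d + 1) = w ^ (M + m) * w ^ (d + 1 - m) := by
    rw [← pow_add]; congr 1; omega
  have e2 : (1 - h) ^ (d + 1) = (1 - h) ^ m * (1 - h) ^ (d + 1 - m) := by
    rw [← pow_add]; congr 1; omega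
  have hs := pow_ne_zero m hh
  simp only [eval_mul, eval_C, eval_pow, eval_X, demod]
  rw [e1, e2, div_pow]
  field_simp

/-- The eliminant nearly vanishes at the points attached to zeros of the Laguerre polynomial. -/
lemma exists_norm_sum_fwdDiff_demod_le (d : ℕ) (C : ℝ) (hC : 0 < C) (x : ℝ)
    (hx : x * (laguerre 1 d).eval x = 0) :
    ∃ C' : ℝ, 0 < C' ∧ ∀ (ρ : ℕ → ℂ) (A : ℕ → ℝ) (H : ℝ) (M : ℕ), |A 0| ≤ H → 1 ≤ M →
      DiffBound M (d + 1) (C * H * (M : ℝ) ^ ((d : ℤ) - 1)) (fun k => ρ k - jumpSymbol d 1 A k) →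
      ‖∑ j ∈ Finset.range (d + 2), ((d + 1).choose j : ℂ) * ((x / M : ℝ) : ℂ) ^ j *
        (-1) ^ (d + 1 - j) * (fwdDiff 1)^[d + 1 - j] ρ (M + j)‖ ≤ C' * H / (M : ℝ) ^ 2 := by
  choose b hb hpow using fun n : ℕ => exists_fwdDiff_iter_pow_sub_le (d + 1) n d
  set w : ℕ → ℝ := fun j => ((d + 1).choose j : ℝ) * |x| ^ j with hwdef
  have hw : ∀ j, 0 ≤ w j := fun j => by positivity
  refine ⟨∑ j ∈ Finset.range (d + 2), w j * (b (d + 1 - j) + C) + 1, ?_,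
    fun ρ A H M hA hM hρ => ?_⟩
  · have : 0 ≤ ∑ j ∈ Finset.range (d + 2), w j * (b (d + 1 - j) + C) :=
      Finset.sum_nonneg fun j _ => mul_nonneg (hw j) (add_pos (hb _) hC).le
    positivity
  have hM' : (1 : ℝ) ≤ M := by exact_mod_cast hM
  have hM0 : (M : ℝ) ≠ 0 := by positivity
  have hMc : (M : ℂ) ≠ 0 := by exact_mod_cast hM0
  have hH : 0 ≤ H := (abs_nonneg _).trans hA
  set a : ℂ := A 0 * Complex.I ^ (d : ℤ) with ha
  have hna : ‖a‖ ≤ H := by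
    rw [ha, norm_mul, norm_zpow, Complex.norm_I, one_zpow, mul_one, Complex.norm_real]
    exact hA
  -- The leading terms sum up to a multiple of `x L(x)`, hence to zero.
  have hzero : ∑ j ∈ Finset.range (d + 2), ((d + 1).choose j : ℂ) * ((x / M : ℝ) : ℂ) ^ j *
      (-1) ^ (d + 1 - j) *
        (a * ((d.descFactorial (d + 1 - j) : ℂ) * (M : ℂ) ^ ((d : ℤ) - (d + 1 - j : ℕ)))) = 0 := by
    have h1 := sum_choose_descFactorial_eq_laguerre d x
    rw [mul_assoc _ x, hx, mul_zero] at h1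
    have h2 := congrArg (fun r : ℝ => (r : ℂ) * (a * (M : ℂ)⁻¹)) h1
    simp only [Complex.ofReal_zero, zero_mul] at h2
    rw [← h2]
    push_cast
    rw [Finset.sum_mul]
    refine Finset.sum_congr rfl fun j hj => ?_
    have hj : j ≤ d + 1 := by have := Finset.mem_range.1 hj; omega
    have e : (M : ℂ) ^ ((d : ℤ) - (d + 1 - j : ℕ)) = (M : ℂ) ^ j * (M : ℂ)⁻¹ := by
      have : (d : ℤ) - (d + 1 - j : ℕ) = j + (-1) := by omega
      rw [this, zpow_add₀ hMc, zpow_natCast, zpow_neg_one]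
    rw [e, div_pow]
    have := pow_ne_zero j hMc
    field_simp
  rw [← sub_zero (∑ j ∈ Finset.range (d + 2), _), ← hzero, ← Finset.sum_sub_distrib]
  have hterm : ∀ j ∈ Finset.range (d + 2),
      ‖((d + 1).choose j : ℂ) * ((x / M : ℝ) : ℂ) ^ j * (-1) ^ (d + 1 - j) *
          (fwdDiff 1)^[d + 1 - j] ρ (M + j) -
        ((d + 1).choose j : ℂ) * ((x / M : ℝ) : ℂ) ^ j * (-1) ^ (d + 1 - j) *
        (a * ((d.descFactorial (d + 1 - j) : ℂ) * (M : ℂ) ^ ((d : ℤ) - (d + 1 - j : ℕ))))‖ ≤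
        w j * (b (d + 1 - j) + C) * (H / (M : ℝ) ^ 2) := by
    intro j hj
    have hj : j ≤ d + 1 := by have := Finset.mem_range.1 hj; omega
    have h1 := hρ (d + 1 - j) j (by omega)
    have h2 := hpow (d + 1 - j) M hM j (by omega)
    have hsplit : (fwdDiff 1)^[d + 1 - j] ρ (M + j) =
        (fwdDiff 1)^[d + 1 - j] (fun k => ρ k - jumpSymbol d 1 A k) (M + j) +
          a * (fwdDiff 1)^[d + 1 - j] (fun k : ℕ => (k : ℂ) ^ d) (M + j) := by
      have e : ρ = (fun k => ρ k - jumpSymbol d 1 A k) + a • (fun k : ℕ => (k : ℂ) ^ d) := by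
        funext k
        simp [jumpSymbol, ha]
      conv_lhs => rw [e]
      rw [fwdDiff_iter_add, fwdDiff_iter_const_smul]
      rfl
    rw [← mul_sub, norm_mul, norm_mul, norm_mul, norm_pow, norm_pow, norm_neg, norm_one, one_pow,
      mul_one, Complex.norm_natCast, Complex.norm_real, Real.norm_eq_abs, abs_div, Nat.abs_cast,
      hsplit, add_sub_assoc, ← mul_sub]
    set P := (fwdDiff 1)^[d + 1 - j] (fun k => ρ k - jumpSymbol d 1 A k) (M + j)
    set Q := (fwdDiff 1)^[d + 1 - j] (fun k : ℕ => (k : ℂ) ^ d) (M + j) -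
      (d.descFactorial (d + 1 - j) : ℂ) * (M : ℂ) ^ ((d : ℤ) - (d + 1 - j : ℕ))
    have h3 : ‖P + a * Q‖ ≤ (b (d + 1 - j) + C) * H * ((M : ℝ) ^ j / (M : ℝ) ^ 2) := by
      have e1 : (M : ℝ) ^ ((d : ℤ) - (d + 1 - j : ℕ) - 1) = (M : ℝ) ^ j / (M : ℝ) ^ 2 := by
        have : (d : ℤ) - (d + 1 - j : ℕ) - 1 = (j : ℤ) - (2 : ℕ) := by omega
        rw [this, zpow_sub₀ hM0, zpow_natCast, zpow_natCast]
      have e2 : (M : ℝ) ^ ((d : ℤ) - 1) / (M : ℝ) ^ (d + 1 - j) = (M : ℝ) ^ j / (M : ℝ) ^ 2 := by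
        rw [← e1, ← zpow_natCast, ← zpow_sub₀ hM0]
        congr 1; ring
      rw [e1] at h2
      rw [mul_div_assoc, e2] at h1
      calc _ ≤ ‖P‖ + ‖a‖ * ‖Q‖ := (norm_add_le _ _).trans (by rw [norm_mul])
        _ ≤ C * H * ((M : ℝ) ^ j / (M : ℝ) ^ 2) + H * (b (d + 1 - j) * ((M : ℝ) ^ j / (M : ℝ) ^ 2)) := by
          gcongr
        _ = _ := by ring
    calc _ ≤ ((d + 1).choose j : ℝ) * (|x| / M) ^ j *
          ((b (d + 1 - j) + C) * H * ((M : ℝ) ^ j / (M : ℝ) ^ 2)) := by gcongr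
      _ = _ := by
        rw [hwdef, div_pow]
        field_simp
  refine (norm_sum_le _ _).trans ((Finset.sum_le_sum hterm).trans ?_)
  rw [← Finset.sum_mul, mul_div_assoc]
  gcongr
  linarith

/-! ### Roots of the eliminant -/

lemma exists_pos_forall_le {ι : Type*} [Finite ι] (f : ι → ℝ) (hf : ∀ i, 0 < f i) :
    ∃ c : ℝ, 0 < c ∧ ∀ i, c ≤ f i := by
  cases nonempty_fintype ι
  rcases isEmpty_or_nonempty ι with h | h
  · exact ⟨1, one_pos, fun i => h.elim i⟩
  · obtain ⟨i, hi⟩ := Finite.exists_min f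
    exact ⟨f i, hf i, hi⟩

lemma exists_forall_le_const {ι : Type*} [Finite ι] (f : ι → ℝ) :
    ∃ c : ℝ, 0 < c ∧ ∀ i, f i ≤ c := by
  cases nonempty_fintype ι
  rcases isEmpty_or_nonempty ι with h | h
  · exact ⟨1, one_pos, fun i => h.elim i⟩
  · obtain ⟨i, hi⟩ := Finite.exists_max f
    exact ⟨|f i| + 1, by positivity, fun j => (hi j).trans (by linarith [le_abs_self (f i)])⟩

lemma modelRoot_eq {d : ℕ} (φ : Fin d → ℝ) (w : ℂ) (M : ℕ) (i : Fin (d + 1)) :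
    modelRoot φ w M i = w / (1 - (((Fin.cons 0 φ : Fin (d + 1) → ℝ) i / M : ℝ) : ℂ)) := by
  induction i using Fin.cases with
  | zero => simp [modelRoot]
  | succ i => simp [modelRoot]

lemma modelRoot_eq_smul {d : ℕ} (φ : Fin d → ℝ) (w : ℂ) (M : ℕ) (i : Fin (d + 1)) :
    modelRoot φ w M i = ((1 - (Fin.cons 0 φ : Fin (d + 1) → ℝ) i / M : ℝ)⁻¹ : ℝ) * w := by
  rw [modelRoot_eq, div_eq_inv_mul]
  push_cast
  rfl

/-- The model roots lie on one ray, in the order of the Laguerre roots and separated at the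
scale `1 / M`. -/
lemma exists_modelRoot_separated {d : ℕ} (φ : Fin d → ℝ) (hφ : StrictMono φ) (hpos : ∀ i, 0 < φ i) :
    ∃ C₁ N : ℝ, 0 < C₁ ∧ 0 < N ∧ ∀ M : ℕ, N ≤ M → ∀ w : ℂ, ‖w‖ = 1 →
      (∀ i, ∃ s : ℝ, 1 ≤ s ∧ s ≤ 2 ∧ modelRoot φ w M i = s * w ∧ ‖modelRoot φ w M i‖ = s ∧
        s = (1 - (Fin.cons 0 φ : Fin (d + 1) → ℝ) i / M)⁻¹) ∧
      ∀ i i', i < i' → C₁ / M ≤ ‖modelRoot φ w M i'‖ - ‖modelRoot φ w M i‖ := by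
  set x : Fin (d + 1) → ℝ := Fin.cons 0 φ with hx
  have hx0 : ∀ i, 0 ≤ x i := by
    intro i
    induction i using Fin.cases with
    | zero => simp [hx]
    | succ i => simpa [hx] using (hpos i).le
  have hxm : StrictMono x := by
    intro i i' hii
    induction i' using Fin.cases with
    | zero => exact absurd hii (Fin.not_lt_zero i)
    | succ i' =>
      induction i using Fin.cases with
      | zero => simpa [hx] using hpos i'
      | succ i => simpa [hx] using hφ (Fin.succ_lt_succ_iff.1 hii)
  obtain ⟨X, hX, hXle⟩ := exists_forall_le_const x
  obtain ⟨c, hc, hcle⟩ := exists_pos_forall_le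
    (fun p : {p : Fin (d + 1) × Fin (d + 1) // p.1 < p.2} => x p.1.2 - x p.1.1)
    (fun p => sub_pos.2 (hxm p.2))
  refine ⟨c, 2 * X, hc, by positivity, fun M hM w hw => ?_⟩
  have hM0 : (0 : ℝ) < M := by linarith
  have hr : ∀ i, 0 ≤ x i / M ∧ x i / M ≤ 1 / 2 := by
    intro i
    refine ⟨div_nonneg (hx0 i) hM0.le, ?_⟩
    rw [div_le_iff₀ hM0]
    linarith [hXle i]
  have hs : ∀ i, 1 ≤ (1 - x i / M)⁻¹ := fun i =>
    (one_le_inv₀ (by linarith [(hr i).2])).2 (by linarith [(hr i).1])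
  have hn : ∀ i, ‖modelRoot φ w M i‖ = (1 - x i / M)⁻¹ := by
    intro i
    rw [modelRoot_eq_smul, norm_mul, hw, mul_one, Complex.norm_real, Real.norm_eq_abs,
      abs_of_nonneg (by linarith [hs i])]
  refine ⟨fun i => ⟨_, hs i, ?_, modelRoot_eq_smul φ w M i, hn i, rfl⟩, fun i i' hii => ?_⟩
  · rw [inv_le_comm₀ (by linarith [(hr i).2]) (by norm_num)]
    linarith [(hr i).2]
  · rw [hn, hn]
    have h1 := hs i
    have h2 := hs i'
    have h3 := hcle ⟨(i, i'), hii⟩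
    simp only at h3
    have e : (1 - x i' / M)⁻¹ - (1 - x i / M)⁻¹ =
        (x i' - x i) / M * ((1 - x i' / M)⁻¹ * (1 - x i / M)⁻¹) := by
      have a1 : 1 - x i / M ≠ 0 := by linarith [(hr i).2]
      have a2 : 1 - x i' / M ≠ 0 := by linarith [(hr i').2]
      field_simp
      have b1 : (M : ℝ) - x i ≠ 0 := by
        intro h; apply a1; field_simp; linarith
      have b2 : (M : ℝ) - x i' ≠ 0 := by
        intro h; apply a2; field_simp; linarith
      field_simp
      ring
    rw [e]
    calc c / M ≤ (x i' - x i) / M := by gcongr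
      _ ≤ _ := le_mul_of_one_le_right (div_nonneg (by linarith) hM0.le) (by nlinarith)

lemma coeff_eliminant (d : ℕ) (c : ℤ → ℂ) (M : ℕ) :
    (eliminant d c M).coeff (d + 1) = scaledCoeff d c M := by
  rw [eliminant, finsetSum_coeff, Finset.sum_eq_single 0]
  · simp
  · intro j hj hj0
    rw [coeff_C_mul_X_pow, if_neg]
    have := Finset.mem_range.1 hj
    omega
  · simp

lemma natDegree_eliminant {d : ℕ} {c : ℤ → ℂ} {M : ℕ} (h : scaledCoeff d c M ≠ 0) :
    (eliminant d c M).natDegree = d + 1 := by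
  refine natDegree_eq_of_le_of_coeff_ne_zero ?_ (by rwa [coeff_eliminant])
  refine natDegree_sum_le_of_forall_le _ _ fun j _ => ?_
  exact (natDegree_C_mul_X_pow_le _ _).trans (by omega)

/-- At the unit circle point itself the eliminant is smaller than at the other model roots, since
its value is a difference of order `d + 1`, which annihilates the polynomial part. -/
lemma norm_eval_eliminant_node_le {d : ℕ} {C H : ℝ} {w : ℂ} (hw : ‖w‖ = 1) {A : ℕ → ℝ} {c : ℤ → ℂ}
    {M : ℕ} (hM : 1 ≤ M)
    (h : DiffBound M (d + 1) (C * H * (M : ℝ) ^ ((d : ℤ) - (d + 1 : ℕ)))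
      (fun k => demod d c w k - jumpSymbol d (d + 1) A k)) :
    ‖(eliminant d c M).eval w‖ ≤ C * H / (M : ℝ) ^ (d + 2) := by
  have hw0 : w ≠ 0 := by intro h; rw [h, norm_zero] at hw; exact zero_ne_one hw
  have hM' : (M : ℝ) ≠ 0 := by exact_mod_cast (by omega : M ≠ 0)
  have h1 := eval_eliminant d c M hw0 (h := 0) (by simp)
  rw [Finset.sum_eq_single 0 (by intro j _ hj; simp [hj]) (by simp)] at h1
  simp only [sub_zero, div_one, one_pow, inv_one, mul_one, Nat.choose_zero_right, Nat.cast_one,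
    pow_zero, one_mul, add_zero] at h1
  have h2 := h (d + 1) 0 (by omega)
  have hpoly : (fwdDiff 1)^[d + 1] (fun k => jumpSymbol d (d + 1) A k) M = 0 := by
    have e : (fun k => jumpSymbol d (d + 1) A k) = ∑ l ∈ Finset.range (d + 1),
        (A l * Complex.I ^ ((d : ℤ) - l)) • fun k : ℕ => (k : ℂ) ^ ((d : ℤ) - l) := by
      funext k
      simp [jumpSymbol, Finset.sum_apply]
    rw [e, fwdDiff_iter_finsetSum, Finset.sum_apply]
    refine Finset.sum_eq_zero fun l hl => ?_
    have hl := Finset.mem_range.1 hl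
    rw [fwdDiff_iter_const_smul, Pi.smul_apply]
    have : (d : ℤ) - l = ((d - l : ℕ) : ℤ) := by omega
    rw [this, fwdDiff_iter_zpow_eq_zero (by omega), smul_zero]
  have hsplit : (fwdDiff 1)^[d + 1] (demod d c w) M =
      (fwdDiff 1)^[d + 1] (fun k => demod d c w k - jumpSymbol d (d + 1) A k) (M + 0) := by
    have e : demod d c w = (fun k => demod d c w k - jumpSymbol d (d + 1) A k) +
        fun k => jumpSymbol d (d + 1) A k := by
      funext k; simp
    conv_lhs => rw [e]
    rw [fwdDiff_iter_add, Pi.add_apply, hpoly, add_zero, add_zero]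
  rw [h1, norm_mul, norm_mul, norm_pow, norm_pow, hw, norm_neg, norm_one, one_pow, one_pow,
    one_mul, one_mul, Nat.sub_zero, hsplit]
  refine h2.trans (le_of_eq ?_)
  have : (d : ℤ) - (d + 1 : ℕ) = -1 := by push_cast; ring
  rw [this, zpow_neg_one, pow_succ _ (d + 1)]
  field_simp

/-- The first magnitude dominates the leading coefficient of the eliminant. -/
lemma le_norm_scaledCoeff {d : ℕ} {C H J : ℝ} {w : ℂ} (hw : ‖w‖ = 1) {A : ℕ → ℝ} {c : ℤ → ℂ}
    {M : ℕ} (hJ : J ≤ |A 0|) (hM : 1 ≤ M) (hMH : C * H ≤ J / 2 * M)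
    (h : DiffBound M (d + 1) (C * H * (M : ℝ) ^ ((d : ℤ) - 1))
      (fun k => demod d c w k - jumpSymbol d 1 A k)) :
    J / 2 * (M : ℝ) ^ d ≤ ‖scaledCoeff d c M‖ := by
  have hM' : (1 : ℝ) ≤ M := by exact_mod_cast hM
  have hM0 : (M : ℝ) ≠ 0 := by positivity
  have h1 := h 0 0 (by omega)
  simp only [Function.iterate_zero, id_eq, pow_zero, div_one, add_zero] at h1
  have h2 : ‖demod d c w M‖ = ‖scaledCoeff d c M‖ := by
    rw [demod, norm_mul, norm_inv, norm_pow, hw, one_pow, inv_one, mul_one]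
  have h3 : ‖jumpSymbol d 1 A M‖ = |A 0| * (M : ℝ) ^ d := by
    simp [jumpSymbol]
  have h4 : C * H * (M : ℝ) ^ ((d : ℤ) - 1) ≤ J / 2 * (M : ℝ) ^ d := by
    rw [zpow_sub_one₀ hM0, zpow_natCast]
    calc _ = C * H * (M : ℝ)⁻¹ * (M : ℝ) ^ d := by ring
      _ ≤ J / 2 * M * (M : ℝ)⁻¹ * (M : ℝ) ^ d := by gcongr
      _ = _ := by field_simp
  have h5 : J * (M : ℝ) ^ d ≤ |A 0| * (M : ℝ) ^ d := by gcongr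
  have h6 := norm_sub_norm_le (jumpSymbol d 1 A M) (demod d c w M)
  rw [norm_sub_rev, h2, h3] at h6
  linarith

/-- The roots of the eliminant follow the model roots. -/
lemma exists_eliminant_roots_near (d d₁ : ℕ) (hd : 2 * d + 1 ≤ d₁) {J : ℝ} (hJ : 0 < J) {C₀ : ℝ}
    (hC₀ : 0 < C₀) (φ : Fin d → ℝ) (hφ : StrictMono φ) (hpos : ∀ i, 0 < φ i)
    (hroot : ∀ i, (laguerre 1 d).eval (φ i) = 0) :
    ∃ C₁ C₂ C₅ : ℝ, 0 < C₁ ∧ 0 < C₂ ∧ 0 < C₅ ∧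
    ∀ (w : ℂ) (A : ℕ → ℝ) (H : ℝ) (c : ℤ → ℂ) (M : ℕ), ‖w‖ = 1 → J ≤ |A 0| → 1 ≤ H →
      (∀ l ≤ d₁, |A l| ≤ H) → C₅ * H < M →
      (∀ i ≤ d + 1, ‖c (M + i : ℕ) - jumpCoeff d₁ A w (M + i : ℕ)‖ ≤ C₀ * H / (M : ℝ) ^ (d₁ + 2)) →
      (∀ i, ∃ s : ℝ, 1 ≤ s ∧ modelRoot φ w M i = s * w) ∧
      (∀ i i', i < i' → C₁ / M ≤ ‖modelRoot φ w M i - modelRoot φ w M i'‖) ∧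
      (eliminant d c M).roots.card = d + 1 ∧
      (∀ κ : Fin (d + 1) → ℂ, (eliminant d c M).roots = Finset.univ.val.map κ →
        (Monotone fun i => ‖κ i‖) →
        (∀ i, i ≠ 0 → ‖κ i - modelRoot φ w M i‖ ≤ C₂ * H / (M : ℝ) ^ 2) ∧
        ‖κ 0 - w‖ ≤ C₂ * H / (M : ℝ) ^ (d + 2)) ∧
      ∀ z : ℂ, IsClosestRoot (eliminant d c M) z → ‖z - w‖ ≤ C₂ * H / (M : ℝ) ^ (d + 2) := by
  obtain ⟨C, hC, hdemod⟩ := exists_diffBound_demod d d₁ hd C₀ hC₀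
  obtain ⟨C₁, N, hC₁, hN, hmodel⟩ := exists_modelRoot_separated φ hφ hpos
  set x : Fin (d + 1) → ℝ := Fin.cons 0 φ with hx
  have hxroot : ∀ i, x i * (laguerre 1 d).eval (x i) = 0 := by
    intro i
    induction i using Fin.cases with
    | zero => simp [hx]
    | succ i => simp [hx, hroot i]
  choose b hb hval using fun i => exists_norm_sum_fwdDiff_demod_le d C hC (x i) (hxroot i)
  obtain ⟨B, hB, hBle⟩ := exists_forall_le_const b
  -- `G * H / M ^ (d + 2)` bounds the product of the distances from a model root to all roots.
  set G : ℝ := (2 ^ (d + 1) * B + C) / (J / 2) with hG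
  have hGpos : 0 < G := by positivity
  refine ⟨C₁, G / (C₁ / 2) ^ d, N + 1 + C / (J / 2) + G / (C₁ / 4) ^ (d + 1), hC₁, by positivity,
    by positivity, fun w A H c M hw hJA hH hA hMH hc => ?_⟩
  have hH0 : 0 < H := by linarith
  have hMbig : ∀ a b : ℝ, 0 ≤ a → 0 ≤ b → a + b = N + 1 + C / (J / 2) + G / (C₁ / 4) ^ (d + 1) →
      a * H < M := by
    intro a b ha hb' hab
    rw [← hab, add_mul] at hMH
    have := mul_nonneg hb' hH0.le
    linarith
  have hMN : N ≤ M := by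
    have := hMbig N (1 + C / (J / 2) + G / (C₁ / 4) ^ (d + 1)) hN.le (by positivity) (by ring)
    nlinarith
  have hM1' : (1 : ℝ) < M := by
    have := hMbig 1 (N + C / (J / 2) + G / (C₁ / 4) ^ (d + 1)) one_pos.le (by positivity) (by ring)
    linarith
  have hM1 : 1 ≤ M := by exact_mod_cast hM1'.le
  have hM0 : (0 : ℝ) < M := by linarith
  have hMC : C * H ≤ J / 2 * M := by
    have := hMbig (C / (J / 2)) (N + 1 + G / (C₁ / 4) ^ (d + 1)) (by positivity) (by positivity)
      (by ring)
    rw [div_mul_eq_mul_div, div_lt_iff₀ (by positivity)] at this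
    linarith
  have hMG : G * H < (C₁ / 4) ^ (d + 1) * M := by
    have := hMbig (G / (C₁ / 4) ^ (d + 1)) (N + 1 + C / (J / 2)) (by positivity) (by positivity)
      (by ring)
    rw [div_mul_eq_mul_div, div_lt_iff₀ (by positivity)] at this
    linarith
  have hw0 : w ≠ 0 := by intro h; rw [h, norm_zero] at hw; exact zero_ne_one hw
  have hρ := hdemod w A H c M hw hH0.le hA hM1 hc
  obtain ⟨hray, hstep⟩ := hmodel M hMN w hw
  set q := eliminant d c M with hq
  set y : Fin (d + 1) → ℂ := modelRoot φ w M with hy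
  have hlead := le_norm_scaledCoeff hw hJA hM1 hMC (by simpa using hρ 1 (by omega))
  have hrM : scaledCoeff d c M ≠ 0 := by
    intro h
    rw [h, norm_zero] at hlead
    have : 0 < J / 2 * (M : ℝ) ^ d := by positivity
    linarith
  have hdeg := natDegree_eliminant hrM
  have hlc : q.leadingCoeff = scaledCoeff d c M := by
    rw [leadingCoeff, hdeg, coeff_eliminant]
  have hcard : q.roots.card = d + 1 := by
    rw [← hdeg]
    exact (IsAlgClosed.splits q).natDegree_eq_card_roots.symm
  have hy0 : y 0 = w := by simp [hy, modelRoot]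
  have hevalw : ‖q.eval w‖ ≤ C * H / (M : ℝ) ^ (d + 2) :=
    norm_eval_eliminant_node_le hw hM1 (hρ (d + 1) le_rfl)
  have hevaly : ∀ i, ‖q.eval (y i)‖ ≤ 2 ^ (d + 1) * B * H / (M : ℝ) ^ 2 := by
    intro i
    obtain ⟨s, hs1, hs2, -, -, hs⟩ := hray i
    have hne : (1 : ℂ) - ((x i / M : ℝ) : ℂ) ≠ 0 := by
      intro h
      have : (1 : ℝ) - x i / M = 0 := by exact_mod_cast h
      rw [this, inv_zero] at hs
      linarith
    rw [hy, modelRoot_eq, hq, eval_eliminant d c M hw0 hne, norm_mul, norm_mul, norm_pow, hw,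
      one_pow, one_mul]
    have h1 := hval i (demod d c w) A H M (hA 0 (by omega)) hM1 (by simpa using hρ 1 (by omega))
    have h2 : ‖((1 - ((x i / M : ℝ) : ℂ)) ^ (d + 1))⁻¹‖ ≤ 2 ^ (d + 1) := by
      rw [← inv_pow, norm_pow]
      have : ‖(1 - ((x i / M : ℝ) : ℂ))⁻¹‖ = s := by
        rw [hs, ← Complex.ofReal_one, ← Complex.ofReal_sub, ← Complex.ofReal_inv,
          Complex.norm_real, Real.norm_eq_abs, abs_of_nonneg (by rw [← hs]; linarith)]
      rw [this]
      exact pow_le_pow_left₀ (by linarith) hs2 _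
    have h3 := hBle i
    calc _ ≤ 2 ^ (d + 1) * (b i * H / (M : ℝ) ^ 2) := by gcongr
      _ ≤ 2 ^ (d + 1) * (B * H / (M : ℝ) ^ 2) := by gcongr
      _ = _ := by ring
  have hmatch : ∀ κ : Fin (d + 1) → ℂ, q.roots = Finset.univ.val.map κ →
      ∃ σ : Equiv.Perm (Fin (d + 1)), (∀ i, ‖κ (σ i) - y i‖ < C₁ / M / 4) ∧
        (∀ i, ‖κ (σ i) - y i‖ ≤ G / (C₁ / 2) ^ d * H / (M : ℝ) ^ 2) ∧
        ‖κ (σ 0) - y 0‖ ≤ G / (C₁ / 2) ^ d * H / (M : ℝ) ^ (d + 2) := by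
    intro κ hκ
    have hprod : ∀ i (E : ℝ), ‖q.eval (y i)‖ ≤ E →
        ∏ k, ‖y i - κ k‖ ≤ E / (J / 2 * (M : ℝ) ^ d) := by
      intro i E hE
      rw [norm_eval_eq_mul_prod_roots q κ hκ, hlc] at hE
      rw [le_div_iff₀ (by positivity)]
      refine le_trans ?_ hE
      rw [mul_comm]
      exact mul_le_mul_of_nonneg_right hlead (Finset.prod_nonneg fun _ _ => norm_nonneg _)
    let e : Fin (d + 1) → ℝ := fun i =>
      if i = 0 then G * H / (M : ℝ) ^ (2 * d + 2) else G * H / (M : ℝ) ^ (d + 2)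
    have heq : e 0 = G * H / (M : ℝ) ^ (2 * d + 2) := if_pos rfl
    have hle : ∀ i, e i ≤ G * H / (M : ℝ) ^ (d + 2) := by
      intro i
      simp only [e]
      split_ifs
      · gcongr
        · exact hM1'.le
        · omega
      · exact le_rfl
    have he : ∀ i, ∏ k, ‖y i - κ k‖ ≤ e i := by
      intro i
      simp only [e]
      split_ifs with hi
      · subst hi
        refine (hprod 0 _ (hy0 ▸ hevalw)).trans ?_
        calc _ = C / (J / 2) * H / (M : ℝ) ^ (2 * d + 2) := by
              have : (2 * d + 2) = (d + 2) + d := by ring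
              rw [this, pow_add]; field_simp; ring
          _ ≤ _ := by
              rw [hG]; gcongr
              have : 0 < 2 ^ (d + 1) * B := by positivity
              linarith
      · refine (hprod i _ (hevaly i)).trans ?_
        calc _ = 2 ^ (d + 1) * B / (J / 2) * H / (M : ℝ) ^ (d + 2) := by
              field_simp; ring
          _ ≤ _ := by
              rw [hG]; gcongr
              linarith
    have hsmall : ∀ i, e i < (C₁ / M / 4) ^ (d + 1) := by
      intro i
      refine (hle i).trans_lt ?_
      rw [div_right_comm, div_pow, div_lt_div_iff₀ (by positivity) (by positivity), pow_succ _ (d + 1)]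
      have := mul_lt_mul_of_pos_right hMG (pow_pos hM0 (d + 1))
      calc _ < _ := this
        _ = _ := by ring
    have hsep : ∀ i i', i ≠ i' → C₁ / M ≤ ‖y i - y i'‖ := by
      intro i i' hne
      rcases lt_or_gt_of_ne hne with h | h
      · rw [norm_sub_rev]
        exact (hstep i i' h).trans (norm_sub_norm_le _ _)
      · exact (hstep i' i h).trans (norm_sub_norm_le _ _)
    obtain ⟨σ, hσ⟩ := exists_perm_norm_sub_le y κ (s := C₁ / M) (by positivity) hsep e he hsmall
    have hden : (C₁ / M / 2) ^ (d + 1 - 1) = (C₁ / 2) ^ d / (M : ℝ) ^ d := by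
      rw [div_right_comm, div_pow, Nat.add_sub_cancel]
    refine ⟨σ, fun i => (hσ i).1, fun i => (hσ i).2.trans ?_, (hσ 0).2.trans ?_⟩
    · rw [hden]
      calc _ ≤ G * H / (M : ℝ) ^ (d + 2) / ((C₁ / 2) ^ d / (M : ℝ) ^ d) := by
            gcongr; exact hle i
        _ = _ := by rw [pow_add]; field_simp
    · rw [hden, heq]
      refine le_of_eq ?_
      have : (2 * d + 2) = (d + 2) + d := by ring
      rw [this, pow_add]; field_simp
  refine ⟨fun i => ?_, fun i i' hii => ?_, hcard, fun κ hκ hmono => ?_, fun z hz => ?_⟩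
  · obtain ⟨s, h1, -, h2, -⟩ := hray i
    exact ⟨s, h1, h2⟩
  · rw [norm_sub_rev]
    exact (hstep i i' hii).trans (norm_sub_norm_le _ _)
  · obtain ⟨σ, h1, h2, h3⟩ := hmatch κ hκ
    have hσ := perm_eq_one_of_monotone y κ hstep (by positivity) hmono σ h1
    subst hσ
    exact ⟨fun i _ => h2 i, by simpa [hy0] using h3⟩
  · obtain ⟨κ, hκ⟩ := exists_eq_map_univ q.roots hcard
    obtain ⟨σ, h1, -, h3⟩ := hmatch κ hκ
    obtain ⟨hzr, hzmin⟩ := hz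
    have hzr' := hzr
    rw [hκ] at hzr'
    obtain ⟨k, -, rfl⟩ := Multiset.mem_map.1 hzr'
    obtain ⟨i, rfl⟩ := σ.surjective k
    have hmem : κ (σ 0) ∈ q.roots := by rw [hκ]; exact Multiset.mem_map_of_mem _ (Finset.mem_univ (σ 0))
    have h4 := hzmin _ hmem
    by_cases hi : i = 0
    · subst hi; rw [hy0] at h3; exact h3
    · -- A root matched with another model root lies too far outside the unit circle.
      exfalso
      have h5 := hstep 0 i (Fin.pos_of_ne_zero hi)
      have h6 := h1 i
      have h7 := h1 0
      have h8 := (abs_le.1 (abs_norm_sub_norm_le (κ (σ i)) (y i))).1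
      have h9 := abs_norm_sub_norm_le (κ (σ 0)) (y 0)
      have hy01 : ‖y 0‖ = 1 := by rw [hy0, hw]
      rw [hy01] at h5 h9
      have h10 := le_abs_self (‖κ (σ i)‖ - 1)
      have : 0 < C₁ / M := by positivity
      linarith

/-! ### The linear system for the magnitudes -/

lemma fwdDiff_iter_pow_base (θ : ℂ) (m k : ℕ) :
    (fwdDiff 1)^[m] (fun k : ℕ => θ ^ k) k = (θ - 1) ^ m * θ ^ k := by
  induction m generalizing k with
  | zero => simp
  | succ m ih =>
    rw [Function.iterate_succ_apply', fwdDiff, ih, ih, pow_succ, pow_succ]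
    ring

/-- For `θ` within `1 / M` of `1` the sequence `θ ^ k - 1` obeys difference bounds. -/
lemma diffBound_pow_sub_one {M D : ℕ} (hM : 1 ≤ M) {θ : ℂ} (hθ : ‖θ - 1‖ ≤ (M : ℝ)⁻¹) :
    DiffBound M D ((D + 1) * Real.exp (D + 1) * ‖θ - 1‖ * M) (fun k => θ ^ k - 1) := by
  have hM' : (1 : ℝ) ≤ M := by exact_mod_cast hM
  have hM0 : (M : ℝ) ≠ 0 := by positivity
  have hexp : ∀ i ≤ D, ‖θ‖ ^ (M + i) ≤ Real.exp (D + 1) := by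
    intro i hi
    have h1 : ‖θ‖ ≤ Real.exp ((M : ℝ)⁻¹) := by
      have h2 := norm_sub_norm_le θ 1
      rw [norm_one] at h2
      linarith [Real.add_one_le_exp ((M : ℝ)⁻¹)]
    calc ‖θ‖ ^ (M + i) ≤ Real.exp ((M : ℝ)⁻¹) ^ (M + i) := pow_le_pow_left₀ (norm_nonneg _) h1 _
      _ = Real.exp ((M + i : ℕ) * (M : ℝ)⁻¹) := (Real.exp_nat_mul _ _).symm
      _ ≤ _ := by
        refine Real.exp_le_exp.2 ?_
        rw [← div_eq_mul_inv, div_le_iff₀ (by positivity)]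
        have : (i : ℝ) ≤ D := by exact_mod_cast hi
        push_cast
        nlinarith [(Nat.cast_nonneg i : (0 : ℝ) ≤ i)]
  have hE := Real.exp_pos (D + 1 : ℝ)
  intro m i hmi
  rcases m with _ | m
  · simp only [Function.iterate_zero, id_eq, pow_zero, div_one]
    have hgeom : θ ^ (M + i) - 1 = (∑ t ∈ Finset.range (M + i), θ ^ t) * (θ - 1) :=
      (geom_sum_mul θ (M + i)).symm
    rw [hgeom, norm_mul]
    have h1 : ‖∑ t ∈ Finset.range (M + i), θ ^ t‖ ≤ (M + i : ℕ) * Real.exp (D + 1) := by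
      refine (norm_sum_le _ _).trans ?_
      have : ∀ t ∈ Finset.range (M + i), ‖θ ^ t‖ ≤ Real.exp (D + 1) := by
        intro t ht
        rw [norm_pow]
        rcases le_total ‖θ‖ 1 with h | h
        · exact (pow_le_one₀ (norm_nonneg _) h).trans (Real.one_le_exp (by positivity))
        · exact (pow_le_pow_right₀ h (Finset.mem_range.1 ht).le).trans (hexp i (by omega))
      refine (Finset.sum_le_sum this).trans ?_
      simp
    have h2 : ((M + i : ℕ) : ℝ) ≤ (D + 1) * M := by
      have : (i : ℝ) ≤ D := by exact_mod_cast (by omega : i ≤ D)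
      push_cast
      nlinarith [(Nat.cast_nonneg i : (0 : ℝ) ≤ i)]
    calc _ ≤ ((D + 1) * M) * Real.exp (D + 1) * ‖θ - 1‖ := by
          refine mul_le_mul_of_nonneg_right (h1.trans ?_) (norm_nonneg _)
          gcongr
      _ = _ := by ring
  · have hd : fwdDiff 1 (fun k : ℕ => θ ^ k - 1) = fwdDiff 1 (fun k : ℕ => θ ^ k) := by
      funext k; simp [fwdDiff]
    rw [Function.iterate_succ_apply, hd, ← Function.iterate_succ_apply, fwdDiff_iter_pow_base,
      norm_mul, norm_pow, norm_pow]
    calc ‖θ - 1‖ ^ (m + 1) * ‖θ‖ ^ (M + i)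
        ≤ (((M : ℝ)⁻¹) ^ m * ‖θ - 1‖) * Real.exp (D + 1) := by
          rw [pow_succ]
          gcongr
          exact hexp i (by omega)
      _ = Real.exp (D + 1) * ‖θ - 1‖ * M / (M : ℝ) ^ (m + 1) := by
          rw [inv_pow, pow_succ]; field_simp
      _ ≤ _ := by
          gcongr
          exact le_mul_of_one_le_left hE.le (by linarith [(Nat.cast_nonneg D : (0 : ℝ) ≤ D)])

lemma sum_fin_eq_sum_range_rev (d : ℕ) (k : ℂ) (B : Fin (d + 1) → ℂ) :
    ∑ l : Fin (d + 1), (Complex.I * k) ^ (d - (l : ℕ)) * B l =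
      ∑ t ∈ Finset.range (d + 1), (Complex.I ^ t * B (Fin.ofNat (d + 1) (d - t))) * k ^ t := by
  rw [← Finset.sum_range_reflect, Finset.sum_range]
  refine Finset.sum_congr rfl fun l _ => ?_
  have hl : (l : ℕ) ≤ d := by have := l.2; omega
  have h1 : d + 1 - 1 - (l : ℕ) = d - l := by omega
  have h2 : Fin.ofNat (d + 1) (d - (d - (l : ℕ))) = l := by
    apply Fin.ext
    simp only [Fin.ofNat]
    rw [Nat.sub_sub_self hl, Nat.mod_eq_of_lt l.2]
  rw [h1, h2, mul_pow]
  ring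

/-- The system for the magnitudes is uniquely solvable, and its solution is close to the true
magnitudes, for every `z` close enough to the location `w` of the jump. -/
lemma exists_magnitudes (d d₁ : ℕ) (hd : 2 * d + 1 ≤ d₁) {C₀ : ℝ} (hC₀ : 0 < C₀) {C₂ : ℝ}
    (hC₂ : 0 < C₂) :
    ∃ C₄ C₅ : ℝ, 0 < C₄ ∧ 0 < C₅ ∧
    ∀ (w z : ℂ) (A : ℕ → ℝ) (H : ℝ) (c : ℤ → ℂ) (M : ℕ), ‖w‖ = 1 → 1 ≤ H →
      (∀ l ≤ d₁, |A l| ≤ H) → C₅ * H < M →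
      (∀ i ≤ d + 1, ‖c (M + i : ℕ) - jumpCoeff d₁ A w (M + i : ℕ)‖ ≤ C₀ * H / (M : ℝ) ^ (d₁ + 2)) →
      ‖z - w‖ ≤ C₂ * H / (M : ℝ) ^ (d + 2) →
      (∃! B : Fin (d + 1) → ℂ, SolvesMagnitudes d c M z B) ∧
      ∀ B : Fin (d + 1) → ℂ, SolvesMagnitudes d c M z B → ∀ l : Fin (d + 1),
        ‖B l - (A l : ℂ)‖ ≤ C₄ * H ^ 2 * (M : ℝ) ^ (((l : ℕ) : ℤ) - (d : ℤ) - 1) := by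
  obtain ⟨C, hC, hdemod⟩ := exists_diffBound_demod d d₁ hd C₀ hC₀
  obtain ⟨Q, hQ, hcoef⟩ := exists_coeff_le_of_fwdDiff_le d
  set E : ℝ := (d + 1) * Real.exp (d + 1) with hE
  have hEpos : 0 < E := by positivity
  set F : ℝ := C + 2 ^ d * (C * (E * (2 * C₂))) with hF
  have hFpos : 0 < F := by positivity
  refine ⟨Q * F, 2 * C₂ + 1, by positivity, by positivity, fun w z A H c M hw hH hA hMH hc hz => ?_⟩
  have hH0 : 0 < H := by linarith
  have hM1' : (1 : ℝ) < M := by nlinarith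
  have hM1 : 1 ≤ M := by exact_mod_cast hM1'.le
  have hM0 : (0 : ℝ) < M := by linarith
  have hMne : (M : ℝ) ≠ 0 := hM0.ne'
  have hMC : 2 * C₂ * H ≤ M := by nlinarith
  have hw0 : w ≠ 0 := by intro h; rw [h, norm_zero] at hw; exact zero_ne_one hw
  have hρ := hdemod w A H c M hw hH0.le hA hM1 hc
  have hpow2 : (M : ℝ) ^ (d + 2) = (M : ℝ) ^ (d + 1) * M := pow_succ _ _
  have hMd : (1 : ℝ) ≤ (M : ℝ) ^ (d + 1) := one_le_pow₀ hM1'.le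
  have hz2 : ‖z - w‖ ≤ 1 / 2 := by
    refine hz.trans ?_
    rw [div_le_iff₀ (by positivity), hpow2]
    nlinarith
  have hznorm : 1 / 2 ≤ ‖z‖ := by
    have := norm_sub_norm_le w z
    rw [norm_sub_rev, hw] at this
    linarith
  have hz0 : z ≠ 0 := by intro h; rw [h, norm_zero] at hznorm; linarith
  set θ : ℂ := w / z with hθ
  have hθ1 : ‖θ - 1‖ ≤ 2 * C₂ * H / (M : ℝ) ^ (d + 2) := by
    have : θ - 1 = (w - z) / z := by rw [hθ]; field_simp
    rw [this, norm_div, norm_sub_rev, div_le_iff₀ (by linarith)]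
    have h0 : 0 ≤ C₂ * H / (M : ℝ) ^ (d + 2) := by positivity
    calc _ ≤ C₂ * H / (M : ℝ) ^ (d + 2) := hz
      _ = 2 * (C₂ * H / (M : ℝ) ^ (d + 2)) * (1 / 2) := by ring
      _ ≤ 2 * (C₂ * H / (M : ℝ) ^ (d + 2)) * ‖z‖ := by gcongr
      _ = _ := by ring
  have hθM : ‖θ - 1‖ ≤ (M : ℝ)⁻¹ := by
    refine hθ1.trans ?_
    rw [div_le_iff₀ (by positivity), hpow2, mul_comm ((M : ℝ) ^ (d + 1)), ← mul_assoc,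
      inv_mul_cancel₀ hMne, one_mul, pow_succ]
    have : (1 : ℝ) ≤ (M : ℝ) ^ d := one_le_pow₀ hM1'.le
    nlinarith
  -- The right-hand side of the system, less the contribution of the true magnitudes.
  set g : ℕ → ℂ := fun k => demod d c w k * θ ^ k - jumpSymbol d (d + 1) A k with hg
  have hgbound : DiffBound M d (F * H ^ 2 / M) g := by
    have h1 := (hρ (d + 1) le_rfl).of_le (Nat.le_succ d)
    have h0 : DiffBound M d (C * H * (M : ℝ) ^ d) (demod d c w) := by
      have := (hρ 0 (by omega)).of_le (Nat.le_succ d)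
      simpa [jumpSymbol] using this
    have h2 := h1.add (h0.mul (diffBound_pow_sub_one hM1 hθM))
    refine (h2.congr (g := g) fun i _ => ?_).mono ?_
    · simp only [hg]; ring
    · have e1 : (M : ℝ) ^ ((d : ℤ) - (d + 1 : ℕ)) = (M : ℝ)⁻¹ := by
        have : (d : ℤ) - (d + 1 : ℕ) = -1 := by push_cast; ring
        rw [this, zpow_neg_one]
      rw [e1]
      calc _ ≤ C * H ^ 2 * (M : ℝ)⁻¹ + 2 ^ d * (C * H * (M : ℝ) ^ d *
            (E * (2 * C₂ * H / (M : ℝ) ^ (d + 2)) * M)) := by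
            gcongr
            nlinarith
        _ = _ := by
            rw [hF, hpow2, pow_succ]
            field_simp
            ring
  have hrhs : ∀ k : ℕ, scaledCoeff d c k * z ^ (-(k : ℤ)) =
      g k + jumpSymbol d (d + 1) A k := by
    intro k
    simp only [hg, demod, hθ]
    rw [zpow_neg, zpow_natCast, div_pow]
    have := pow_ne_zero k hw0
    have := pow_ne_zero k hz0
    field_simp
    ring
  have hsymb : ∀ k : ℕ, jumpSymbol d (d + 1) A k =
      ∑ l : Fin (d + 1), (Complex.I * k) ^ (d - (l : ℕ)) * (A l : ℂ) := by
    intro k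
    rw [jumpSymbol, Finset.sum_range]
    refine Finset.sum_congr rfl fun l _ => ?_
    have hl : (l : ℕ) ≤ d := by have := l.2; omega
    have : (d : ℤ) - (l : ℕ) = ((d - l : ℕ) : ℤ) := by omega
    rw [this, zpow_natCast, zpow_natCast, mul_pow]
    ring
  -- The operator `B ↦ (∑ (ik)^(d-l) B_l)_k` is injective with controlled inverse.
  have hinv : ∀ (B : Fin (d + 1) → ℂ) (f : ℕ → ℂ) (b : ℝ), DiffBound M d b f →
      (∀ i ≤ d, ∑ l : Fin (d + 1), (Complex.I * ((M + i : ℕ) : ℂ)) ^ (d - (l : ℕ)) * B l =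
        f (M + i)) → ∀ l : Fin (d + 1), ‖B l‖ ≤ Q * (b / (M : ℝ) ^ (d - (l : ℕ))) := by
    intro B f b hf hB l
    have hl : (l : ℕ) ≤ d := by have := l.2; omega
    have h1 := hcoef M hM1 b (fun t => Complex.I ^ t * B (Fin.ofNat (d + 1) (d - t))) ?_
      (d - l) (by omega)
    · have h2 : Fin.ofNat (d + 1) (d - (d - (l : ℕ))) = l := by
        apply Fin.ext
        simp only [Fin.ofNat]
        rw [Nat.sub_sub_self hl, Nat.mod_eq_of_lt l.2]
      simp only [h2] at h1
      rwa [norm_mul, norm_pow, Complex.norm_I, one_pow, one_mul] at h1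
    · intro n hn
      have h2 := hf n 0 (by omega)
      rw [add_zero] at h2
      rw [fwdDiff_iter_congr (g := f)]
      · exact h2
      · intro i hi
        rw [← hB i (by omega), sum_fin_eq_sum_range_rev]
  let T : (Fin (d + 1) → ℂ) →ₗ[ℂ] (Fin (d + 1) → ℂ) :=
    { toFun := fun B i => ∑ l : Fin (d + 1), (Complex.I * ((M + i : ℕ) : ℂ)) ^ (d - (l : ℕ)) * B l
      map_add' := fun B B' => by
        funext i
        simp only [Pi.add_apply, mul_add, Finset.sum_add_distrib]
      map_smul' := fun a B => by
        funext i
        simp only [Pi.smul_apply, smul_eq_mul, RingHom.id_apply, Finset.mul_sum]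
        exact Finset.sum_congr rfl fun l _ => by ring }
  have hTinj : Function.Injective T := by
    rw [← LinearMap.ker_eq_bot, LinearMap.ker_eq_bot']
    intro B hB
    funext l
    have := hinv B (fun _ => 0) 0 DiffBound.zero (fun i hi => ?_) l
    · simpa using this
    · exact congrFun hB ⟨i, by omega⟩
  have hsolve : ∀ B, SolvesMagnitudes d c M z B ↔
      T B = fun i : Fin (d + 1) => scaledCoeff d c (M + i) * z ^ (-((M + i : ℕ) : ℤ)) := by
    intro B
    constructor
    · intro h
      funext i
      exact (h (M + i) (Finset.mem_Icc.2 ⟨by omega, by have := i.2; omega⟩)).symm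
    · intro h k hk
      obtain ⟨hk1, hk2⟩ := Finset.mem_Icc.1 hk
      obtain ⟨i, rfl⟩ := Nat.exists_eq_add_of_le hk1
      exact (congrFun h ⟨i, by omega⟩).symm
  refine ⟨?_, fun B hB l => ?_⟩
  · obtain ⟨B, hB⟩ := (LinearMap.injective_iff_surjective.1 hTinj)
      (fun i : Fin (d + 1) => scaledCoeff d c (M + i) * z ^ (-((M + i : ℕ) : ℤ)))
    exact ⟨B, (hsolve B).2 hB, fun B' hB' => hTinj (((hsolve B').1 hB').trans hB.symm)⟩
  · have hl : (l : ℕ) ≤ d := by have := l.2; omega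
    have h1 := hinv (fun l => B l - (A l : ℂ)) g _ hgbound (fun i hi => ?_) l
    · refine h1.trans (le_of_eq ?_)
      have : ((l : ℕ) : ℤ) - (d : ℤ) - 1 = -((d - l : ℕ) : ℤ) + (-1) := by omega
      rw [this, zpow_add₀ hMne, zpow_neg, zpow_natCast, zpow_neg_one]
      field_simp
    · have h2 := hB (M + i) (Finset.mem_Icc.2 ⟨by omega, by omega⟩)
      rw [hrhs, hsymb] at h2
      simp only [mul_sub, Finset.sum_sub_distrib]
      rw [← h2]
      ring

section

/-! ### The bump and its derivatives -/

lemma mollifier_eq (x : ℝ) : mollifier x = expNegInvGlue (1 - x ^ 2) := by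
  have h : |x| < 1 ↔ ¬ (1 - x ^ 2 ≤ 0) := by
    rw [not_le, sub_pos, sq_lt_one_iff_abs_lt_one]
  rw [mollifier, expNegInvGlue]
  by_cases hx : |x| < 1
  · rw [if_pos hx, if_neg (h.1 hx), neg_div, one_div]
  · rw [if_neg hx, if_pos (by rwa [h, not_not] at hx)]

lemma contDiff_mollifier : ContDiff ℝ (⊤ : ℕ∞) mollifier := by
  have h : mollifier = fun x => expNegInvGlue (1 - x ^ 2) := funext mollifier_eq
  rw [h]
  exact expNegInvGlue.contDiff.comp (by fun_prop)

lemma mollifier_eq_zero {x : ℝ} (h : 1 ≤ |x|) : mollifier x = 0 := if_neg (not_lt.2 h)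

lemma integral_mollifier_pos : 0 < ∫ y in (-1 : ℝ)..1, mollifier y := by
  refine intervalIntegral.intervalIntegral_pos_of_pos_on
    (contDiff_mollifier.continuous.intervalIntegrable _ _) (fun x hx => ?_) (by norm_num)
  rw [mollifier, if_pos (abs_lt.2 hx)]
  exact Real.exp_pos _

lemma integral_mollifier_eq_zero {a b : ℝ} (h : ∀ x ∈ Set.uIcc a b, 1 ≤ |x|) :
    ∫ y in a..b, mollifier y = 0 :=
  intervalIntegral.integral_zero_ae (Filter.Eventually.of_forall fun x hx =>
    mollifier_eq_zero (h x (Set.uIoc_subset_uIcc hx)))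

/-- The distribution function of the mollifier. -/
def mollifierCdf (x : ℝ) : ℝ := ∫ y in (-1)..x, mollifier y

lemma contDiff_mollifierCdf : ContDiff ℝ (⊤ : ℕ∞) mollifierCdf := by
  have hd : ∀ x, HasDerivAt mollifierCdf (mollifier x) x := fun x =>
    intervalIntegral.integral_hasDerivAt_right
      (contDiff_mollifier.continuous.intervalIntegrable _ _)
      (contDiff_mollifier.continuous.stronglyMeasurableAtFilter _ _)
      contDiff_mollifier.continuous.continuousAt
  rw [contDiff_infty_iff_deriv]
  refine ⟨fun x => (hd x).differentiableAt, ?_⟩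
  rw [show deriv mollifierCdf = mollifier from funext fun x => (hd x).deriv]
  exact contDiff_mollifier

lemma mollifierCdf_of_le {x : ℝ} (h : x ≤ -1) : mollifierCdf x = 0 := by
  refine integral_mollifier_eq_zero fun y hy => ?_
  rw [Set.uIcc_of_ge h] at hy
  rw [le_abs]
  right
  linarith [hy.2]

lemma mollifierCdf_of_ge {x : ℝ} (h : 1 ≤ x) : mollifierCdf x = ∫ y in (-1 : ℝ)..1, mollifier y := by
  have hi : ∀ a b : ℝ, IntervalIntegrable mollifier MeasureTheory.volume a b := fun a b =>
    contDiff_mollifier.continuous.intervalIntegrable _ _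
  rw [mollifierCdf, ← intervalIntegral.integral_add_adjacent_intervals (hi (-1) 1) (hi 1 x),
    integral_mollifier_eq_zero (a := 1) (b := x), add_zero]
  intro y hy
  rw [Set.uIcc_of_le h] at hy
  exact hy.1.trans (le_abs_self y)

lemma bump_eq_mollifierCdf {E t : ℝ} (hs : E - t / 2 ≠ 0) (x : ℝ) :
    bump E t x = (∫ y in (-1 : ℝ)..1, mollifier y)⁻¹ *
      (mollifierCdf ((x + (E + t) / 3) / ((E - t / 2) / 3)) -
        mollifierCdf ((x - (E + t) / 3) / ((E - t / 2) / 3))) := by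
  set s := (E - t / 2) / 3 with hsdef
  have hs' : s ≠ 0 := by rw [hsdef]; exact div_ne_zero hs (by norm_num)
  have hi : ∀ a b : ℝ, IntervalIntegrable mollifier MeasureTheory.volume a b := fun a b =>
    contDiff_mollifier.continuous.intervalIntegrable _ _
  have h1 : ∫ τ in (-((E + t) / 3))..((E + t) / 3), mollifier ((x - τ) / s) =
      s * ∫ y in ((x - (E + t) / 3) / s)..((x + (E + t) / 3) / s), mollifier y := by
    have := intervalIntegral.integral_comp_sub_div (a := -((E + t) / 3)) (b := (E + t) / 3)
      mollifier hs' (x / s)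
    simp only [← sub_div, smul_eq_mul] at this
    rw [this, sub_neg_eq_add]
  have h2 := intervalIntegral.integral_add_adjacent_intervals
    (hi (-1) ((x - (E + t) / 3) / s)) (hi _ ((x + (E + t) / 3) / s))
  have hΔ := integral_mollifier_pos.ne'
  rw [bump, ← hsdef, h1, mollifierCdf, mollifierCdf, ← h2, add_sub_cancel_left]
  field_simp

/-- The bump with the separation scaled to `1`. -/
def unitBump : ℝ → ℝ := bump 1 (2 / 3)

lemma bump_eq_unitBump {J : ℝ} (hJ : 0 < J) (x : ℝ) :
    bump J (2 * (J / 3)) x = unitBump (x / J) := by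
  have h : J - 2 * (J / 3) / 2 ≠ 0 := by
    have : 0 < J - 2 * (J / 3) / 2 := by linarith
    exact this.ne'
  rw [unitBump, bump_eq_mollifierCdf h, bump_eq_mollifierCdf (by norm_num)]
  congr 3
  · field_simp
  · field_simp

lemma contDiff_unitBump : ContDiff ℝ (⊤ : ℕ∞) unitBump := by
  have h : unitBump = fun x => (∫ y in (-1 : ℝ)..1, mollifier y)⁻¹ *
      (mollifierCdf ((x + (1 + 2 / 3) / 3) / ((1 - 2 / 3 / 2) / 3)) -
        mollifierCdf ((x - (1 + 2 / 3) / 3) / ((1 - 2 / 3 / 2) / 3))) :=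
    funext fun x => bump_eq_mollifierCdf (by norm_num) x
  rw [h]
  exact contDiff_const.mul ((contDiff_mollifierCdf.comp (by fun_prop)).sub
    (contDiff_mollifierCdf.comp (by fun_prop)))

lemma unitBump_eq_one {x : ℝ} (h : |x| ≤ 1 / 3) : unitBump x = 1 := by
  obtain ⟨h1, h2⟩ := abs_le.1 h
  rw [unitBump, bump_eq_mollifierCdf (by norm_num), mollifierCdf_of_ge, mollifierCdf_of_le, sub_zero,
    inv_mul_cancel₀ integral_mollifier_pos.ne']
  · rw [div_le_iff₀ (by norm_num)]; linarith
  · rw [le_div_iff₀ (by norm_num)]; linarith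

lemma unitBump_eq_zero {x : ℝ} (h : 7 / 9 ≤ |x|) : unitBump x = 0 := by
  rw [unitBump, bump_eq_mollifierCdf (by norm_num)]
  rcases le_abs.1 h with h | h
  · rw [mollifierCdf_of_ge, mollifierCdf_of_ge, sub_self, mul_zero]
    · rw [le_div_iff₀ (by norm_num)]; linarith
    · rw [le_div_iff₀ (by norm_num)]; linarith
  · rw [mollifierCdf_of_le, mollifierCdf_of_le, sub_self, mul_zero]
    · rw [div_le_iff₀ (by norm_num)]; linarith
    · rw [div_le_iff₀ (by norm_num)]; linarith

/-- The `p`-th derivative of the unit bump, with complex values. -/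
def bumpDeriv (p : ℕ) : ℝ → ℂ := iteratedDeriv p (fun x => (unitBump x : ℂ))

lemma contDiff_unitBump_ofReal : ContDiff ℝ (⊤ : ℕ∞) (fun x => (unitBump x : ℂ)) :=
  Complex.ofRealCLM.contDiff.comp contDiff_unitBump

lemma contDiff_bumpDeriv (p : ℕ) : ContDiff ℝ (⊤ : ℕ∞) (bumpDeriv p) := by
  rw [bumpDeriv, iteratedDeriv_eq_iterate]
  exact contDiff_unitBump_ofReal.iterate_deriv p

lemma bumpDeriv_zero (x : ℝ) : bumpDeriv 0 x = (unitBump x : ℂ) := by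
  rw [bumpDeriv, iteratedDeriv_zero]

lemma bumpDeriv_eqOn_of_isOpen {U : Set ℝ} (hU : IsOpen U) {a : ℝ} (h : ∀ x ∈ U, unitBump x = a)
    {p : ℕ} (hp : 1 ≤ p ∨ a = 0) : ∀ x ∈ closure U, bumpDeriv p x = 0 := by
  have hcl : IsClosed {x | bumpDeriv p x = 0} :=
    isClosed_eq (contDiff_bumpDeriv p).continuous continuous_const
  refine fun x hx => (closure_minimal (fun y hy => ?_) hcl) hx
  have he : (fun x => (unitBump x : ℂ)) =ᶠ[𝓝 y] fun _ => (a : ℂ) := by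
    filter_upwards [hU.mem_nhds hy] with z hz
    rw [h z hz]
  have := he.iteratedDeriv_eq p
  rw [Set.mem_ofPred_eq, bumpDeriv, this, iteratedDeriv_const]
  rcases hp with hp | hp
  · rw [if_neg (by omega)]
  · simp [hp]

lemma bumpDeriv_eq_zero_of_ge (p : ℕ) {x : ℝ} (h : 7 / 9 ≤ |x|) : bumpDeriv p x = 0 := by
  rcases le_abs.1 h with h | h
  · refine bumpDeriv_eqOn_of_isOpen (U := Set.Ioi (7 / 9)) (a := 0) isOpen_Ioi (fun y hy => ?_)
      (Or.inr rfl) x ?_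
    · exact unitBump_eq_zero (le_trans (le_of_lt hy) (le_abs_self y))
    · rw [closure_Ioi]; exact h
  · refine bumpDeriv_eqOn_of_isOpen (U := Set.Iio (-(7 / 9))) (a := 0) isOpen_Iio (fun y hy => ?_)
      (Or.inr rfl) x ?_
    · have hy : y < -(7 / 9) := hy
      exact unitBump_eq_zero (le_abs.2 (Or.inr (by linarith)))
    · rw [closure_Iio, Set.mem_Iic]; linarith

lemma bumpDeriv_eq_zero_of_le {p : ℕ} (hp : 1 ≤ p) {x : ℝ} (h : |x| ≤ 1 / 3) :
    bumpDeriv p x = 0 := by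
  refine bumpDeriv_eqOn_of_isOpen (U := Set.Ioo (-(1 / 3)) (1 / 3)) (a := 1) isOpen_Ioo
    (fun y hy => unitBump_eq_one (abs_lt.2 hy).le) (Or.inl hp) x ?_
  rw [closure_Ioo (by norm_num)]
  exact abs_le.1 h

lemma hasCompactSupport_bumpDeriv (p : ℕ) : HasCompactSupport (bumpDeriv p) := by
  refine HasCompactSupport.intro (isCompact_Icc (a := -(7 / 9 : ℝ)) (b := 7 / 9)) fun x hx => ?_
  refine bumpDeriv_eq_zero_of_ge p (not_lt.1 fun h => hx ?_)
  exact abs_le.1 h.le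

/-! ### Fourier coefficients of the localized bump -/

open scoped FourierTransform

/-- The `m`-th Fourier coefficient of the bump centred at `c`, for the separation `J`. -/
def bumpCoeff (J c : ℝ) (m : ℤ) : ℂ :=
  (J / (2 * π) : ℝ) * 𝓕 (bumpDeriv 0) (J * m / (2 * π)) * Complex.exp (-(Complex.I * m * c))

lemma fourier_bumpDeriv (p : ℕ) (y : ℝ) :
    𝓕 (bumpDeriv p) y = (2 * π * Complex.I * y) ^ p * 𝓕 (bumpDeriv 0) y := by
  have h := Real.fourier_iteratedDeriv (f := bumpDeriv 0) (N := ⊤) (n := p) (contDiff_bumpDeriv 0)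
    (fun n _ => ?_) le_top
  · have e : iteratedDeriv p (bumpDeriv 0) = bumpDeriv p := by
      rw [show bumpDeriv 0 = fun x => (unitBump x : ℂ) from funext bumpDeriv_zero]
      rfl
    rw [e] at h
    rw [h]
    rfl
  · have e : iteratedDeriv n (bumpDeriv 0) = bumpDeriv n := by
      rw [show bumpDeriv 0 = fun x => (unitBump x : ℂ) from funext bumpDeriv_zero]
      rfl
    rw [e]
    exact (contDiff_bumpDeriv n).continuous.integrable_of_hasCompactSupport
      (hasCompactSupport_bumpDeriv n)

lemma fourier_comp_mul_left (f : ℝ → ℂ) {a : ℝ} (ha : 0 < a) (y : ℝ) :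
    𝓕 (fun x => f (a * x)) y = (a⁻¹ : ℝ) * 𝓕 f (y / a) := by
  rw [Real.fourier_real_eq_integral_exp_smul, Real.fourier_real_eq_integral_exp_smul]
  have := MeasureTheory.Measure.integral_comp_mul_left
    (fun v => Complex.exp (↑(-2 * π * v * (y / a)) * Complex.I) • f v) a
  rw [abs_of_pos (inv_pos.2 ha)] at this
  rw [← Complex.real_smul, ← this]
  congr 1
  funext v
  congr 4
  field_simp

/-- The Poisson summation formula for the derivatives of the rescaled bump. -/
lemma tsum_bumpDeriv_eq {J : ℝ} (hJ : 0 < J) (c : ℝ) (p : ℕ) (x : ℝ) :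
    ∑' n : ℤ, bumpDeriv p ((x - c + 2 * π * n) / J) =
      ∑' m : ℤ, bumpCoeff J c m * (Complex.I * (J * m : ℝ)) ^ p * Complex.exp (Complex.I * m * x) := by
  have hπ := Real.pi_pos
  set a : ℝ := 2 * π / J with ha
  have hapos : 0 < a := by positivity
  let F : SchwartzMap ℝ ℂ := HasCompactSupport.toSchwartzMap (f := fun y => bumpDeriv p (a * y))
    ((hasCompactSupport_bumpDeriv p).comp_homeomorph (Homeomorph.mulLeft₀ a hapos.ne'))
    ((contDiff_bumpDeriv p).comp (contDiff_const.mul contDiff_id))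
  have h := F.tsum_eq_tsum_fourier ((x - c) / (2 * π))
  have h1 : ∀ n : ℤ, F ((x - c) / (2 * π) + n) = bumpDeriv p ((x - c + 2 * π * n) / J) := by
    intro n
    change bumpDeriv p (a * ((x - c) / (2 * π) + n)) = _
    congr 1
    rw [ha]; field_simp
  simp only [h1] at h
  rw [h]
  refine tsum_congr fun m => ?_
  rw [SchwartzMap.fourier_coe]
  change 𝓕 (fun y => bumpDeriv p (a * y)) (m : ℝ) * _ = _
  rw [fourier_comp_mul_left _ hapos, fourier_bumpDeriv, fourier_coe_apply, bumpCoeff]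
  have e1 : (m : ℝ) / a = J * m / (2 * π) := by rw [ha]; field_simp
  have e2 : a⁻¹ = J / (2 * π) := by rw [ha, inv_div]
  have e3 : Complex.exp (2 * π * Complex.I * m * ((x - c) / (2 * π) : ℝ) / (1 : ℝ)) =
      Complex.exp (-(Complex.I * m * c)) * Complex.exp (Complex.I * m * x) := by
    rw [← Complex.exp_add]
    congr 1
    push_cast
    have : (π : ℂ) ≠ 0 := by exact_mod_cast hπ.ne'
    field_simp
    ring
  have e4 : (2 * π * Complex.I * ((J * m / (2 * π) : ℝ) : ℂ)) = Complex.I * (J * m : ℝ) := by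
    push_cast
    have : (π : ℂ) ≠ 0 := by exact_mod_cast hπ.ne'
    field_simp
  rw [e1, e2, e3, e4]
  ring

/-- Only the translate nearest to the centre contributes to the periodized bump. -/
lemma tsum_bumpDeriv_eq_single {J : ℝ} (hJ : 0 < J) (hJπ : J ≤ π) (p : ℕ) {y : ℝ} (n₀ : ℤ)
    (h : |y - n₀ * (2 * π)| ≤ π) :
    ∑' n : ℤ, bumpDeriv p ((y + 2 * π * n) / J) = bumpDeriv p ((y - n₀ * (2 * π)) / J) := by
  have hπ := Real.pi_pos
  rw [tsum_eq_single (-n₀)]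
  · congr 2; push_cast; ring
  · intro n hn
    refine bumpDeriv_eq_zero_of_ge p ?_
    rw [abs_div, abs_of_pos hJ, le_div_iff₀ hJ]
    have h1 : (1 : ℝ) ≤ |((n + n₀ : ℤ) : ℝ)| := by
      rw [← Int.cast_abs]
      exact_mod_cast Int.one_le_abs (by omega)
    have e : y + 2 * π * n = (y - n₀ * (2 * π)) + 2 * π * ((n + n₀ : ℤ) : ℝ) := by
      push_cast; ring
    have h2 : |2 * π * ((n + n₀ : ℤ) : ℝ)| = 2 * π * |((n + n₀ : ℤ) : ℝ)| := by
      rw [abs_mul, abs_of_pos (by positivity)]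
    have h3 := abs_sub_abs_le_abs_sub (2 * π * ((n + n₀ : ℤ) : ℝ)) (-(y - n₀ * (2 * π)))
    rw [h2, abs_neg, sub_neg_eq_add, add_comm (2 * π * ((n + n₀ : ℤ) : ℝ)), ← e] at h3
    nlinarith

/-- Rapid decay of the Fourier coefficients of the bump, uniform in the scale `J`. -/
lemma exists_norm_bumpCoeff_le (N : ℕ) :
    ∃ C : ℝ, 0 < C ∧ ∀ J : ℝ, 0 < J → ∀ (c : ℝ) (m : ℤ),
      ‖bumpCoeff J c m‖ ≤ C * J / (1 + J * |(m : ℝ)|) ^ N := by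
  have hπ := Real.pi_pos
  let F : SchwartzMap ℝ ℂ := (hasCompactSupport_bumpDeriv 0).toSchwartzMap (contDiff_bumpDeriv 0)
  obtain ⟨S, hS⟩ : ∃ S : ℝ, ∀ y : ℝ, (1 + ‖y‖) ^ N * ‖𝓕 (bumpDeriv 0) y‖ ≤ S := by
    refine ⟨2 ^ N * (Finset.Iic (N, 0)).sup (fun m => SchwartzMap.seminorm ℝ m.1 m.2) (𝓕 F),
      fun y => ?_⟩
    have := SchwartzMap.one_add_le_sup_seminorm_apply (𝕜 := ℝ) (m := (N, 0)) le_rfl le_rfl (𝓕 F) y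
    rw [norm_iteratedFDeriv_zero, SchwartzMap.fourier_coe] at this
    exact this
  have hS0 : 0 ≤ S := le_trans (by positivity) (hS 0)
  refine ⟨(2 * π) ^ N * (S + 1), by positivity, fun J hJ c m => ?_⟩
  have hexp : ‖Complex.exp (-(Complex.I * m * c))‖ = 1 := by
    rw [Complex.norm_exp]; simp
  rw [bumpCoeff, norm_mul, norm_mul, hexp, mul_one, Complex.norm_real, Real.norm_eq_abs,
    abs_of_pos (by positivity : 0 < J / (2 * π))]
  have h1 := hS (J * m / (2 * π))
  have hm : ‖J * m / (2 * π)‖ = J * |(m : ℝ)| / (2 * π) := by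
    rw [Real.norm_eq_abs, abs_div, abs_mul, abs_of_pos hJ, abs_of_pos (by positivity : 0 < 2 * π)]
  rw [hm] at h1
  have h2 : 1 + J * |(m : ℝ)| ≤ 2 * π * (1 + J * |(m : ℝ)| / (2 * π)) := by
    have : 2 * π * (1 + J * |(m : ℝ)| / (2 * π)) = 2 * π + J * |(m : ℝ)| := by field_simp
    rw [this]
    linarith [Real.pi_gt_three]
  rw [le_div_iff₀ (by positivity)]
  have h3 : (1 + J * |(m : ℝ)|) ^ N ≤ (2 * π) ^ N * (1 + J * |(m : ℝ)| / (2 * π)) ^ N := by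
    rw [← mul_pow]
    exact pow_le_pow_left₀ (by positivity) h2 N
  set v := ‖𝓕 (bumpDeriv 0) (J * m / (2 * π))‖
  have hv : 0 ≤ v := norm_nonneg _
  have hJ2 : J / (2 * π) ≤ J := div_le_self hJ.le (by linarith [Real.pi_gt_three])
  calc J / (2 * π) * v * (1 + J * |(m : ℝ)|) ^ N
      ≤ J * v * ((2 * π) ^ N * (1 + J * |(m : ℝ)| / (2 * π)) ^ N) := by gcongr
    _ = (2 * π) ^ N * J * ((1 + J * |(m : ℝ)| / (2 * π)) ^ N * v) := by ring
    _ ≤ (2 * π) ^ N * J * S := by gcongr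
    _ ≤ (2 * π) ^ N * J * (S + 1) := by gcongr; linarith
    _ = _ := by ring

end

/-! ### Weighted sums of the coefficients of the bump -/

lemma sum_range_div_sq_le {J : ℝ} (hJ : 0 < J) (n : ℕ) :
    ∑ m ∈ Finset.range n, J / (1 + J * (m : ℝ)) ^ 2 ≤ J + 1 := by
  have key : ∀ n : ℕ, ∑ m ∈ Finset.range (n + 1), J / (1 + J * (m : ℝ)) ^ 2 ≤
      J + 1 - 1 / (1 + J * n) := by
    intro n
    induction n with
    | zero => simp
    | succ n ih =>
      rw [Finset.sum_range_succ]
      have h0 : (0 : ℝ) < 1 + J * n := by positivity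
      have h1 : (0 : ℝ) < 1 + J * (n + 1 : ℕ) := by positivity
      have h2 : 1 + J * (n : ℝ) ≤ 1 + J * (n + 1 : ℕ) := by push_cast; nlinarith
      have h3 : J / (1 + J * (n + 1 : ℕ)) ^ 2 ≤ 1 / (1 + J * n) - 1 / (1 + J * (n + 1 : ℕ)) := by
        rw [div_sub_div _ _ h0.ne' h1.ne', div_le_div_iff₀ (by positivity) (by positivity)]
        have e : 1 * (1 + J * ((n + 1 : ℕ) : ℝ)) - (1 + J * n) * 1 = J := by push_cast; ring
        rw [e, pow_two]
        gcongr
      linarith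
  rcases n with _ | n
  · simp; linarith
  · refine (key n).trans ?_
    have : 0 ≤ 1 / (1 + J * (n : ℝ)) := by positivity
    linarith

lemma summable_and_tsum_div_sq_le {J : ℝ} (hJ : 0 < J) (hJπ : J ≤ π) :
    Summable (fun m : ℤ => J / (1 + J * |(m : ℝ)|) ^ 2) ∧
      ∑' m : ℤ, J / (1 + J * |(m : ℝ)|) ^ 2 ≤ 2 * (π + 1) := by
  set f : ℤ → ℝ := fun m => J / (1 + J * |(m : ℝ)|) ^ 2 with hf
  have h0 : ∀ m, 0 ≤ f m := fun m => by positivity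
  have hsum : ∀ n : ℕ, ∑ m ∈ Finset.range n, f (m : ℤ) ≤ J + 1 := by
    intro n
    refine le_trans (le_of_eq ?_) (sum_range_div_sq_le hJ n)
    refine Finset.sum_congr rfl fun m _ => ?_
    simp [hf]
  have h1 : Summable fun n : ℕ => f (n : ℤ) :=
    summable_of_sum_range_le (fun n => h0 _) hsum
  have h2 : (fun n : ℕ => f (-(n : ℤ))) = fun n : ℕ => f (n : ℤ) := by
    funext n; simp [hf]
  have h3 : Summable fun n : ℕ => f (-(n : ℤ)) := by rw [h2]; exact h1
  refine ⟨Summable.of_nat_of_neg h1 h3, ?_⟩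
  rw [Summable.tsum_of_nat_of_neg h1 h3, h2]
  have h4 := Real.tsum_le_of_sum_range_le (fun n => h0 _) hsum
  have := h0 0
  linarith

/-- The Wiener-type norms of the bump are bounded uniformly in the scale `J`. -/
lemma exists_tsum_weighted_bumpCoeff_le (P : ℕ) :
    ∃ C : ℝ, 0 < C ∧ ∀ J : ℝ, 0 < J → J ≤ π → ∀ c : ℝ,
      Summable (fun m : ℤ => (1 + J * |(m : ℝ)|) ^ P * ‖bumpCoeff J c m‖) ∧
        ∑' m : ℤ, (1 + J * |(m : ℝ)|) ^ P * ‖bumpCoeff J c m‖ ≤ C := by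
  obtain ⟨C, hC, h⟩ := exists_norm_bumpCoeff_le (P + 2)
  have hπ := Real.pi_pos
  refine ⟨C * (2 * (π + 1)), by positivity, fun J hJ hJπ c => ?_⟩
  obtain ⟨hs, ht⟩ := summable_and_tsum_div_sq_le hJ hJπ
  have hle : ∀ m : ℤ, (1 + J * |(m : ℝ)|) ^ P * ‖bumpCoeff J c m‖ ≤
      C * (J / (1 + J * |(m : ℝ)|) ^ 2) := by
    intro m
    have h1 := h J hJ c m
    have hpos : 0 < 1 + J * |(m : ℝ)| := by positivity
    calc _ ≤ (1 + J * |(m : ℝ)|) ^ P * (C * J / (1 + J * |(m : ℝ)|) ^ (P + 2)) := by gcongr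
      _ = _ := by rw [pow_add]; field_simp
  have hsum : Summable (fun m : ℤ => (1 + J * |(m : ℝ)|) ^ P * ‖bumpCoeff J c m‖) :=
    Summable.of_nonneg_of_le (fun m => by positivity) hle (hs.mul_left C)
  refine ⟨hsum, (hsum.tsum_le_tsum hle (hs.mul_left C)).trans ?_⟩
  rw [tsum_mul_left]
  gcongr

lemma summable_norm_bumpCoeff {J : ℝ} (hJ : 0 < J) (hJπ : J ≤ π) (c : ℝ) :
    Summable (fun m : ℤ => ‖bumpCoeff J c m‖) := by
  obtain ⟨C, -, h⟩ := exists_tsum_weighted_bumpCoeff_le 0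
  simpa using (h J hJ hJπ c).1

lemma norm_exp_I_int_mul (m : ℤ) (x : ℝ) : ‖Complex.exp (Complex.I * m * x)‖ = 1 := by
  rw [Complex.norm_exp]; simp

lemma hasSum_locBump {J : ℝ} (hJ : 0 < J) (hJπ : J ≤ π) (c x : ℝ) :
    HasSum (fun m : ℤ => bumpCoeff J c m * Complex.exp (Complex.I * m * x)) (locBump J c x : ℂ) := by
  have hs : Summable (fun m : ℤ => bumpCoeff J c m * Complex.exp (Complex.I * m * x)) := by
    refine Summable.of_norm ?_
    simpa [norm_exp_I_int_mul] using summable_norm_bumpCoeff hJ hJπ c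
  have h1 := tsum_bumpDeriv_eq hJ c 0 x
  simp only [pow_zero, mul_one] at h1
  have hmem := toIocMod_mem_Ioc Real.two_pi_pos (-π) (x - c)
  have habs : |x - c - toIocDiv Real.two_pi_pos (-π) (x - c) * (2 * π)| ≤ π := by
    have e : toIocMod Real.two_pi_pos (-π) (x - c) =
        x - c - toIocDiv Real.two_pi_pos (-π) (x - c) * (2 * π) := by
      rw [toIocMod, zsmul_eq_mul]
    rw [← e, abs_le]
    exact ⟨hmem.1.le, by linarith [hmem.2]⟩
  rw [tsum_bumpDeriv_eq_single hJ hJπ 0 _ habs, bumpDeriv_zero] at h1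
  have h2 : locBump J c x = unitBump ((x - c - toIocDiv Real.two_pi_pos (-π) (x - c) * (2 * π)) / J) := by
    rw [locBump, circleBump, bump_eq_unitBump hJ, toIocMod, zsmul_eq_mul]
  rw [h2, h1]
  exact hs.hasSum

/-- At the points of the plateau of the bump all moments of its coefficients vanish, except the
zeroth, which is `1`; outside the support all of them vanish. -/
lemma tsum_moment_bumpCoeff {J : ℝ} (hJ : 0 < J) (hJπ : J ≤ π) {c x γ : ℝ}
    (h : circDist c x ≤ J / 3 ∧ γ = 1 ∨ 7 * J / 9 ≤ circDist c x ∧ γ = 0) (p : ℕ) :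
    ∑' m : ℤ, bumpCoeff J c m * (Complex.I * (J * m : ℝ)) ^ p * Complex.exp (Complex.I * m * x) =
      if p = 0 then (γ : ℂ) else 0 := by
  rw [← tsum_bumpDeriv_eq hJ]
  rw [circDist_comm] at h
  obtain ⟨n, hn, hle⟩ := circDist_eq_abs x c
  rw [tsum_bumpDeriv_eq_single hJ hJπ p n hle]
  rw [hn] at h
  rcases h with ⟨h, rfl⟩ | ⟨h, rfl⟩
  · have h' : |(x - c - n * (2 * π)) / J| ≤ 1 / 3 := by
      rw [abs_div, abs_of_pos hJ, div_le_iff₀ hJ]; linarith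
    split_ifs with hp
    · rw [hp, bumpDeriv_zero, unitBump_eq_one h']
    · exact bumpDeriv_eq_zero_of_le (by omega) h'
  · have h' : 7 / 9 ≤ |(x - c - n * (2 * π)) / J| := by
      rw [abs_div, abs_of_pos hJ, le_div_iff₀ hJ]; linarith
    rw [bumpDeriv_eq_zero_of_ge p h']
    simp

/-! ### Fourier coefficients of products -/

open MeasureTheory in
/-- The convolution theorem, for a factor with an absolutely convergent Fourier series. -/
lemma hasSum_fc_mul {u g : ℝ → ℝ} {b : ℤ → ℂ} (hu : IntervalIntegrable u volume (-π) π)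
    (hb : Summable fun m => ‖b m‖)
    (hg : ∀ x : ℝ, HasSum (fun m : ℤ => b m * Complex.exp (Complex.I * m * x)) (g x : ℂ)) (k : ℤ) :
    HasSum (fun m : ℤ => fc u (k - m) * b m) (fc (fun x => u x * g x) k) := by
  have huc : IntervalIntegrable (fun x => (u x : ℂ)) volume (-π) π :=
    ⟨hu.1.ofReal, hu.2.ofReal⟩
  have key : HasSum (fun m : ℤ => ∫ x in (-π)..π, b m *
      ((u x : ℂ) * Complex.exp (-(Complex.I * (k - m : ℤ) * x))))
      (∫ x in (-π)..π, ((u x * g x : ℝ) : ℂ) * Complex.exp (-(Complex.I * k * x))) := by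
    refine intervalIntegral.hasSum_integral_of_dominated_convergence
      (fun m x => ‖b m‖ * ‖u x‖) ?_ ?_ ?_ ?_ ?_
    · intro m
      refine AEStronglyMeasurable.const_mul ?_ _
      refine AEStronglyMeasurable.mul (intervalIntegrable_iff.1 huc).aestronglyMeasurable ?_
      exact (by fun_prop : Continuous fun x : ℝ =>
        Complex.exp (-(Complex.I * (k - m : ℤ) * x))).aestronglyMeasurable
    · intro m
      refine Filter.Eventually.of_forall fun x _ => ?_
      rw [norm_mul, norm_mul, Complex.norm_real]
      have : ‖Complex.exp (-(Complex.I * (k - m : ℤ) * x))‖ = 1 := by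
        rw [Complex.norm_exp]; simp
      rw [this, mul_one]
    · exact Filter.Eventually.of_forall fun x _ => hb.mul_right _
    · simp only [tsum_mul_right]
      exact hu.norm.const_mul _
    · refine Filter.Eventually.of_forall fun x _ => ?_
      have h1 := (hg x).mul_left ((u x : ℂ) * Complex.exp (-(Complex.I * k * x)))
      have e : ((u x * g x : ℝ) : ℂ) * Complex.exp (-(Complex.I * k * x)) =
          (u x : ℂ) * Complex.exp (-(Complex.I * k * x)) * (g x : ℂ) := by push_cast; ring
      rw [e]
      refine h1.congr_fun fun m => ?_
      have : Complex.exp (-(Complex.I * (k - m : ℤ) * x)) =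
          Complex.exp (-(Complex.I * k * x)) * Complex.exp (Complex.I * m * x) := by
        rw [← Complex.exp_add]; congr 1; push_cast; ring
      rw [this]; ring
  have h2 := key.mul_left (1 / (2 * π : ℂ))
  rw [fc]
  refine h2.congr_fun fun m => ?_
  rw [intervalIntegral.integral_const_mul, fc]
  ring

lemma fc_one (k : ℤ) : fc (fun _ => 1) k = if k = 0 then 1 else 0 := by
  have hπ : (π : ℂ) ≠ 0 := by exact_mod_cast Real.pi_ne_zero
  rw [fc]
  split_ifs with hk
  · subst hk
    simp
    field_simp
    norm_num
  · have hk' : -(Complex.I * k) ≠ 0 := by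
      simp [hk]
    have e : ∀ x : ℝ, ((1 : ℝ) : ℂ) * Complex.exp (-(Complex.I * k * x)) =
        Complex.exp (-(Complex.I * k) * x) := by
      intro x; push_cast; rw [one_mul]; congr 1; ring
    simp only [e]
    rw [integral_exp_mul_complex hk']
    have : Complex.exp (-(Complex.I * k) * (π : ℝ)) = Complex.exp (-(Complex.I * k) * ((-π : ℝ) : ℂ)) := by
      rw [Complex.exp_eq_exp_iff_exists_int]
      refine ⟨-k, ?_⟩
      push_cast; ring
    rw [this, sub_self, zero_div, mul_zero]

lemma fc_locBump {J : ℝ} (hJ : 0 < J) (hJπ : J ≤ π) (c : ℝ) (k : ℤ) :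
    fc (locBump J c) k = bumpCoeff J c k := by
  have h := hasSum_fc_mul (u := fun _ => 1) (g := locBump J c) intervalIntegrable_const
    (summable_norm_bumpCoeff hJ hJπ c) (fun x => hasSum_locBump hJ hJπ c x) k
  simp only [fc_one, one_mul] at h
  have h2 := hasSum_single (f := fun m : ℤ => (if k - m = 0 then 1 else 0) * bumpCoeff J c m) k
    (fun m hm => by rw [if_neg (by omega), zero_mul])
  have := h.unique h2
  simpa using this

lemma fc_neg (u : ℝ → ℝ) (k : ℤ) : fc u (-k) = (starRingEnd ℂ) (fc u k) := by
  rw [fc, fc, map_mul, intervalIntegral, intervalIntegral, map_sub, ← integral_conj, ← integral_conj]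
  congr 1
  · simp [Complex.conj_ofNat]
  · have : ∀ x : ℝ, (u x : ℂ) * Complex.exp (-(Complex.I * (-k : ℤ) * x)) =
      (starRingEnd ℂ) ((u x : ℂ) * Complex.exp (-(Complex.I * k * x))) := by
      intro x
      rw [map_mul, Complex.conj_ofReal, ← Complex.exp_conj]
      congr 2
      simp
    simp only [this]

lemma norm_fc_neg (u : ℝ → ℝ) (k : ℤ) : ‖fc u (-k)‖ = ‖fc u k‖ := by
  rw [fc_neg, RCLike.norm_conj]

section

open MeasureTheory

/-! ### Integrability and linearity -/

lemma fc_integrand_intervalIntegrable {u : ℝ → ℝ} (hu : IntervalIntegrable u volume (-π) π) (k : ℤ) :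
    IntervalIntegrable (fun x => (u x : ℂ) * Complex.exp (-(Complex.I * k * x))) volume (-π) π := by
  have huc : IntervalIntegrable (fun x => (u x : ℂ)) volume (-π) π :=
    ⟨hu.1.ofReal, hu.2.ofReal⟩
  exact huc.mul_continuousOn (by fun_prop)

lemma fc_sub {u v : ℝ → ℝ} (hu : IntervalIntegrable u volume (-π) π)
    (hv : IntervalIntegrable v volume (-π) π) (k : ℤ) :
    fc (fun x => u x - v x) k = fc u k - fc v k := by
  rw [fc, fc, fc, ← mul_sub, ← intervalIntegral.integral_sub (fc_integrand_intervalIntegrable hu k)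
    (fc_integrand_intervalIntegrable hv k)]
  congr 2
  funext x
  push_cast
  ring

lemma fc_const_mul (a : ℝ) (u : ℝ → ℝ) (k : ℤ) : fc (fun x => a * u x) k = a * fc u k := by
  rw [fc, fc, mul_left_comm, ← intervalIntegral.integral_const_mul (a : ℂ)]
  congr 2
  funext x
  push_cast
  ring

lemma fc_sum {ι : Type*} (s : Finset ι) {u : ι → ℝ → ℝ}
    (hu : ∀ i ∈ s, IntervalIntegrable (u i) volume (-π) π) (k : ℤ) :
    fc (fun x => ∑ i ∈ s, u i x) k = ∑ i ∈ s, fc (u i) k := by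
  simp only [fc]
  rw [← Finset.mul_sum, ← intervalIntegral.integral_finsetSum
    (fun i hi => fc_integrand_intervalIntegrable (hu i hi) k)]
  congr 2
  funext x
  rw [Complex.ofReal_sum, Finset.sum_mul]

/-- A piecewise continuous periodic function is integrable over a period. -/
lemma HasJumps.intervalIntegrable {K d₁ : ℕ} {f : ℝ → ℝ} {ξ : Fin K → ℝ} {A : ℕ → Fin K → ℝ}
    (h : HasJumps d₁ f ξ A) (a b : ℝ) : IntervalIntegrable f volume a b := by
  set U : Set ℝ := {x | ∀ (j : Fin K) (n : ℤ), x ≠ ξ j + n * (2 * π)} with hU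
  set Z : Set ℝ := Set.range (fun p : Fin K × ℤ => ξ p.1 + p.2 * (2 * π)) with hZ
  have hUZ : U = Zᶜ := by
    ext x
    constructor
    · rintro hx ⟨⟨j, n⟩, rfl⟩
      exact hx j n rfl
    · intro hx j n hxe
      exact hx ⟨(j, n), hxe.symm⟩
  have hZcount : Z.Countable := Set.countable_range _
  have hZclosed : IsClosed Z := by
    have e : Z = ⋃ j : Fin K, (fun x => (x - ξ j) / (2 * π)) ⁻¹' Set.range ((↑) : ℤ → ℝ) := by
      have hπ := Real.two_pi_pos.ne'
      ext x
      simp only [hZ, Set.mem_range, Prod.exists, Set.mem_iUnion, Set.mem_preimage]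
      refine exists_congr fun j => exists_congr fun n => ?_
      rw [eq_div_iff hπ]
      constructor <;> intro h <;> linarith
    rw [e]
    exact isClosed_iUnion_of_finite fun j =>
      Int.isClosedEmbedding_coe_real.isClosed_range.preimage (by fun_prop)
  have hUopen : IsOpen U := hUZ ▸ hZclosed.isOpen_compl
  have hcont : ContinuousOn f U := h.smooth.continuousOn
  have hmeas : AEStronglyMeasurable f volume := by
    have h1 := hcont.aestronglyMeasurable (μ := volume) hUopen.measurableSet
    have h2 : volume.restrict U = volume := by
      rw [hUZ]
      exact Measure.restrict_eq_self_of_ae_mem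
        (compl_mem_ae_iff.2 (hZcount.measure_zero volume))
    rwa [h2] at h1
  have hloc : LocallyIntegrable f volume := by
    intro x
    by_cases hx : x ∈ U
    · have ht : Tendsto f (𝓝 x) (𝓝 (f x)) := hcont.continuousAt (hUopen.mem_nhds hx)
      exact (volume.finiteAt_nhds x).integrableAtFilter_of_tendsto
        ⟨Set.univ, univ_mem, by simpa using hmeas⟩ ht
    · rw [hUZ, Set.notMem_compl_iff] at hx
      obtain ⟨⟨j, n⟩, rfl⟩ := hx
      simp only
      obtain ⟨p, q, hp, hq, -⟩ := h.jump 0 (Nat.zero_le _) j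
      rw [iteratedDeriv_zero] at hp hq
      have hper : ∀ y, f (y - n * (2 * π)) = f y := fun y => h.periodic.sub_int_mul_eq n
      have hshift : Tendsto (fun y => y - n * (2 * π)) (𝓝[<] (ξ j + n * (2 * π))) (𝓝[<] (ξ j)) ∧
          Tendsto (fun y => y - n * (2 * π)) (𝓝[>] (ξ j + n * (2 * π))) (𝓝[>] (ξ j)) := by
        have hc : Tendsto (fun y => y - n * (2 * π)) (𝓝 (ξ j + n * (2 * π))) (𝓝 (ξ j)) := by
          have : Continuous fun y : ℝ => y - n * (2 * π) := by fun_prop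
          have h2 := this.tendsto (ξ j + n * (2 * π))
          simpa using h2
        constructor
        · refine tendsto_nhdsWithin_iff.2 ⟨hc.mono_left nhdsWithin_le_nhds, ?_⟩
          filter_upwards [self_mem_nhdsWithin] with y hy
          have hy : y < ξ j + n * (2 * π) := hy
          exact (by linarith : y - n * (2 * π) < ξ j)
        · refine tendsto_nhdsWithin_iff.2 ⟨hc.mono_left nhdsWithin_le_nhds, ?_⟩
          filter_upwards [self_mem_nhdsWithin] with y hy
          have hy : ξ j + n * (2 * π) < y := hy
          exact (by linarith : ξ j < y - n * (2 * π))
      have h1 := (hp.comp hshift.1).congr hper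
      have h2 := (hq.comp hshift.2).congr hper
      rw [← nhdsNE_sup_pure, ← nhdsLT_sup_nhdsGT, IntegrableAtFilter.sup_iff,
        IntegrableAtFilter.sup_iff]
      have hm : ∀ l : Filter ℝ, StronglyMeasurableAtFilter f l volume := fun l =>
        ⟨Set.univ, univ_mem, by simpa using hmeas⟩
      refine ⟨⟨?_, ?_⟩, ?_⟩
      · exact ((volume.finiteAt_nhds _).filter_mono nhdsWithin_le_nhds).integrableAtFilter_of_tendsto
          (hm _) h1
      · exact ((volume.finiteAt_nhds _).filter_mono nhdsWithin_le_nhds).integrableAtFilter_of_tendsto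
          (hm _) h2
      · exact ⟨{ξ j + n * (2 * π)}, Set.mem_singleton _, by simp⟩
  exact (hloc.integrableOn_isCompact isCompact_uIcc).intervalIntegrable

/-! ### Fourier coefficients of the sawtooth functions -/

lemma measurable_sawtooth (n : ℕ) (ξ : ℝ) : Measurable (sawtooth n ξ) := by
  unfold sawtooth
  refine Measurable.const_mul ?_ _
  have : Continuous (bernoulliFun (n + 1)) := Polynomial.continuous _
  exact this.measurable.comp (measurable_fract.comp (by fun_prop))

lemma sawtooth_intervalIntegrable (n : ℕ) (ξ a b : ℝ) :
    IntervalIntegrable (sawtooth n ξ) volume a b := by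
  have hc : Continuous (bernoulliFun (n + 1)) := Polynomial.continuous _
  obtain ⟨C, hC⟩ := (isCompact_Icc (a := (0 : ℝ)) (b := 1)).exists_bound_of_continuousOn
    hc.continuousOn
  rw [intervalIntegrable_iff]
  refine Measure.integrableOn_of_bounded (M := |(2 * π) ^ n / (Nat.factorial (n + 1) : ℝ)| * C)
    (by rw [Set.uIoc]; exact measure_Ioc_lt_top.ne)
    (measurable_sawtooth n ξ).aestronglyMeasurable ?_
  refine Filter.Eventually.of_forall fun x => ?_
  rw [sawtooth, norm_mul, norm_neg, Real.norm_eq_abs]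
  gcongr
  exact hC _ ⟨Int.fract_nonneg _, (Int.fract_lt_one _).le⟩

lemma fc_sawtooth (n : ℕ) (ξ : ℝ) (k : ℤ) :
    fc (sawtooth n ξ) k = node ξ ^ k / (2 * π * (Complex.I * k) ^ (n + 1)) := by
  have hπ : (π : ℂ) ≠ 0 := by exact_mod_cast Real.pi_ne_zero
  have hfac : ((n + 1).factorial : ℂ) ≠ 0 := by exact_mod_cast (n + 1).factorial_ne_zero
  have hnode : node ξ ^ k = Complex.exp (-(Complex.I * k * ξ)) := by
    rw [node, ← Complex.exp_int_mul]; congr 1; ring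
  set F : ℝ → ℂ := fun x => (sawtooth n ξ x : ℂ) * Complex.exp (-(Complex.I * k * x)) with hF
  have hper : Function.Periodic F (2 * π) := by
    intro x
    simp only [hF]
    congr 1
    · have : (x + 2 * π - ξ) / (2 * π) = (x - ξ) / (2 * π) + 1 := by
        field_simp; ring
      rw [sawtooth, sawtooth, this, Int.fract_add_one]
    · rw [Complex.exp_eq_exp_iff_exists_int]
      exact ⟨-k, by push_cast; ring⟩
  have h1 : ∫ x in (-π)..π, F x = ∫ x in ξ..(ξ + 2 * π), F x := by
    have := hper.intervalIntegral_add_eq (-π) ξ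
    rwa [show -π + 2 * π = π by ring] at this
  have h2 : ∫ x in ξ..(ξ + 2 * π), F x = 2 * π * ∫ y in (0 : ℝ)..1, F (2 * π * y + ξ) := by
    have := intervalIntegral.integral_comp_mul_add (a := 0) (b := 1) F Real.two_pi_pos.ne' ξ
    rw [this, mul_zero, zero_add, mul_one, add_comm (2 * π) ξ, Complex.real_smul]
    push_cast
    field_simp
  have h3 : ∫ y in (0 : ℝ)..1, F (2 * π * y + ξ) = ∫ y in (0 : ℝ)..1,
      (-((2 * π) ^ n / ((n + 1).factorial : ℂ)) * node ξ ^ k) *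
        (fourier (-k) (y : AddCircle (1 : ℝ)) • (bernoulliFun (n + 1) y : ℂ)) := by
    rw [intervalIntegral.integral_of_le zero_le_one, intervalIntegral.integral_of_le zero_le_one,
      ← integral_Ioc_eq_integral_Ioo.symm, ← integral_Ioc_eq_integral_Ioo.symm]
    refine setIntegral_congr_fun measurableSet_Ioo fun y hy => ?_
    have e1 : (2 * π * y + ξ - ξ) / (2 * π) = y := by field_simp; ring
    have e2 : Int.fract y = y := Int.fract_eq_self.2 ⟨hy.1.le, hy.2⟩
    simp only [hF]
    rw [sawtooth, e1, e2, fourier_coe_apply, hnode, smul_eq_mul]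
    have e3 : Complex.exp (-(Complex.I * k * ((2 * π * y + ξ : ℝ) : ℂ))) =
        Complex.exp (-(Complex.I * k * ξ)) *
          Complex.exp (2 * π * Complex.I * ((-k : ℤ) : ℂ) * y / ((1 : ℝ) : ℂ)) := by
      rw [← Complex.exp_add]
      congr 1
      push_cast
      rw [div_one]
      ring
    rw [e3]
    push_cast
    ring
  have h4 := fourierCoeffOn_eq_integral (fun x => (bernoulliFun (n + 1) x : ℂ)) k zero_lt_one
  have h5 := bernoulliFourierCoeff_eq (k := n + 1) (Nat.succ_ne_zero n) k
  rw [bernoulliFourierCoeff, h4, sub_zero, div_one, one_smul] at h5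
  have h6 : fc (sawtooth n ξ) k = (1 / (2 * π : ℂ)) * ∫ x in (-π)..π, F x := rfl
  rw [h6, h1, h2, h3, intervalIntegral.integral_const_mul]
  rw [h5]
  rcases eq_or_ne k 0 with rfl | hk
  · simp
  have hk' : (k : ℂ) ≠ 0 := by exact_mod_cast hk
  have hI := Complex.I_ne_zero
  have e4 : (2 * π * Complex.I * k : ℂ) ^ (n + 1) = (2 * π) ^ (n + 1) * (Complex.I * k) ^ (n + 1) := by
    rw [← mul_pow]; ring
  rw [e4, pow_succ (2 * π : ℂ)]
  have := pow_ne_zero (n + 1) (mul_ne_zero hI hk')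
  field_simp

lemma sum_sawtooth_intervalIntegrable (n : ℕ) (ξ : ℝ) (A : ℕ → ℝ) (a b : ℝ) :
    IntervalIntegrable (fun x => ∑ l ∈ Finset.range (n + 1), A l * sawtooth l ξ x) volume a b := by
  have := IntervalIntegrable.sum (μ := volume) (a := a) (b := b) (Finset.range (n + 1))
    (f := fun l x => A l * sawtooth l ξ x)
    (fun l _ => (sawtooth_intervalIntegrable l ξ _ _).const_mul _)
  simpa [Finset.sum_fn] using this

lemma fc_singularPart {K : ℕ} (n : ℕ) (ξ : Fin K → ℝ) (A : ℕ → Fin K → ℝ) (k : ℤ) :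
    fc (singularPart n ξ A) k = ∑ j, jumpCoeff n (fun l => A l j) (node (ξ j)) k := by
  have h2 : fc (singularPart n ξ A) k =
      fc (fun x => ∑ j : Fin K, ∑ l ∈ Finset.range (n + 1), A l j * sawtooth l (ξ j) x) k := rfl
  rw [h2, fc_sum _ (fun j _ => sum_sawtooth_intervalIntegrable n (ξ j) (fun l => A l j) _ _)]
  refine Finset.sum_congr rfl fun j _ => ?_
  rw [fc_sum _ (fun l _ => (sawtooth_intervalIntegrable l (ξ j) _ _).const_mul _), jumpCoeff]
  refine Finset.sum_congr rfl fun l _ => ?_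
  rw [fc_const_mul, fc_sawtooth]

lemma singularPart_intervalIntegrable {K : ℕ} (n : ℕ) (ξ : Fin K → ℝ) (A : ℕ → Fin K → ℝ)
    (a b : ℝ) : IntervalIntegrable (singularPart n ξ A) volume a b := by
  have h := IntervalIntegrable.sum (μ := volume) (a := a) (b := b) Finset.univ
    (fun j _ => sum_sawtooth_intervalIntegrable n (ξ j) (fun l => A l j) a b)
  have e : singularPart n ξ A =
      ∑ j : Fin K, fun x => ∑ l ∈ Finset.range (n + 1), A l j * sawtooth l (ξ j) x := by
    funext x
    rw [singularPart, Finset.sum_apply]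
  rw [e]
  exact h

end

/-! ### Inversion of Vandermonde systems -/

lemma norm_coeff_prod_X_sub_C_le {ι : Type*} (s : Finset ι) {v a : ι → ℂ} {B : ℝ} (hB : 0 ≤ B)
    (hv : ∀ i ∈ s, ‖v i‖ ≤ 1) (ha : ∀ i ∈ s, ‖a i‖ ≤ B) (l : ℕ) :
    ‖(∏ i ∈ s, (C (a i) * (X - C (v i)))).coeff l‖ ≤ (2 * B) ^ s.card := by
  classical
  induction s using Finset.induction_on generalizing l with
  | empty =>
    rw [Finset.prod_empty, coeff_one]
    split_ifs <;> simp
  | insert i s hi ih =>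
    have ih' : ∀ l, _ := ih (fun j hj => hv j (Finset.mem_insert_of_mem hj))
      (fun j hj => ha j (Finset.mem_insert_of_mem hj))
    set p := ∏ j ∈ s, (C (a j) * (X - C (v j)))
    have hvi := hv i (Finset.mem_insert_self i s)
    have hai := ha i (Finset.mem_insert_self i s)
    have h1 : ‖((X - C (v i)) * p).coeff l‖ ≤ 2 * (2 * B) ^ s.card := by
      have h2 : ‖(X * p).coeff l‖ ≤ (2 * B) ^ s.card := by
        rcases l with _ | l
        · rw [coeff_X_mul_zero, norm_zero]; positivity
        · rw [coeff_X_mul]; exact ih' l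
      have h3 : ‖(C (v i) * p).coeff l‖ ≤ (2 * B) ^ s.card := by
        rw [coeff_C_mul, norm_mul]
        calc _ ≤ 1 * (2 * B) ^ s.card := by gcongr; exact ih' l
          _ = _ := one_mul _
      rw [sub_mul, coeff_sub]
      exact (norm_sub_le _ _).trans (by linarith)
    rw [Finset.prod_insert hi, Finset.card_insert_of_notMem hi, mul_assoc, coeff_C_mul, norm_mul,
      pow_succ]
    calc _ ≤ B * (2 * (2 * B) ^ s.card) := by gcongr
      _ = _ := by ring

/-- Quantitative inverse of a Vandermonde matrix with nodes in the unit disc, given by the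
coefficients of the Lagrange basis polynomials. -/
lemma exists_vandermonde_inverse {n : ℕ} {v : Fin n → ℂ} {δ : ℝ} (hδ : 0 < δ) (hδ2 : δ ≤ 2)
    (hv : ∀ i, ‖v i‖ ≤ 1) (hsep : ∀ i j, i ≠ j → δ ≤ ‖v i - v j‖) :
    ∃ b : Fin n → Fin n → ℂ, (∀ j i, ‖b j i‖ ≤ (2 / δ) ^ n) ∧
      (∀ j j', ∑ i, b j i * v j' ^ (i : ℕ) = if j = j' then 1 else 0) ∧
      ∀ i i' : Fin n, ∑ j, v j ^ (i : ℕ) * b j i' = if i = i' then 1 else 0 := by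
  classical
  have hinj : Set.InjOn v (Finset.univ : Finset (Fin n)) := by
    intro i _ j _ hij
    by_contra hne
    have := hsep i j hne
    rw [hij, sub_self, norm_zero] at this
    linarith
  set b : Fin n → Fin n → ℂ := fun j i => (Lagrange.basis Finset.univ v j).coeff i with hb
  have h1 : ∀ j j', ∑ i, b j i * v j' ^ (i : ℕ) = if j = j' then 1 else 0 := by
    intro j j'
    have hdeg : (Lagrange.basis Finset.univ v j).natDegree < n := by
      have h0 : 0 < n := j.pos
      have h := Lagrange.degree_basis hinj (Finset.mem_univ j)
      rw [natDegree_eq_of_degree_eq_some h]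
      simp
      omega
    have h2 : (Lagrange.basis Finset.univ v j).eval (v j') = ∑ i, b j i * v j' ^ (i : ℕ) := by
      rw [eval_eq_sum_range' hdeg, ← Fin.sum_univ_eq_sum_range
        (fun i => (Lagrange.basis Finset.univ v j).coeff i * v j' ^ i)]
    rw [← h2]
    split_ifs with h
    · rw [← h, Lagrange.eval_basis_self hinj (Finset.mem_univ j)]
    · exact Lagrange.eval_basis_of_ne h (Finset.mem_univ j')
  refine ⟨b, fun j i => ?_, h1, ?_⟩
  · have h2 : Lagrange.basis Finset.univ v j =
        ∏ i ∈ Finset.univ.erase j, (C ((v j - v i)⁻¹) * (X - C (v i))) := by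
      rw [Lagrange.basis]; rfl
    have h3 := norm_coeff_prod_X_sub_C_le (Finset.univ.erase j) (v := v)
      (a := fun i => (v j - v i)⁻¹) (B := 1 / δ) (by positivity) (fun i _ => hv i)
      (fun i hi => by
        rw [norm_inv, one_div]
        exact inv_anti₀ hδ (hsep j i (Finset.ne_of_mem_erase hi).symm)) i
    rw [← h2] at h3
    refine h3.trans ?_
    rw [mul_one_div]
    refine pow_le_pow_right₀ ((one_le_div hδ).2 hδ2) ?_
    exact (Finset.card_le_univ _).trans (by simp)
  · set Λ : Matrix (Fin n) (Fin n) ℂ := Matrix.of b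
    set V : Matrix (Fin n) (Fin n) ℂ := Matrix.of fun i j => v j ^ (i : ℕ)
    have hmul : Λ * V = 1 := by
      ext j j'
      rw [Matrix.mul_apply, Matrix.one_apply, ← h1 j j']
      rfl
    have hmul' : V * Λ = 1 := mul_eq_one_comm.1 hmul
    intro i i'
    have := congrFun (congrFun hmul' i) i'
    rw [Matrix.mul_apply, Matrix.one_apply] at this
    exact this

/-- A polynomial which is small at separated points has small coefficients. -/
lemma norm_coeff_le_of_eval_le {n : ℕ} {v : Fin n → ℂ} {δ : ℝ} (hδ : 0 < δ) (hδ2 : δ ≤ 2)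
    (hv : ∀ i, ‖v i‖ ≤ 1) (hsep : ∀ i j, i ≠ j → δ ≤ ‖v i - v j‖) {a : Fin n → ℂ} {B : ℝ}
    (h : ∀ j, ‖∑ l, a l * v j ^ (l : ℕ)‖ ≤ B) (l : Fin n) : ‖a l‖ ≤ n * (2 / δ) ^ n * B := by
  obtain ⟨b, hb, -, h2⟩ := exists_vandermonde_inverse hδ hδ2 hv hsep
  have e : a l = ∑ j, b j l * ∑ i, a i * v j ^ (i : ℕ) := by
    simp only [Finset.mul_sum]
    rw [Finset.sum_comm]
    have : ∀ i, ∑ j, b j l * (a i * v j ^ (i : ℕ)) = a i * if i = l then 1 else 0 := by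
      intro i
      rw [← h2 i l, Finset.mul_sum]
      exact Finset.sum_congr rfl fun j _ => by ring
    simp [this]
  rw [e]
  calc _ ≤ ∑ j, ‖b j l * ∑ i, a i * v j ^ (i : ℕ)‖ := norm_sum_le _ _
    _ ≤ ∑ _j : Fin n, (2 / δ) ^ n * B := Finset.sum_le_sum fun j _ => by
        rw [norm_mul]
        exact mul_le_mul (hb j l) (h j) (norm_nonneg _) (by positivity)
    _ = _ := by simp; ring

/-- An exponential sum with separated frequencies which is small has small amplitudes. -/
lemma norm_amplitude_le {n : ℕ} {v : Fin n → ℂ} {δ : ℝ} (hδ : 0 < δ) (hδ2 : δ ≤ 2)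
    (hv : ∀ i, ‖v i‖ ≤ 1) (hsep : ∀ i j, i ≠ j → δ ≤ ‖v i - v j‖) {a : Fin n → ℂ} {B : ℝ}
    (h : ∀ i : Fin n, ‖∑ j, a j * v j ^ (i : ℕ)‖ ≤ B) (j : Fin n) :
    ‖a j‖ ≤ n * (2 / δ) ^ n * B := by
  obtain ⟨b, hb, h1, -⟩ := exists_vandermonde_inverse hδ hδ2 hv hsep
  have e : a j = ∑ i, b j i * ∑ j', a j' * v j' ^ (i : ℕ) := by
    simp only [Finset.mul_sum]
    rw [Finset.sum_comm]
    have : ∀ j', ∑ i, b j i * (a j' * v j' ^ (i : ℕ)) = a j' * if j = j' then 1 else 0 := by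
      intro j'
      rw [← h1 j j', Finset.mul_sum]
      exact Finset.sum_congr rfl fun i _ => by ring
    simp [this]
  rw [e]
  calc _ ≤ ∑ i, ‖b j i * ∑ j', a j' * v j' ^ (i : ℕ)‖ := norm_sum_le _ _
    _ ≤ ∑ _i : Fin n, (2 / δ) ^ n * B := Finset.sum_le_sum fun i _ => by
        rw [norm_mul]
        exact mul_le_mul (hb j i) (h i) (norm_nonneg _) (by positivity)
    _ = _ := by simp; ring

/-! ### Multiplication of a sawtooth function by the bump -/

lemma abs_le_weight {J : ℝ} {k : ℕ} (hk : 1 ≤ k) (hkJ : 1 ≤ J * k) (m : ℤ) :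
    |(m : ℝ) / k| ≤ J * |(m : ℝ)| := by
  have hk' : (0 : ℝ) < k := by exact_mod_cast hk
  rw [abs_div, abs_of_pos hk', div_le_iff₀ hk']
  nlinarith [abs_nonneg (m : ℝ)]

lemma hasSum_moment_bumpCoeff {J : ℝ} (hJ : 0 < J) (hJπ : J ≤ π) {c x γ : ℝ}
    (h : circDist c x ≤ J / 3 ∧ γ = 1 ∨ 7 * J / 9 ≤ circDist c x ∧ γ = 0) {k : ℕ} (hk : 1 ≤ k)
    (hkJ : 1 ≤ J * k) (p : ℕ) :
    HasSum (fun m : ℤ => bumpCoeff J c m * Complex.exp (Complex.I * m * x) * ((m : ℂ) / k) ^ p)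
      (if p = 0 then (γ : ℂ) else 0) := by
  have hk0 : (k : ℂ) ≠ 0 := by exact_mod_cast (by omega : k ≠ 0)
  have hJ0 : (J : ℂ) ≠ 0 := by exact_mod_cast hJ.ne'
  have hs : Summable fun m : ℤ =>
      bumpCoeff J c m * Complex.exp (Complex.I * m * x) * ((m : ℂ) / k) ^ p := by
    obtain ⟨C, -, hC⟩ := exists_tsum_weighted_bumpCoeff_le p
    refine Summable.of_norm_bounded (hC J hJ hJπ c).1 fun m => ?_
    rw [norm_mul, norm_mul, norm_exp_I_int_mul, mul_one, mul_comm, norm_pow]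
    have : ‖(m : ℂ) / k‖ = |(m : ℝ) / k| := by
      rw [← Real.norm_eq_abs, ← Complex.norm_real]; push_cast; rfl
    rw [this]
    gcongr
    linarith [abs_le_weight hk hkJ m]
  convert hs.hasSum using 1
  have e : ∀ m : ℤ, bumpCoeff J c m * Complex.exp (Complex.I * m * x) * ((m : ℂ) / k) ^ p =
      (1 / (Complex.I * (J * k))) ^ p *
        (bumpCoeff J c m * (Complex.I * (J * m : ℝ)) ^ p * Complex.exp (Complex.I * m * x)) := by
    intro m
    have : (m : ℂ) / k = 1 / (Complex.I * (J * k)) * (Complex.I * (J * m : ℝ)) := by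
      push_cast
      field_simp [Complex.I_ne_zero]
    rw [this, mul_pow]
    ring
  simp only [e]
  rw [tsum_mul_left, tsum_moment_bumpCoeff hJ hJπ h]
  split_ifs with hp
  · simp [hp]
  · simp

/-- Comparison of `(1 - x)⁻ⁿ` with the `n`-th power of the truncated geometric series at the
points `x = m / k`; the pole at `x = 1` is harmless, with the convention `1 / 0 = 0`. -/
lemma exists_norm_inv_pow_sub_geom_pow_le (P n : ℕ) :
    ∃ C : ℝ, 0 < C ∧ ∀ k : ℕ, 1 ≤ k → ∀ m : ℤ,
      ‖((1 - (m : ℂ) / k)⁻¹) ^ n - (∑ p ∈ Finset.range P, ((m : ℂ) / k) ^ p) ^ n‖ ≤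
        C * (k : ℝ) ^ n * (|(m : ℝ) / k| ^ P * (1 + |(m : ℝ) / k|) ^ (P * n)) := by
  refine ⟨n * (P + 1) * (P + 1) ^ n + 1, by positivity, fun k hk m => ?_⟩
  have hk' : (1 : ℝ) ≤ k := by exact_mod_cast hk
  have hk0 : (k : ℂ) ≠ 0 := by exact_mod_cast (by omega : k ≠ 0)
  set x : ℂ := (m : ℂ) / k with hx
  have hxn : ‖x‖ = |(m : ℝ) / k| := by
    rw [← Real.norm_eq_abs, ← Complex.norm_real]; push_cast; rfl
  rw [← hxn]
  set y : ℝ := ‖x‖ with hy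
  have hy0 : 0 ≤ y := norm_nonneg _
  set S : ℂ := ∑ p ∈ Finset.range P, x ^ p with hS
  set u : ℂ := (1 - x)⁻¹ with hu
  have hW : 1 ≤ (1 + y) ^ P := one_le_pow₀ (by linarith)
  have hSn : ‖S‖ ≤ P * (1 + y) ^ P := by
    calc ‖S‖ ≤ ∑ p ∈ Finset.range P, ‖x ^ p‖ := norm_sum_le _ _
      _ ≤ ∑ _p ∈ Finset.range P, (1 + y) ^ P := Finset.sum_le_sum fun p hp => by
          rw [norm_pow]
          calc y ^ p ≤ (1 + y) ^ p := by gcongr; linarith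
            _ ≤ (1 + y) ^ P := pow_le_pow_right₀ (by linarith) (Finset.mem_range.1 hp).le
      _ = _ := by simp
  have hun : ‖u‖ ≤ k := by
    by_cases hkm : (k : ℤ) = m
    · have : x = 1 := by rw [hx, ← hkm]; push_cast; exact div_self hk0
      rw [hu, this, sub_self, inv_zero, norm_zero]
      linarith
    · have e : u = (k : ℂ) / ((k - m : ℤ) : ℂ) := by
        have : ((k - m : ℤ) : ℂ) ≠ 0 := by exact_mod_cast sub_ne_zero.2 hkm
        have e2 : 1 - x = ((k - m : ℤ) : ℂ) / k := by
          rw [hx]; push_cast; field_simp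
        rw [hu, e2, inv_div]
      rw [e, norm_div, Complex.norm_natCast, Complex.norm_intCast]
      have : (1 : ℝ) ≤ |((k - m : ℤ) : ℝ)| := by
        exact_mod_cast Int.one_le_abs (sub_ne_zero.2 hkm)
      exact div_le_self (by linarith) this
  have hdiff : ‖u - S‖ ≤ (P + 1) * k * y ^ P := by
    by_cases hx1 : x = 1
    · have e1 : u = 0 := by rw [hu, hx1, sub_self, inv_zero]
      have e2 : S = P := by rw [hS, hx1]; simp
      have e3 : y = 1 := by rw [hy, hx1, norm_one]
      rw [e1, e2, e3, zero_sub, norm_neg, Complex.norm_natCast, one_pow]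
      nlinarith [(Nat.cast_nonneg P : (0 : ℝ) ≤ P)]
    · have h1 : 1 - x ≠ 0 := sub_ne_zero.2 (Ne.symm hx1)
      have e : u - S = x ^ P * u := by
        have hg := geom_sum_mul_neg x P
        rw [← hS] at hg
        rw [hu]
        field_simp
        linear_combination -hg
      rw [e, norm_mul, norm_pow]
      have : (0 : ℝ) ≤ P * k * y ^ P := by positivity
      nlinarith [pow_nonneg hy0 P]
  rcases n with _ | n
  · simp
    positivity
  have hfac := (Commute.all u S).mul_geom_sum₂ (n + 1)
  rw [← hfac, norm_mul]
  have hL : ‖∑ i ∈ Finset.range (n + 1), u ^ i * S ^ (n + 1 - 1 - i)‖ ≤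
      (n + 1) * ((P + 1) * k * (1 + y) ^ P) ^ n := by
    have hZu : ‖u‖ ≤ (P + 1) * k * (1 + y) ^ P := by
      have h1 : (1 : ℝ) * k * 1 ≤ (P + 1) * k * (1 + y) ^ P := by
        gcongr; linarith [(Nat.cast_nonneg P : (0 : ℝ) ≤ P)]
      linarith
    have hZS : ‖S‖ ≤ (P + 1) * k * (1 + y) ^ P := by
      refine hSn.trans ?_
      gcongr
      nlinarith [(Nat.cast_nonneg P : (0 : ℝ) ≤ P)]
    calc _ ≤ ∑ i ∈ Finset.range (n + 1), ‖u ^ i * S ^ (n + 1 - 1 - i)‖ := norm_sum_le _ _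
      _ ≤ ∑ _i ∈ Finset.range (n + 1), ((P + 1) * k * (1 + y) ^ P) ^ n :=
          Finset.sum_le_sum fun i hi => by
            have hi' : i ≤ n := Nat.lt_succ_iff.1 (Finset.mem_range.1 hi)
            rw [norm_mul, norm_pow, norm_pow, Nat.add_sub_cancel]
            calc _ ≤ ((P + 1) * k * (1 + y) ^ P) ^ i * ((P + 1) * k * (1 + y) ^ P) ^ (n - i) := by
                  gcongr
              _ = _ := by rw [← pow_add, Nat.add_sub_cancel' hi']
      _ = _ := by simp
  calc _ ≤ (P + 1) * k * y ^ P * ((n + 1) * ((P + 1) * k * (1 + y) ^ P) ^ n) :=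
        mul_le_mul hdiff hL (norm_nonneg _) (by positivity)
    _ = ((n + 1) * (P + 1) * (P + 1) ^ n) * (k : ℝ) ^ (n + 1) * (y ^ P * (1 + y) ^ (P * n)) := by
        rw [mul_pow, mul_pow, ← pow_mul]; ring
    _ ≤ _ := by
        have hy1 : 1 ≤ 1 + y := by linarith
        have hP1 : (1 : ℝ) ≤ P + 1 := by linarith [(Nat.cast_nonneg P : (0 : ℝ) ≤ P)]
        have h2 : ((n : ℝ) + 1) * (P + 1) * (P + 1) ^ n ≤
            ((n + 1 : ℕ) : ℝ) * (P + 1) * (P + 1) ^ (n + 1) + 1 := by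
          have : ((P : ℝ) + 1) ^ n ≤ (P + 1) ^ (n + 1) := pow_le_pow_right₀ hP1 (Nat.le_succ n)
          push_cast
          have h3 : ((n : ℝ) + 1) * (P + 1) * (P + 1) ^ n ≤ (n + 1) * (P + 1) * (P + 1) ^ (n + 1) := by
            gcongr
          linarith
        have h3 : (1 + y) ^ (P * n) ≤ (1 + y) ^ (P * (n + 1)) :=
          pow_le_pow_right₀ hy1 (Nat.mul_le_mul_left P (Nat.le_succ n))
        gcongr

/-- Multiplying a sawtooth function by a bump which is constant near the discontinuity changes its
Fourier coefficients by a rapidly decaying amount. -/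
lemma exists_norm_fc_sawtooth_mul_sub_le (P l : ℕ) (hP : 1 ≤ P) :
    ∃ C : ℝ, 0 < C ∧ ∀ J : ℝ, 0 < J → J ≤ π → ∀ c x γ : ℝ,
      (circDist c x ≤ J / 3 ∧ γ = 1 ∨ 7 * J / 9 ≤ circDist c x ∧ γ = 0) →
      ∀ k : ℕ, 1 ≤ k → 1 ≤ J * k →
        ‖fc (fun y => sawtooth l x y * locBump J c y) k - γ * fc (sawtooth l x) k‖ ≤
          C / (J * k) ^ P := by
  obtain ⟨C₁, hC₁, h₁⟩ := exists_norm_inv_pow_sub_geom_pow_le P (l + 1)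
  obtain ⟨C₂, hC₂, h₂⟩ := exists_tsum_weighted_bumpCoeff_le (P + P * (l + 1))
  refine ⟨C₁ * C₂, by positivity, fun J hJ hJπ c x γ h k hk hkJ => ?_⟩
  have hk' : (0 : ℝ) < k := by exact_mod_cast hk
  have hk0 : (k : ℂ) ≠ 0 := by exact_mod_cast (by omega : k ≠ 0)
  have hπ : (π : ℂ) ≠ 0 := by exact_mod_cast Real.pi_ne_zero
  set b := bumpCoeff J c with hb
  set e : ℤ → ℂ := fun m => Complex.exp (Complex.I * m * x) with he
  -- `Q (m / k)` replaces `(1 - m / k) ^ (-l - 1)`; only its constant term has a nonzero moment.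
  set Q : ℂ[X] := (∑ p ∈ Finset.range P, X ^ p) ^ (l + 1) with hQ
  have hQ0 : Q.coeff 0 = 1 := by
    rw [hQ, coeff_zero_eq_eval_zero, eval_pow, eval_finsetSum]
    have : ∑ p ∈ Finset.range P, eval (0 : ℂ) (X ^ p) = 1 := by
      rw [Finset.sum_eq_single_of_mem 0 (Finset.mem_range.2 hP)]
      · simp
      · intro p _ hp; simp [hp]
    rw [this, one_pow]
  have hQsum : HasSum (fun m : ℤ => b m * e m * Q.eval ((m : ℂ) / k)) (γ : ℂ) := by
    have hs := hasSum_sum (f := fun p (m : ℤ) => Q.coeff p * (b m * e m * ((m : ℂ) / k) ^ p))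
      (s := Finset.range (Q.natDegree + 1))
      (fun p _ => (hasSum_moment_bumpCoeff hJ hJπ h hk hkJ p).mul_left (Q.coeff p))
    have e1 : ∑ p ∈ Finset.range (Q.natDegree + 1), Q.coeff p * (if p = 0 then (γ : ℂ) else 0) = γ := by
      rw [Finset.sum_eq_single_of_mem 0 (Finset.mem_range.2 (Nat.succ_pos _))]
      · simp [hQ0]
      · intro p _ hp; simp [hp]
    rw [e1] at hs
    refine hs.congr_fun fun m => ?_
    rw [eval_eq_sum_range, Finset.mul_sum]
    exact Finset.sum_congr rfl fun p _ => by ring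
  set a : ℂ := node x ^ k / (2 * π * (Complex.I * k) ^ (l + 1)) with ha
  have hsaw : ∀ m : ℤ, fc (sawtooth l x) (k - m) * b m =
      a * (b m * e m * ((1 - (m : ℂ) / k)⁻¹) ^ (l + 1)) := by
    intro m
    have hn : node x ^ ((k : ℤ) - m) = node x ^ k * e m := by
      rw [zpow_sub₀ (node_ne_zero x), zpow_natCast, div_eq_mul_inv, ← zpow_neg, he]
      congr 1
      rw [node, ← Complex.exp_int_mul]
      congr 1
      push_cast; ring
    have hd : (Complex.I * (((k : ℤ) - m : ℤ) : ℂ)) ^ (l + 1) =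
        (Complex.I * k) ^ (l + 1) * (1 - (m : ℂ) / k) ^ (l + 1) := by
      rw [← mul_pow]
      congr 1
      push_cast
      field_simp
    rw [fc_sawtooth, hn, hd, ha, div_eq_mul_inv, div_eq_mul_inv, mul_inv, mul_inv, mul_inv, inv_pow]
    ring
  have hmain := hasSum_fc_mul (u := sawtooth l x) (g := locBump J c)
    (sawtooth_intervalIntegrable l x _ _) (summable_norm_bumpCoeff hJ hJπ c)
    (fun x => hasSum_locBump hJ hJπ c x) k
  have hγ : HasSum (fun m : ℤ => a * (b m * e m * Q.eval ((m : ℂ) / k))) (γ * fc (sawtooth l x) k) := by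
    have := hQsum.mul_left a
    rwa [show (γ : ℂ) * fc (sawtooth l x) k = a * γ by
      rw [fc_sawtooth, ha, zpow_natCast, Int.cast_natCast]; ring]
  have hdiff := hmain.sub hγ
  rw [← hdiff.tsum_eq]
  have hW := h₂ J hJ hJπ c
  have hbound : ∀ m : ℤ, ‖fc (sawtooth l x) (k - m) * b m -
      a * (b m * e m * Q.eval ((m : ℂ) / k))‖ ≤
      C₁ / (J * k) ^ P * ((1 + J * |(m : ℝ)|) ^ (P + P * (l + 1)) * ‖b m‖) := by
    intro m
    rw [hsaw, ← mul_sub, ← mul_sub, norm_mul, norm_mul, norm_mul]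
    have he1 : ‖e m‖ = 1 := norm_exp_I_int_mul m x
    have hQe : Q.eval ((m : ℂ) / k) = (∑ p ∈ Finset.range P, ((m : ℂ) / k) ^ p) ^ (l + 1) := by
      rw [hQ, eval_pow, eval_finsetSum]; simp
    have han : ‖a‖ ≤ 1 / (k : ℝ) ^ (l + 1) := by
      rw [ha, norm_div, norm_pow, norm_node, one_pow, norm_mul, norm_pow, norm_mul, norm_mul,
        Complex.norm_I, one_mul, Complex.norm_natCast, Complex.norm_real, Real.norm_eq_abs,
        abs_of_pos Real.pi_pos, Complex.norm_ofNat]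
      refine one_div_le_one_div_of_le (by positivity) ?_
      have : 1 ≤ 2 * π := by linarith [Real.pi_gt_three]
      exact le_mul_of_one_le_left (by positivity) this
    have hx1 := abs_le_weight hk hkJ m
    have hxP : |(m : ℝ) / k| ^ P ≤ (1 + J * |(m : ℝ)|) ^ P / (J * k) ^ P := by
      rw [← div_pow]
      gcongr
      rw [abs_div, abs_of_pos hk', div_le_div_iff₀ hk' (by positivity)]
      nlinarith [abs_nonneg (m : ℝ)]
    have h3 := h₁ k hk m
    rw [he1, hQe, mul_one]
    calc _ ≤ 1 / (k : ℝ) ^ (l + 1) * (‖b m‖ * (C₁ * (k : ℝ) ^ (l + 1) *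
          ((1 + J * |(m : ℝ)|) ^ P / (J * k) ^ P * (1 + J * |(m : ℝ)|) ^ (P * (l + 1))))) := by
          refine mul_le_mul han (mul_le_mul_of_nonneg_left (h3.trans ?_) (norm_nonneg _))
            (by positivity) (by positivity)
          gcongr
      _ = _ := by rw [pow_add _ P]; field_simp
  calc _ ≤ ∑' m : ℤ, C₁ / (J * k) ^ P * ((1 + J * |(m : ℝ)|) ^ (P + P * (l + 1)) * ‖b m‖) :=
        tsum_of_norm_bounded (hW.1.mul_left _).hasSum hbound
    _ = C₁ / (J * k) ^ P * ∑' m : ℤ, ((1 + J * |(m : ℝ)|) ^ (P + P * (l + 1)) * ‖b m‖) :=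
        tsum_mul_left
    _ ≤ C₁ / (J * k) ^ P * C₂ := by gcongr; exact hW.2
    _ = _ := by ring

section

open MeasureTheory

/-! ### Localization -/

/-- Multiplication by the bump, when the Fourier coefficients grow polynomially on the scale `1 / J`
around the frequency `k`. -/
lemma exists_norm_fc_mul_le (P : ℕ) :
    ∃ C : ℝ, 0 < C ∧ ∀ J : ℝ, 0 < J → J ≤ π → ∀ (c : ℝ) (u : ℝ → ℝ) (k : ℤ) (B : ℝ),
      IntervalIntegrable u volume (-π) π → 0 ≤ B →
      (∀ m : ℤ, ‖fc u (k - m)‖ ≤ B * (1 + J * |(m : ℝ)|) ^ P) →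
        ‖fc (fun x => u x * locBump J c x) k‖ ≤ C * B := by
  obtain ⟨C, hC, h⟩ := exists_tsum_weighted_bumpCoeff_le P
  refine ⟨C, hC, fun J hJ hJπ c u k B hu hB hle => ?_⟩
  have hW := h J hJ hJπ c
  rw [← (hasSum_fc_mul hu (summable_norm_bumpCoeff hJ hJπ c)
    (fun x => hasSum_locBump hJ hJπ c x) k).tsum_eq]
  calc _ ≤ ∑' m : ℤ, B * ((1 + J * |(m : ℝ)|) ^ P * ‖bumpCoeff J c m‖) := by
        refine tsum_of_norm_bounded (hW.1.mul_left _).hasSum fun m => ?_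
        rw [norm_mul, ← mul_assoc]
        gcongr
        exact hle m
    _ = B * ∑' m : ℤ, ((1 + J * |(m : ℝ)|) ^ P * ‖bumpCoeff J c m‖) := tsum_mul_left
    _ ≤ B * C := by gcongr; exact hW.2
    _ = _ := mul_comm _ _

/-- Multiplication by the bump preserves the decay of Fourier coefficients, up to a rapidly decaying
error in the scale of the bump. -/
lemma exists_norm_fc_mul_le_of_decay (P q : ℕ) :
    ∃ C : ℝ, 0 < C ∧ ∀ J : ℝ, 0 < J → J ≤ π → ∀ (c : ℝ) (u : ℝ → ℝ) (R : ℝ),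
      IntervalIntegrable u volume (-π) π → 0 ≤ R →
      (∀ a : ℤ, a ≠ 0 → ‖fc u a‖ ≤ R / |(a : ℝ)| ^ q) → ‖fc u 0‖ ≤ R → ∀ k : ℕ, 1 ≤ k →
        ‖fc (fun x => u x * locBump J c x) k‖ ≤ C * (R / (k : ℝ) ^ q + R / (J * k) ^ P) := by
  obtain ⟨C, hC, h⟩ := exists_norm_fc_mul_le P
  refine ⟨C * (2 ^ q + 2 ^ P), by positivity, fun J hJ hJπ c u R hu hR hdec h0 k hk => ?_⟩
  have hk' : (1 : ℝ) ≤ k := by exact_mod_cast hk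
  have hall : ∀ a : ℤ, ‖fc u a‖ ≤ R := by
    intro a
    by_cases ha : a = 0
    · rw [ha]; exact h0
    · refine (hdec a ha).trans (div_le_self hR (one_le_pow₀ ?_))
      exact_mod_cast Int.one_le_abs ha
  have key := h J hJ hJπ c u k (2 ^ q * (R / (k : ℝ) ^ q) + 2 ^ P * (R / (J * k) ^ P)) hu
    (by positivity) ?_
  · refine key.trans ?_
    rw [mul_assoc]
    gcongr
    have h1 : 0 ≤ R / (k : ℝ) ^ q := by positivity
    have h2 : 0 ≤ R / (J * k) ^ P := by positivity
    have h3 : (0 : ℝ) ≤ 2 ^ q := by positivity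
    have h4 : (0 : ℝ) ≤ 2 ^ P := by positivity
    nlinarith [mul_nonneg h3 h2, mul_nonneg h4 h1]
  · -- For `|m| ≤ k / 2` the frequency `k - m` is comparable to `k`; for larger `|m|` the weight wins.
    intro m
    have hpow : (1 : ℝ) ≤ (1 + J * |(m : ℝ)|) ^ P := one_le_pow₀ (by
      have : 0 ≤ J * |(m : ℝ)| := by positivity
      linarith)
    rcases le_or_gt (2 * |(m : ℝ)|) k with hm | hm
    · have hge : (k : ℝ) / 2 ≤ |(((k : ℤ) - m : ℤ) : ℝ)| := by
        have := abs_sub_abs_le_abs_sub (k : ℝ) (m : ℝ)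
        rw [abs_of_pos (by linarith : (0 : ℝ) < k)] at this
        push_cast
        linarith
      have hne : (k : ℤ) - m ≠ 0 := by
        intro h
        rw [h] at hge
        simp at hge
        linarith
      calc _ ≤ R / |(((k : ℤ) - m : ℤ) : ℝ)| ^ q := hdec _ hne
        _ ≤ R / ((k : ℝ) / 2) ^ q := by gcongr
        _ = (2 ^ q * (R / (k : ℝ) ^ q) + 0) * 1 := by rw [div_pow]; field_simp; ring
        _ ≤ _ := by gcongr; positivity
    · have hle : (k : ℝ) ≤ 2 * |(m : ℝ)| := hm.le
      calc _ ≤ R := hall _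
        _ = R / (J * k) ^ P * (J * k) ^ P := by field_simp
        _ ≤ R / (J * k) ^ P * (2 * (1 + J * |(m : ℝ)|)) ^ P := by
            have h2 : J * k ≤ 2 * (1 + J * |(m : ℝ)|) := by nlinarith
            exact mul_le_mul_of_nonneg_left (pow_le_pow_left₀ (by positivity) h2 P) (by positivity)
        _ = (0 + 2 ^ P * (R / (J * k) ^ P)) * (1 + J * |(m : ℝ)|) ^ P := by rw [mul_pow 2]; ring
        _ ≤ _ := by gcongr; positivity

/-- The error of truncating the convolution. -/
lemma exists_norm_fc_mul_sub_truncConv_le (P d : ℕ) :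
    ∃ C : ℝ, 0 < C ∧ ∀ J : ℝ, 0 < J → J ≤ π → ∀ (c : ℝ) (u : ℝ → ℝ) (B : ℝ),
      IntervalIntegrable u volume (-π) π → 0 ≤ B → (∀ a : ℤ, a ≠ 0 → ‖fc u a‖ ≤ B) →
      ∀ M k : ℕ, 2 * (d + 1) ≤ M → k ≤ M + (d + 1) →
        ‖fc (fun x => u x * locBump J c x) k - truncConv u (locBump J c) M k‖ ≤
          C * B / (J * M) ^ P := by
  obtain ⟨C, hC, h⟩ := exists_tsum_weighted_bumpCoeff_le P
  refine ⟨2 ^ P * C, by positivity, fun J hJ hJπ c u B hu hB hle M k hM hk => ?_⟩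
  have hM' : (0 : ℝ) < M := by exact_mod_cast (by omega : 0 < M)
  have hW := h J hJ hJπ c
  set b := bumpCoeff J c
  set S : Finset ℤ := Finset.Icc (-(2 * (M : ℤ))) (2 * (M : ℤ)) with hS
  have h1 := hasSum_fc_mul hu (summable_norm_bumpCoeff hJ hJπ c)
    (fun x => hasSum_locBump hJ hJπ c x) k
  have h2 : HasSum (fun m : ℤ => if (k : ℤ) - m ∈ S then fc u (k - m) * b m else 0)
      (truncConv u (locBump J c) M k) := by
    have h3 : HasSum (fun i : ℤ => if i ∈ S then fc u i * b (k - i) else 0)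
        (truncConv u (locBump J c) M k) := by
      have h4 := hasSum_sum_of_ne_finset_zero (s := S) (L := .unconditional ℤ)
        (f := fun i : ℤ => if i ∈ S then fc u i * b (k - i) else 0) (fun i hi => if_neg hi)
      convert h4 using 1
      rw [truncConv]
      refine Finset.sum_congr rfl fun i hi => ?_
      rw [if_pos hi, fc_locBump hJ hJπ]
    have h5 := (Equiv.subLeft (k : ℤ)).hasSum_iff.2 h3
    refine h5.congr_fun fun m => ?_
    simp
  rw [← (h1.sub h2).tsum_eq]
  have hbound : ∀ m : ℤ, ‖fc u (k - m) * bumpCoeff J c m -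
      (if (k : ℤ) - m ∈ S then fc u (k - m) * b m else 0)‖ ≤
      2 ^ P * B / (J * M) ^ P * ((1 + J * |(m : ℝ)|) ^ P * ‖b m‖) := by
    intro m
    split_ifs with hmS
    · rw [sub_self, norm_zero]; positivity
    · -- Discarded frequencies `k - m` have `|k - m| > 2M`, while `k ≤ 3M / 2`.
      have hm : (M : ℤ) ≤ 2 * |m| ∧ (k : ℤ) - m ≠ 0 := by
        rw [hS, Finset.mem_Icc, not_and_or] at hmS
        constructor
        · rcases abs_cases m with h | h <;> omega
        · omega
      have hm' : (M : ℝ) ≤ 2 * |(m : ℝ)| := by exact_mod_cast hm.1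
      rw [sub_zero, norm_mul]
      calc _ ≤ B * 1 * ‖b m‖ := by
            rw [mul_one]; gcongr; exact hle _ hm.2
        _ ≤ B * ((2 * (1 + J * |(m : ℝ)|)) ^ P / (J * M) ^ P) * ‖b m‖ := by
            gcongr
            have h2 : J * M ≤ 2 * (1 + J * |(m : ℝ)|) := by nlinarith
            rw [one_le_div (by positivity)]
            exact pow_le_pow_left₀ (by positivity) h2 P
        _ = _ := by rw [mul_pow 2]; ring
  calc _ ≤ ∑' m : ℤ, 2 ^ P * B / (J * M) ^ P * ((1 + J * |(m : ℝ)|) ^ P * ‖b m‖) :=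
        tsum_of_norm_bounded (hW.1.mul_left _).hasSum hbound
    _ = 2 ^ P * B / (J * M) ^ P * ∑' m : ℤ, ((1 + J * |(m : ℝ)|) ^ P * ‖b m‖) := tsum_mul_left
    _ ≤ 2 ^ P * B / (J * M) ^ P * C := by gcongr; exact hW.2
    _ = _ := by ring

lemma jumpCoeff_zero (n : ℕ) (A : ℕ → ℝ) (w : ℂ) : jumpCoeff n A w 0 = 0 := by
  simp [jumpCoeff]

/-- The bump separates the contributions of the jumps to the Fourier coefficients. -/
lemma exists_norm_fc_mul_sub_sum_jumpCoeff_le (d₁ K P : ℕ) (hP : 1 ≤ P) :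
    ∃ C : ℝ, 0 < C ∧ ∀ (f : ℝ → ℝ) (ξ : Fin K → ℝ) (A : ℕ → Fin K → ℝ) (J c R Y : ℝ)
      (γ : Fin K → ℝ), IntervalIntegrable f volume (-π) π → 0 < J → J ≤ π →
      (∀ i, circDist c (ξ i) ≤ J / 3 ∧ γ i = 1 ∨ 7 * J / 9 ≤ circDist c (ξ i) ∧ γ i = 0) →
      SmoothPartBound d₁ f ξ A R → ‖fc f 0‖ ≤ R → (∀ l ≤ d₁, ∀ i, |A l i| ≤ Y) → 0 ≤ Y →
      ∀ k : ℕ, 1 ≤ k → 1 ≤ J * k →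
        ‖fc (fun x => f x * locBump J c x) k -
            ∑ i, (γ i : ℂ) * jumpCoeff d₁ (fun l => A l i) (node (ξ i)) k‖ ≤
          C * (R / (k : ℝ) ^ (d₁ + 2) + (R + Y) / (J * k) ^ P) := by
  obtain ⟨C₁, hC₁, h₁⟩ := exists_norm_fc_mul_le_of_decay P (d₁ + 2)
  choose C₂ hC₂ h₂ using fun l => exists_norm_fc_sawtooth_mul_sub_le P l hP
  have hSpos : 0 ≤ ∑ l ∈ Finset.range (d₁ + 1), C₂ l := Finset.sum_nonneg fun l _ => (hC₂ l).le
  refine ⟨C₁ + K * ∑ l ∈ Finset.range (d₁ + 1), C₂ l, by positivity,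
    fun f ξ A J c R Y γ hf hJ hJπ hγ hψ h0 hA hY k hk hkJ => ?_⟩
  have hk' : (1 : ℝ) ≤ k := by exact_mod_cast hk
  have hR : 0 ≤ R := (norm_nonneg _).trans h0
  set Φ := singularPart d₁ ξ A with hΦ
  set g := locBump J c with hg
  set ψ : ℝ → ℝ := fun x => f x - Φ x with hψdef
  have hΦi := singularPart_intervalIntegrable d₁ ξ A (-π) π
  have hψi : IntervalIntegrable ψ volume (-π) π := hf.sub hΦi
  have hgc : ∀ u : ℝ → ℝ, IntervalIntegrable u volume (-π) π → ∀ k : ℤ,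
      HasSum (fun m : ℤ => fc u (k - m) * bumpCoeff J c m) (fc (fun x => u x * g x) k) :=
    fun u hu k => hasSum_fc_mul hu (summable_norm_bumpCoeff hJ hJπ c)
      (fun x => hasSum_locBump hJ hJπ c x) k
  -- All the sawtooth functions have mean zero.
  have hψ0 : fc ψ 0 = fc f 0 := by
    rw [hψdef, fc_sub hf hΦi, fc_singularPart]
    simp [jumpCoeff_zero]
  have hdec : ∀ a : ℤ, a ≠ 0 → ‖fc ψ a‖ ≤ R / |(a : ℝ)| ^ (d₁ + 2) := by
    intro a ha
    rcases Int.natAbs_eq a with h | h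
    · have h1 := hψ a.natAbs (Int.natAbs_pos.2 ha)
      have e : |(a : ℝ)| = a.natAbs := by rw [Nat.cast_natAbs]; push_cast; rfl
      rw [e]
      rwa [← h] at h1
    · have h1 := hψ a.natAbs (Int.natAbs_pos.2 ha)
      have e : |(a : ℝ)| = a.natAbs := by rw [Nat.cast_natAbs]; push_cast; rfl
      rw [e, h, norm_fc_neg, Int.natAbs_neg, Int.natAbs_natCast]
      exact h1
  have hsplit : fc (fun x => f x * g x) k = fc (fun x => ψ x * g x) k +
      ∑ i, ∑ l ∈ Finset.range (d₁ + 1), (A l i : ℂ) * fc (fun x => sawtooth l (ξ i) x * g x) k := by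
    have e1 := hgc ψ hψi k
    have e2 : HasSum (fun m : ℤ => ∑ i, ∑ l ∈ Finset.range (d₁ + 1),
        (A l i : ℂ) * (fc (sawtooth l (ξ i)) (k - m) * bumpCoeff J c m))
        (∑ i, ∑ l ∈ Finset.range (d₁ + 1), (A l i : ℂ) * fc (fun x => sawtooth l (ξ i) x * g x) k) :=
      hasSum_sum fun i _ => hasSum_sum fun l _ =>
        (hgc (sawtooth l (ξ i)) (sawtooth_intervalIntegrable _ _ _ _) k).mul_left _
    refine (hgc f hf k).unique ((e1.add e2).congr_fun fun m => ?_)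
    have e3 : fc f (k - m) = fc ψ (k - m) + ∑ i, ∑ l ∈ Finset.range (d₁ + 1),
        (A l i : ℂ) * fc (sawtooth l (ξ i)) (k - m) := by
      have e4 : fc Φ (k - m) = ∑ i, ∑ l ∈ Finset.range (d₁ + 1),
          (A l i : ℂ) * fc (sawtooth l (ξ i)) (k - m) := by
        rw [hΦ, fc_singularPart]
        refine Finset.sum_congr rfl fun i _ => ?_
        rw [jumpCoeff]
        exact Finset.sum_congr rfl fun l _ => by rw [fc_sawtooth]
      rw [← e4, hψdef, fc_sub hf hΦi]
      ring
    rw [e3, add_mul, Finset.sum_mul]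
    congr 1
    refine Finset.sum_congr rfl fun i _ => ?_
    rw [Finset.sum_mul]
    exact Finset.sum_congr rfl fun l _ => by ring
  have hrest : fc (fun x => f x * g x) k -
      ∑ i, (γ i : ℂ) * jumpCoeff d₁ (fun l => A l i) (node (ξ i)) k =
      fc (fun x => ψ x * g x) k + ∑ i, ∑ l ∈ Finset.range (d₁ + 1), (A l i : ℂ) *
        (fc (fun x => sawtooth l (ξ i) x * g x) k - γ i * fc (sawtooth l (ξ i)) k) := by
    rw [hsplit, add_sub_assoc, ← Finset.sum_sub_distrib]
    congr 1
    refine Finset.sum_congr rfl fun i _ => ?_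
    rw [jumpCoeff, Finset.mul_sum, ← Finset.sum_sub_distrib]
    refine Finset.sum_congr rfl fun l _ => ?_
    rw [fc_sawtooth]
    ring
  rw [hrest]
  have hb1 := h₁ J hJ hJπ c ψ R hψi hR hdec (by rw [hψ0]; exact h0) k hk
  have hb2 : ‖∑ i, ∑ l ∈ Finset.range (d₁ + 1), (A l i : ℂ) *
        (fc (fun x => sawtooth l (ξ i) x * g x) k - γ i * fc (sawtooth l (ξ i)) k)‖ ≤
      (K * ∑ l ∈ Finset.range (d₁ + 1), C₂ l) * (Y / (J * k) ^ P) := by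
    calc _ ≤ ∑ i : Fin K, ∑ l ∈ Finset.range (d₁ + 1), Y * (C₂ l / (J * k) ^ P) := by
          refine norm_sum_le_of_le _ fun i _ => norm_sum_le_of_le _ fun l hl => ?_
          rw [norm_mul, Complex.norm_real, Real.norm_eq_abs]
          exact mul_le_mul (hA l (Nat.lt_succ_iff.1 (Finset.mem_range.1 hl)) i)
            (h₂ l J hJ hJπ c (ξ i) (γ i) (hγ i) k hk hkJ) (norm_nonneg _) hY
      _ = _ := by
          rw [← Finset.mul_sum, ← Finset.sum_div]
          simp
          ring
  refine (norm_add_le _ _).trans ((add_le_add hb1 hb2).trans ?_)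
  set Z := ∑ l ∈ Finset.range (d₁ + 1), C₂ l
  have p1 : 0 ≤ R / (k : ℝ) ^ (d₁ + 2) := by positivity
  have p2 : 0 ≤ R / (J * k) ^ P := by positivity
  have p3 : 0 ≤ Y / (J * k) ^ P := by positivity
  have p4 : 0 ≤ (K : ℝ) * Z := by positivity
  rw [add_div]
  nlinarith [mul_nonneg p4 p1, mul_nonneg p4 p2, mul_nonneg hC₁.le p3]


/-- The magnitudes of a jump are recovered from its Fourier coefficients at the frequencies
`M, 2M, …, (n + 1)M`, by inverting the Vandermonde matrix with the nodes `1 / t`. -/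
lemma exists_abs_le_of_jumpCoeff_le (n : ℕ) :
    ∃ C : ℝ, 0 < C ∧ ∀ (A : ℕ → ℝ) (w : ℂ) (M : ℕ) (β : ℝ), ‖w‖ = 1 → 1 ≤ M →
      (∀ t : ℕ, 1 ≤ t → t ≤ n + 1 → ‖jumpCoeff n A w (t * M : ℕ)‖ ≤ β) →
      ∀ l ≤ n, |A l| ≤ C * (M : ℝ) ^ (n + 1) * β := by
  -- `δ` is a lower bound for the distance of two of the nodes `1, 1/2, …, 1/(n+1)`.
  set δ : ℝ := 1 / (n + 1) ^ 2 with hδdef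
  have hδ : 0 < δ := by positivity
  have hδ2 : δ ≤ 2 := by
    rw [hδdef, div_le_iff₀ (by positivity)]
    have : (1 : ℝ) ≤ (n + 1) ^ 2 := one_le_pow₀ (by linarith [(Nat.cast_nonneg n : (0 : ℝ) ≤ n)])
    linarith
  set v : Fin (n + 1) → ℂ := fun t => ((t : ℕ) + 1 : ℂ)⁻¹ with hv
  have hvn : ∀ t : Fin (n + 1), ((t : ℕ) + 1 : ℂ) ≠ 0 := fun t =>
    Nat.cast_add_one_ne_zero _
  have hvnorm : ∀ t : Fin (n + 1), ‖((t : ℕ) + 1 : ℂ)‖ = (t : ℕ) + 1 := fun t => by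
    have := Complex.norm_natCast ((t : ℕ) + 1)
    push_cast at this
    exact this
  have htn : ∀ t : Fin (n + 1), ((t : ℕ) : ℝ) + 1 ≤ n + 1 := fun t => by
    have := Nat.lt_succ_iff.1 t.2
    exact_mod_cast Nat.succ_le_succ this
  have hv1 : ∀ t, ‖v t‖ ≤ 1 := by
    intro t
    rw [hv]
    simp only
    rw [norm_inv, hvnorm]
    exact inv_le_one_of_one_le₀ (by linarith [(Nat.cast_nonneg (t : ℕ) : (0 : ℝ) ≤ (t : ℕ))])
  have hsep : ∀ s t, s ≠ t → δ ≤ ‖v s - v t‖ := by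
    intro s t hst
    have e : v s - v t = (((t : ℕ) : ℤ) - ((s : ℕ) : ℤ) : ℤ) / ((((s : ℕ) : ℂ) + 1) * (((t : ℕ) : ℂ) + 1)) := by
      rw [hv]
      simp only
      have := hvn s
      have := hvn t
      push_cast
      field_simp
      ring
    have hne : ((t : ℕ) : ℤ) - ((s : ℕ) : ℤ) ≠ 0 := by
      have := Fin.val_ne_of_ne hst
      omega
    have h1 : (1 : ℝ) ≤ |((((t : ℕ) : ℤ) - ((s : ℕ) : ℤ) : ℤ) : ℝ)| := by
      have := Int.one_le_abs hne
      rw [← Int.cast_abs]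
      exact_mod_cast this
    rw [e, norm_div, norm_mul, hvnorm, hvnorm, Complex.norm_intCast, hδdef, pow_two]
    have := htn s
    have := htn t
    gcongr
  refine ⟨2 * π * (((n + 1 : ℕ) : ℝ) * (2 / δ) ^ (n + 1)) * (n + 1), by positivity,
    fun A w M β hw hM hβ l hl => ?_⟩
  have hβ0 : 0 ≤ β := (norm_nonneg _).trans (hβ 1 le_rfl (by omega))
  have hM' : (1 : ℝ) ≤ M := by exact_mod_cast hM
  have hM0 : (M : ℂ) ≠ 0 := by exact_mod_cast (by omega : M ≠ 0)
  have hw0 : w ≠ 0 := by intro h; rw [h, norm_zero] at hw; norm_num at hw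
  set a : Fin (n + 1) → ℂ := fun l => (A l : ℂ) / (2 * π * (Complex.I * M) ^ ((l : ℕ) + 1)) with ha
  have hsum : ∀ t, ‖∑ l, a l * v t ^ (l : ℕ)‖ ≤ (n + 1) * β := by
    intro t
    have e : jumpCoeff n A w (((t : ℕ) + 1) * M : ℕ) =
        w ^ (((t : ℕ) + 1) * M) * v t * ∑ l, a l * v t ^ (l : ℕ) := by
      rw [jumpCoeff, ← Fin.sum_univ_eq_sum_range (fun l => (A l : ℂ) *
        (w ^ ((((t : ℕ) + 1) * M : ℕ) : ℤ) /
          (2 * π * (Complex.I * ((((t : ℕ) + 1) * M : ℕ) : ℤ)) ^ (l + 1)))), Finset.mul_sum]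
      refine Finset.sum_congr rfl fun l _ => ?_
      rw [zpow_natCast, ha, hv]
      simp only
      have := hvn t
      have e1 : (Complex.I * ((((t : ℕ) + 1) * M : ℕ) : ℤ)) ^ ((l : ℕ) + 1) =
          (Complex.I * M) ^ ((l : ℕ) + 1) * (((t : ℕ) : ℂ) + 1) ^ ((l : ℕ) + 1) := by
        rw [← mul_pow]
        push_cast
        ring
      rw [e1, inv_pow, pow_succ (((t : ℕ) : ℂ) + 1)]
      simp only [div_eq_mul_inv, mul_inv]
      ring
    have h1 := hβ ((t : ℕ) + 1) (by omega) (by omega)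
    rw [e, norm_mul, norm_mul, norm_pow, hw, one_pow, one_mul, hv] at h1
    simp only at h1
    rw [norm_inv, hvnorm] at h1
    have h2 : (0 : ℝ) < (t : ℕ) + 1 := by positivity
    rw [inv_mul_le_iff₀ h2] at h1
    exact h1.trans (mul_le_mul_of_nonneg_right (htn t) hβ0)
  have h1 := norm_coeff_le_of_eval_le hδ hδ2 hv1 hsep hsum ⟨l, Nat.lt_succ_of_le hl⟩
  rw [ha] at h1
  simp only at h1
  rw [norm_div, Complex.norm_real, Real.norm_eq_abs, norm_mul, norm_pow, norm_mul, norm_mul,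
    Complex.norm_I, one_mul, Complex.norm_natCast, Complex.norm_real, Real.norm_eq_abs,
    abs_of_pos Real.pi_pos, Complex.norm_ofNat, div_le_iff₀ (by positivity)] at h1
  refine h1.trans ?_
  have h2 : (M : ℝ) ^ (l + 1) ≤ (M : ℝ) ^ (n + 1) := pow_le_pow_right₀ hM' (by omega)
  calc _ ≤ ((n + 1 : ℕ) : ℝ) * (2 / δ) ^ (n + 1) * ((n + 1) * β) * (2 * π * (M : ℝ) ^ (n + 1)) := by
        gcongr
    _ = _ := by ring

lemma circDist_self (x : ℝ) : circDist x x = 0 := by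
  simp [circDist]

/-- A priori bound of all jump magnitudes by the Fourier coefficients of the function. The bumps
centred at the jumps isolate them one from another, and the error of doing so is a small multiple
of the largest magnitude, which can be absorbed. -/
lemma exists_forall_abs_jump_le (d₁ K : ℕ) :
    ∃ C C' : ℝ, 0 < C ∧ 0 < C' ∧ ∀ (f : ℝ → ℝ) (ξ : Fin K → ℝ) (A : ℕ → Fin K → ℝ) (J R B : ℝ)
      (M : ℕ), IntervalIntegrable f volume (-π) π → 0 < J → J ≤ π →
      (∀ i j, i ≠ j → J ≤ circDist (ξ i) (ξ j)) →
      SmoothPartBound d₁ f ξ A R → ‖fc f 0‖ ≤ R → 0 ≤ B → (∀ a : ℤ, a ≠ 0 → ‖fc f a‖ ≤ B) →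
      C' ≤ M → 1 ≤ J * M → (M : ℝ) ≤ (J * M) ^ 2 →
      ∀ l ≤ d₁, ∀ i, |A l i| ≤ C * (M : ℝ) ^ (d₁ + 1) * (B + R) := by
  obtain ⟨C₁, hC₁, h₁⟩ := exists_abs_le_of_jumpCoeff_le d₁
  obtain ⟨C₂, hC₂, h₂⟩ := exists_norm_fc_mul_le 0
  obtain ⟨C₃, hC₃, h₃⟩ := exists_norm_fc_mul_sub_sum_jumpCoeff_le d₁ K (2 * (d₁ + 2)) (by omega)
  refine ⟨2 * C₁ * (C₂ + 2 * C₃), 2 * C₁ * C₃ + 1, by positivity, by positivity,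
    fun f ξ A J R B M hf hJ hJπ hsep hψ h0 hB hfB hM hJM hJM2 => ?_⟩
  have hMpos : (0 : ℝ) < M := lt_of_lt_of_le (by positivity) hM
  have hM1 : 1 ≤ M := by exact_mod_cast hMpos
  have hM' : (1 : ℝ) ≤ M := by exact_mod_cast hM1
  have hR : 0 ≤ R := (norm_nonneg _).trans h0
  rcases Nat.eq_zero_or_pos K with hK | hK
  · intro l _ i
    exact absurd i.2 (by omega)
  -- `Y` is the largest magnitude of all, attained at the jump `i₀`.
  obtain ⟨⟨l₀, i₀⟩, hmem, hmax⟩ := Finset.exists_max_image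
    (Finset.range (d₁ + 1) ×ˢ (Finset.univ : Finset (Fin K))) (fun p => |A p.1 p.2|)
    ⟨(0, ⟨0, hK⟩), by simp⟩
  set Y := |A l₀ i₀| with hY
  have hl₀ : l₀ ≤ d₁ := by
    simp only [Finset.mem_product, Finset.mem_range] at hmem
    omega
  have hle : ∀ l ≤ d₁, ∀ i, |A l i| ≤ Y := fun l hl i =>
    hmax (l, i) (by simp; omega)
  suffices hYb : Y ≤ 2 * C₁ * (C₂ + 2 * C₃) * (M : ℝ) ^ (d₁ + 1) * (B + R) from
    fun l hl i => (hle l hl i).trans hYb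
  have hY0 : 0 ≤ Y := abs_nonneg _
  set γ : Fin K → ℝ := fun i => if i = i₀ then 1 else 0 with hγ
  have hpow : (M : ℝ) ^ (d₁ + 2) ≤ (J * M) ^ (2 * (d₁ + 2)) := by
    rw [pow_mul]; gcongr
  have hβ : ∀ t : ℕ, 1 ≤ t → t ≤ d₁ + 1 →
      ‖jumpCoeff d₁ (fun l => A l i₀) (node (ξ i₀)) (t * M : ℕ)‖ ≤
        C₂ * (B + R) + C₃ * (R + (R + Y) / (M : ℝ) ^ (d₁ + 2)) := by
    intro t ht _
    have htM : 1 ≤ t * M := Nat.mul_pos ht hM1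
    have hMt : (M : ℝ) ≤ ((t * M : ℕ) : ℝ) := by
      exact_mod_cast Nat.le_mul_of_pos_left M ht
    have hJk : J * M ≤ J * ((t * M : ℕ) : ℝ) := by gcongr
    have e1 := h₃ f ξ A J (ξ i₀) R Y γ hf hJ hJπ (fun i => by
      by_cases hi : i = i₀
      · left
        rw [hi, circDist_self, hγ]
        exact ⟨by positivity, if_pos rfl⟩
      · right
        refine ⟨?_, if_neg hi⟩
        have := hsep i₀ i (Ne.symm hi)
        linarith) hψ h0 hle hY0 (t * M) htM (hJM.trans hJk)
    have e2 : ∑ i, (γ i : ℂ) * jumpCoeff d₁ (fun l => A l i) (node (ξ i)) (t * M : ℕ) =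
        jumpCoeff d₁ (fun l => A l i₀) (node (ξ i₀)) (t * M : ℕ) := by
      rw [Finset.sum_eq_single i₀]
      · simp [hγ]
      · intro i _ hi; simp [hγ, hi]
      · simp
    rw [e2] at e1
    have e3 := h₂ J hJ hJπ (ξ i₀) f (t * M : ℕ) (B + R) hf (by positivity) (fun m => by
      rw [pow_zero, mul_one]
      by_cases ha : ((t * M : ℕ) : ℤ) - m = 0
      · rw [ha]; linarith
      · linarith [hfB _ ha])
    refine (norm_le_norm_add_norm_sub _ _).trans (add_le_add e3 (e1.trans ?_))
    gcongr
    · exact div_le_self hR (one_le_pow₀ (hM'.trans hMt))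
    · exact hpow.trans (pow_le_pow_left₀ (by positivity) hJk _)
  have h4 := h₁ (fun l => A l i₀) (node (ξ i₀)) M _ (norm_node _) hM1 hβ l₀ hl₀
  have h4 : Y ≤ C₁ * (M : ℝ) ^ (d₁ + 1) *
      (C₂ * (B + R) + C₃ * (R + (R + Y) / (M : ℝ) ^ (d₁ + 2))) := h4
  set W := (M : ℝ) ^ (d₁ + 1) with hW
  have hW1 : 1 ≤ W := one_le_pow₀ hM'
  have e5 : (M : ℝ) ^ (d₁ + 2) = W * M := pow_succ _ _
  rw [e5] at h4
  have e6 : C₁ * W * (C₂ * (B + R) + C₃ * (R + (R + Y) / (W * M))) =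
      C₁ * W * (C₂ * (B + R) + C₃ * (R + R / (W * M))) + C₁ * C₃ / M * Y := by
    field_simp
    ring
  -- The contribution of `Y` to the bound of `Y` is absorbed for large `M`.
  have e7 : C₁ * C₃ / M * Y ≤ 1 / 2 * Y := by
    refine mul_le_mul_of_nonneg_right ?_ hY0
    rw [div_le_div_iff₀ hMpos (by norm_num)]
    linarith
  have e8 : R / (W * M) ≤ R := div_le_self hR (by nlinarith)
  have e9 : C₁ * W * (C₂ * (B + R) + C₃ * (R + R / (W * M))) ≤
      C₁ * W * ((C₂ + 2 * C₃) * (B + R)) := by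
    gcongr
    nlinarith [mul_nonneg hC₃.le hB, mul_le_mul_of_nonneg_left e8 hC₃.le]
  rw [e6] at h4
  linarith


/-- A first-order approximation of the Fourier coefficients bounds them. -/
lemma norm_fc_le_of_approx {K : ℕ} {f : ℝ → ℝ} {ξ : Fin K → ℝ} {A : ℕ → Fin K → ℝ} {J₂ T : ℝ}
    (hA : ∀ j, |A 0 j| ≤ J₂)
    (hT : ∀ k : ℕ, 1 ≤ k →
        ‖2 * π * (Complex.I * k) * fc f k - ∑ j, (A 0 j : ℂ) * node (ξ j) ^ k‖ ≤ T / k)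
    {a : ℤ} (ha : a ≠ 0) : ‖fc f a‖ ≤ K * J₂ + T := by
  have key : ∀ k : ℕ, 1 ≤ k → ‖fc f k‖ ≤ K * J₂ + T := by
    intro k hk
    have hk' : (1 : ℝ) ≤ k := by exact_mod_cast hk
    have h1 := hT k hk
    have hT0 : 0 ≤ T := by
      have := (norm_nonneg _).trans h1
      rwa [le_div_iff₀ (by linarith), zero_mul] at this
    have h2 : ‖∑ j, (A 0 j : ℂ) * node (ξ j) ^ k‖ ≤ K * J₂ := by
      calc _ ≤ ∑ _j : Fin K, J₂ := norm_sum_le_of_le _ fun j _ => by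
            rw [norm_mul, norm_pow, norm_node, one_pow, mul_one, Complex.norm_real]
            exact hA j
        _ = _ := by simp
    have h3 : ‖2 * π * (Complex.I * k) * fc f k‖ = 2 * π * k * ‖fc f k‖ := by
      rw [norm_mul, norm_mul, norm_mul, norm_mul, Complex.norm_I, one_mul, Complex.norm_natCast,
        Complex.norm_real, Real.norm_eq_abs, abs_of_pos Real.pi_pos, Complex.norm_ofNat]
    have h4 := norm_le_norm_add_norm_sub' (2 * π * (Complex.I * k) * fc f k)
      (∑ j, (A 0 j : ℂ) * node (ξ j) ^ k)
    have h5 : T / k ≤ T := div_le_self hT0 hk'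
    have h6 : 1 ≤ 2 * π * k := by nlinarith [Real.pi_gt_three]
    have h7 : ‖fc f k‖ ≤ 2 * π * k * ‖fc f k‖ := le_mul_of_one_le_left (norm_nonneg _) h6
    linarith
  rcases Int.natAbs_eq a with h | h
  · rw [h]; exact key _ (Int.natAbs_pos.2 ha)
  · rw [h, norm_fc_neg]; exact key _ (Int.natAbs_pos.2 ha)

lemma continuous_locBump {J : ℝ} (hJ : 0 < J) (hJπ : J ≤ π) (c : ℝ) :
    Continuous (locBump J c) := by
  have h : Continuous fun x : ℝ =>
      (∑' m : ℤ, bumpCoeff J c m * Complex.exp (Complex.I * m * x)).re := by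
    refine Complex.continuous_re.comp (continuous_tsum (u := fun m => ‖bumpCoeff J c m‖)
      (fun m => by fun_prop) (summable_norm_bumpCoeff hJ hJπ c) fun m x => ?_)
    rw [norm_mul, norm_exp_I_int_mul, mul_one]
  refine h.congr fun x => ?_
  rw [(hasSum_locBump hJ hJπ c x).tsum_eq, Complex.ofReal_re]

/-- The bump is wide on the scale `1 / M` of the frequencies in use. The hypothesis on `M` holds when
`M` is a large multiple of `H`, since `H` dominates `J₁ / J ^ (d₁ + 1)`; the exponent is at least `2`. -/
lemma le_sq_of_le_div_pow {d₁ : ℕ} (hd₁ : 1 ≤ d₁) {J₁ J : ℝ} (hJ₁ : 0 < J₁) (hJ : 0 < J)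
    (hJπ : J ≤ π) {M : ℕ} (h : π ^ (d₁ - 1) / J₁ * (J₁ / J ^ (d₁ + 1)) ≤ M) (hM : 1 ≤ M) :
    1 ≤ J * M ∧ (M : ℝ) ≤ (J * M) ^ 2 := by
  have hM' : (1 : ℝ) ≤ M := by exact_mod_cast hM
  have h1 : 1 ≤ J ^ 2 * M := by
    have h2 : J ^ (d₁ + 1) = J ^ 2 * J ^ (d₁ - 1) := by rw [← pow_add]; congr 1; omega
    have h3 : J ^ (d₁ - 1) ≤ π ^ (d₁ - 1) := by gcongr
    have h4 : 1 / J ^ 2 ≤ π ^ (d₁ - 1) / J₁ * (J₁ / J ^ (d₁ + 1)) := by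
      rw [h2, div_mul_div_comm, div_le_div_iff₀ (by positivity) (by positivity)]
      calc _ = J₁ * J ^ 2 * J ^ (d₁ - 1) := by ring
        _ ≤ J₁ * J ^ 2 * π ^ (d₁ - 1) := by gcongr
        _ = _ := by ring
    have h5 := h4.trans h
    rwa [div_le_iff₀ (by positivity), mul_comm] at h5
  have h2 : (M : ℝ) ≤ (J * M) ^ 2 := by
    have : (J * M) ^ 2 = J ^ 2 * M * M := by ring
    rw [this]
    exact le_mul_of_one_le_left (by linarith) h1
  refine ⟨?_, h2⟩
  by_contra hlt
  push Not at hlt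
  have : (J * M) ^ 2 < 1 := pow_lt_one₀ (by positivity) hlt (by norm_num)
  linarith

/-- The powers of the large parameter `J * M` absorb all powers of `M` and of `1 / J`. -/
lemma pow_mul_div_pow_le {d₁ : ℕ} {J : ℝ} (hJ : 0 < J) {M : ℕ} (hM : 1 ≤ M) (hJM : 1 ≤ J * M)
    (hJM2 : (M : ℝ) ≤ (J * M) ^ 2) {x R : ℝ} (hx : 0 ≤ x) (hR : 0 ≤ R) :
    (M : ℝ) ^ (d₁ + 1) * (x + R) / (J * M) ^ (4 * d₁ + 8) ≤
      (R + x / J ^ (d₁ + 1)) / (M : ℝ) ^ (d₁ + 2) := by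
  have hM' : (1 : ℝ) ≤ M := by exact_mod_cast hM
  have hpow1 : (M : ℝ) ^ (d₁ + 2) * (M : ℝ) ^ (d₁ + 1) ≤ (J * M) ^ (4 * d₁ + 8) := by
    calc _ ≤ (M : ℝ) ^ (2 * d₁ + 4) := by
          rw [← pow_add]; exact pow_le_pow_right₀ hM' (by omega)
      _ ≤ ((J * M) ^ 2) ^ (2 * d₁ + 4) := by gcongr
      _ = _ := by rw [← pow_mul]; congr 1; omega
  have hpow2 : J ^ (d₁ + 1) * ((M : ℝ) ^ (d₁ + 2) * (M : ℝ) ^ (d₁ + 1)) ≤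
      (J * M) ^ (4 * d₁ + 8) := by
    calc _ = (J * M) ^ (d₁ + 1) * (M : ℝ) ^ (d₁ + 2) := by rw [mul_pow]; ring
      _ ≤ (J * M) ^ (d₁ + 1) * ((J * M) ^ 2) ^ (d₁ + 2) := by gcongr
      _ = (J * M) ^ (3 * d₁ + 5) := by rw [← pow_mul, ← pow_add]; congr 1; omega
      _ ≤ _ := pow_le_pow_right₀ hJM (by omega)
  have hMpos : (0 : ℝ) < M := by linarith
  have e1 : (M : ℝ) ^ (d₁ + 1) * R / (J * M) ^ (4 * d₁ + 8) ≤ R / (M : ℝ) ^ (d₁ + 2) := by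
    rw [div_le_div_iff₀ (by positivity) (by positivity)]
    linarith [mul_le_mul_of_nonneg_left hpow1 hR]
  have e2 : (M : ℝ) ^ (d₁ + 1) * x / (J * M) ^ (4 * d₁ + 8) ≤
      x / J ^ (d₁ + 1) / (M : ℝ) ^ (d₁ + 2) := by
    rw [div_div, div_le_div_iff₀ (by positivity) (by positivity)]
    linarith [mul_le_mul_of_nonneg_left hpow2 hx]
  rw [mul_add, add_div, add_div, add_comm]
  exact add_le_add e1 e2

lemma abs_le_sizeH {d d₁ l : ℕ} (a : ℕ → ℝ) {R : ℝ} (hR : 0 ≤ R) (hl : l ≤ d₁) :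
    |a l| ≤ sizeH d d₁ a R := by
  have hm1 := le_max_left 1 (∑ l ∈ Finset.range (d + 1), |a l|)
  have hm2 := le_max_left 1 (∑ l ∈ Finset.Ioc d d₁, |a l|)
  have hm3 := le_max_right 1 (∑ l ∈ Finset.range (d + 1), |a l|)
  have hm4 := le_max_right 1 (∑ l ∈ Finset.Ioc d d₁, |a l|)
  rw [sizeH]
  rcases Nat.lt_or_ge d l with h | h
  · have := Finset.single_le_sum (f := fun l => |a l|) (s := Finset.Ioc d d₁)
      (fun l _ => abs_nonneg _) (Finset.mem_Ioc.2 ⟨h, hl⟩)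
    linarith
  · have := Finset.single_le_sum (f := fun l => |a l|) (s := Finset.range (d + 1))
      (fun l _ => abs_nonneg _) (Finset.mem_range.2 (Nat.lt_succ_of_le h))
    linarith

set_option maxHeartbeats 800000 in
/-- The truncated convolution approximates the Fourier coefficients of a single jump. -/
lemma exists_localization (d d₁ K : ℕ) (hd : 2 * d + 1 ≤ d₁) {J₁ : ℝ} (hJ₁ : 0 < J₁) :
    ∃ C₀ C₅ : ℝ, 0 < C₀ ∧ 0 < C₅ ∧
    ∀ (f : ℝ → ℝ) (ξ : Fin K → ℝ) (A : ℕ → Fin K → ℝ) (J₂ J₃ T : ℝ),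
      HasJumps d₁ f ξ A →
      (∀ j, J₁ ≤ |A 0 j| ∧ |A 0 j| ≤ J₂) →
      0 < J₃ → J₃ ≤ π →
      (∀ i j, i ≠ j → J₃ ≤ circDist (ξ i) (ξ j)) →
      (∀ k : ℕ, 1 ≤ k →
        ‖2 * π * (Complex.I * k) * fc f k - ∑ j, (A 0 j : ℂ) * node (ξ j) ^ k‖ ≤ T / k) →
      ∀ (j : Fin K) (c R : ℝ),
        circDist c (ξ j) ≤ J₃ / 3 →
        (∀ i, i ≠ j → 7 * J₃ / 9 ≤ circDist c (ξ i)) →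
        ((SmoothPartBound d₁ f ξ A R ∧ ‖fc f 0‖ ≤ R) ∨
          SmoothPartBound d₁ (fun x => f x * locBump J₃ c x)
            (fun _ : Fin 1 => ξ j) (fun l _ => A l j) R) →
        ∀ (H : ℝ), H = sizeH d d₁ (fun l => A l j) (R + (J₂ + T) / J₃ ^ (d₁ + 1)) →
        1 ≤ H ∧ (∀ l ≤ d₁, |A l j| ≤ H) ∧
        ∀ (M : ℕ), C₅ * H < M → ∀ i ≤ d + 1,
          ‖truncConv f (locBump J₃ c) M (M + i : ℕ) -
            jumpCoeff d₁ (fun l => A l j) (node (ξ j)) (M + i : ℕ)‖ ≤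
              C₀ * H / (M : ℝ) ^ (d₁ + 2) := by
  -- The order of decay for which `pow_mul_div_pow_le` applies.
  set P : ℕ := 4 * d₁ + 8 with hP
  obtain ⟨C₁, hC₁, h₁⟩ := exists_norm_fc_mul_sub_truncConv_le P d
  obtain ⟨C₂, hC₂, h₂⟩ := exists_norm_fc_mul_sub_sum_jumpCoeff_le d₁ K P (by omega)
  obtain ⟨C₃, C₃', hC₃, hC₃', h₃⟩ := exists_forall_abs_jump_le d₁ K
  have hπ := Real.pi_pos
  set D : ℝ := (K : ℝ) + 1 with hD
  have hD1 : 1 ≤ D := by rw [hD]; linarith [(Nat.cast_nonneg K : (0 : ℝ) ≤ K)]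
  refine ⟨1 + C₁ * D + C₂ * (2 + 2 * C₃ * D),
    max (max C₃' (2 * (d + 1))) (π ^ (d₁ - 1) / J₁), by positivity, by positivity,
    fun f ξ A J₂ J T hf hA hJ hJπ hsep hT j c R hcj hci hcase H hH => ?_⟩
  have hfi := hf.intervalIntegrable (-π) π
  have hT0 : 0 ≤ T := by
    have := (norm_nonneg _).trans (hT 1 le_rfl)
    simpa using this
  have hJ₂ : J₁ ≤ J₂ := (hA j).1.trans (hA j).2
  have hR : 0 ≤ R := by
    rcases hcase with h | h
    · exact (norm_nonneg _).trans h.2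
    · have := (norm_nonneg _).trans (h 1 le_rfl)
      simpa using this
  set Rh : ℝ := R + (J₂ + T) / J ^ (d₁ + 1) with hRh
  have hJT : 0 ≤ (J₂ + T) / J ^ (d₁ + 1) := by
    have : 0 ≤ J₂ + T := by linarith
    positivity
  have hRh0 : 0 ≤ Rh := by positivity
  have hm1 := le_max_left 1 (∑ l ∈ Finset.range (d + 1), |A l j|)
  have hm2 := le_max_left 1 (∑ l ∈ Finset.Ioc d d₁, |A l j|)
  rw [sizeH] at hH
  have hH1 : 1 ≤ H := by linarith
  have hHR : Rh ≤ H := by linarith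
  refine ⟨hH1, fun l hl => ?_, fun M hM i hi => ?_⟩
  · have := abs_le_sizeH (d := d) (fun l => A l j) hRh0 hl
    rwa [sizeH, ← hH] at this
  have hbig : max (max C₃' (2 * (d + 1))) (π ^ (d₁ - 1) / J₁) ≤ M :=
    (le_mul_of_one_le_right (by positivity) hH1).trans hM.le
  have hMC : C₃' ≤ M := (le_max_left _ _).trans ((le_max_left _ _).trans hbig)
  have hMd : 2 * (d + 1) ≤ M := by
    have : (2 * (d + 1) : ℝ) ≤ M := (le_max_right _ _).trans ((le_max_left _ _).trans hbig)
    exact_mod_cast this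
  have hM1 : 1 ≤ M := by omega
  have hM' : (1 : ℝ) ≤ M := by exact_mod_cast hM1
  obtain ⟨hJM, hJM2⟩ := le_sq_of_le_div_pow (d₁ := d₁) (by omega) hJ₁ hJ hJπ (M := M) (by
    have h1 : J₁ / J ^ (d₁ + 1) ≤ H := by
      have : J₁ / J ^ (d₁ + 1) ≤ (J₂ + T) / J ^ (d₁ + 1) := by gcongr; linarith
      linarith
    calc _ ≤ max (max C₃' (2 * (d + 1))) (π ^ (d₁ - 1) / J₁) * H := by
          gcongr; exact le_max_right _ _
      _ ≤ M := hM.le) hM1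
  set k : ℕ := M + i with hk
  have hMk : (M : ℝ) ≤ k := by exact_mod_cast (by omega : M ≤ k)
  have hJMk : J * M ≤ J * k := by gcongr
  have hVk : (M : ℝ) ^ (d₁ + 2) ≤ (k : ℝ) ^ (d₁ + 2) := by gcongr
  have hsmall := pow_mul_div_pow_le (d₁ := d₁) hJ hM1 hJM hJM2
    (by linarith : 0 ≤ J₂ + T) hR
  rw [← hP, ← hRh] at hsmall
  have hEk : (J * M) ^ P ≤ (J * k) ^ P := by gcongr
  set W : ℝ := (M : ℝ) ^ (d₁ + 1) with hW
  have hW1 : 1 ≤ W := one_le_pow₀ hM'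
  set V : ℝ := (M : ℝ) ^ (d₁ + 2) with hV
  have hV1 : 1 ≤ V := one_le_pow₀ hM'
  set E : ℝ := (J * M) ^ P with hE
  have hE1 : 1 ≤ E := one_le_pow₀ hJM
  clear_value W V E Rh
  have hfB : ∀ a : ℤ, a ≠ 0 → ‖fc f a‖ ≤ K * J₂ + T :=
    fun a ha => norm_fc_le_of_approx (fun j => (hA j).2) hT ha
  have hB0 : 0 ≤ K * J₂ + T := by
    have : 0 ≤ J₂ := by linarith
    positivity
  have hBD : K * J₂ + T ≤ D * (J₂ + T) := by
    rw [hD]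
    nlinarith [mul_nonneg (Nat.cast_nonneg K : (0 : ℝ) ≤ K) hT0]
  have htail := h₁ J hJ hJπ c f _ hfi hB0 hfB M k hMd (by omega)
  rw [← hE] at htail
  have htail' : C₁ * (K * J₂ + T) / E ≤ C₁ * D * (Rh / V) := by
    calc _ ≤ C₁ * (D * (1 * (J₂ + T + R))) / E := by
          have : K * J₂ + T ≤ D * (1 * (J₂ + T + R)) := by nlinarith
          gcongr
      _ ≤ C₁ * (D * (W * (J₂ + T + R))) / E := by
          have : 0 ≤ J₂ + T + R := by linarith
          gcongr
      _ = C₁ * D * (W * (J₂ + T + R) / E) := by ring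
      _ ≤ _ := by gcongr
  have hmain : ‖fc (fun x => f x * locBump J c x) k -
      jumpCoeff d₁ (fun l => A l j) (node (ξ j)) k‖ ≤ (1 + C₂ * (2 + 2 * C₃ * D)) * (Rh / V) := by
    have hRV : R / (k : ℝ) ^ (d₁ + 2) ≤ Rh / V := by
      have : R ≤ Rh := by linarith
      gcongr
    have hpos : 0 ≤ Rh / V := by positivity
    rcases hcase with ⟨hψ, h0⟩ | hloc
    · obtain ⟨Y, hY⟩ : ∃ Y, Y = C₃ * W * (K * J₂ + T + R) := ⟨_, rfl⟩
      have hY0 : 0 ≤ Y := by rw [hY]; positivity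
      have hle := h₃ f ξ A J R (K * J₂ + T) M hfi hJ hJπ hsep hψ h0 hB0 hfB hMC hJM hJM2
      rw [← hW, ← hY] at hle
      have e1 := h₂ f ξ A J c R Y (fun i => if i = j then 1 else 0) hfi hJ hJπ (fun i => by
        by_cases hij : i = j
        · left; rw [hij]; exact ⟨hcj, if_pos rfl⟩
        · right; exact ⟨hci i hij, if_neg hij⟩) hψ h0 hle hY0 k (by omega) (hJM.trans hJMk)
      have e2 : ∑ i, (((if i = j then 1 else 0 : ℝ)) : ℂ) *
          jumpCoeff d₁ (fun l => A l i) (node (ξ i)) k =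
          jumpCoeff d₁ (fun l => A l j) (node (ξ j)) k := by
        rw [Finset.sum_eq_single j]
        · simp
        · intro i _ hij; simp [hij]
        · simp
      rw [e2] at e1
      have e3 : (R + Y) / (J * k) ^ P ≤ (1 + C₃ * D) * (Rh / V) := by
        have hZ : 0 ≤ J₂ + T + R := by linarith
        calc _ ≤ (R + Y) / E := by gcongr
          _ ≤ (1 * (W * (J₂ + T + R)) + C₃ * W * (D * (J₂ + T + R))) / E := by
              gcongr
              · rw [one_mul]
                calc R ≤ 1 * (J₂ + T + R) := by linarith
                  _ ≤ W * (J₂ + T + R) := by gcongr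
              · rw [hY]
                gcongr
                nlinarith
          _ = (1 + C₃ * D) * (W * (J₂ + T + R) / E) := by ring
          _ ≤ _ := by gcongr
      calc _ ≤ C₂ * (R / (k : ℝ) ^ (d₁ + 2) + (R + Y) / (J * k) ^ P) := e1
        _ ≤ C₂ * (Rh / V + (1 + C₃ * D) * (Rh / V)) := by gcongr
        _ = C₂ * (2 + C₃ * D) * (Rh / V) := by ring
        _ ≤ _ := by
            gcongr
            have : 0 ≤ C₃ * D := by positivity
            nlinarith
    · have e1 := hloc k (by omega)
      have hgi : IntervalIntegrable (fun x => f x * locBump J c x) volume (-π) π :=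
        hfi.mul_continuousOn (continuous_locBump hJ hJπ c).continuousOn
      have e2 : fc (fun x => f x * locBump J c x -
          singularPart d₁ (fun _ : Fin 1 => ξ j) (fun l _ => A l j) x) k =
          fc (fun x => f x * locBump J c x) k -
            jumpCoeff d₁ (fun l => A l j) (node (ξ j)) k := by
        rw [fc_sub hgi (singularPart_intervalIntegrable _ _ _ _ _), fc_singularPart]
        simp
      rw [e2] at e1
      refine e1.trans (hRV.trans ?_)
      refine le_mul_of_one_le_left hpos ?_
      have : 0 ≤ C₂ * (2 + 2 * C₃ * D) := by positivity
      linarith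
  have htri := norm_sub_le_norm_sub_add_norm_sub (truncConv f (locBump J c) M k)
    (fc (fun x => f x * locBump J c x) k) (jumpCoeff d₁ (fun l => A l j) (node (ξ j)) k)
  rw [norm_sub_rev (truncConv f (locBump J c) M k) (fc (fun x => f x * locBump J c x) k)] at htri
  calc _ ≤ C₁ * D * (Rh / V) + (1 + C₂ * (2 + 2 * C₃ * D)) * (Rh / V) := by linarith
    _ = (1 + C₁ * D + C₂ * (2 + 2 * C₃ * D)) * (Rh / V) := by ring
    _ ≤ (1 + C₁ * D + C₂ * (2 + 2 * C₃ * D)) * (H / V) := by gcongr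
    _ = _ := by ring

end

/-! ### Initial estimates by Prony's method -/

/-- A polynomial whose coefficients approximately annihilate a window of an exponential sum is small
at the frequencies. The leading coefficient `h` is kept separate, in order to treat the
homogeneous system (`h = 0`) along with the inhomogeneous one (`h = 1`). -/
lemma norm_eval_node_le_of_annihilates {K : ℕ} {w : Fin K → ℂ} {a : Fin K → ℂ} {r : ℕ → ℂ}
    {δ J T : ℝ} (hδ : 0 < δ) (hδ2 : δ ≤ 2) (hw : ∀ j, ‖w j‖ = 1)
    (hsep : ∀ i j, i ≠ j → δ ≤ ‖w i - w j‖) (hJ : 0 < J) (ha : ∀ j, J ≤ ‖a j‖) (hT : 0 ≤ T)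
    {M : ℕ} (hM : 1 ≤ M) (hr : ∀ k : ℕ, 1 ≤ k → ‖r k - ∑ j, a j * w j ^ k‖ ≤ T / k)
    {q : Fin K → ℂ} {h : ℂ} (hq : ∀ i : Fin K, ∑ l : Fin K, r (M + i + l) * q l + r (M + K + i) * h = 0)
    (j : Fin K) :
    ‖h * w j ^ K + ∑ l : Fin K, q l * w j ^ (l : ℕ)‖ ≤
      K * (2 / δ) ^ K / J * (T / M * (‖h‖ + ∑ l, ‖q l‖)) := by
  have hM' : (0 : ℝ) < M := by exact_mod_cast hM
  -- The amplitudes `a j * w j ^ M * p j` belong to an exponential sum made up of noise only.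
  set p : Fin K → ℂ := fun j => h * w j ^ K + ∑ l : Fin K, q l * w j ^ (l : ℕ) with hp
  set ε : ℕ → ℂ := fun k => r k - ∑ j, a j * w j ^ k with hε
  have hεle : ∀ i, ‖ε (M + i)‖ ≤ T / M := by
    intro i
    refine (hr (M + i) (by omega)).trans ?_
    gcongr
    omega
  have hsum : ∀ i : Fin K, ‖∑ j, a j * w j ^ M * p j * w j ^ (i : ℕ)‖ ≤
      T / M * (‖h‖ + ∑ l, ‖q l‖) := by
    intro i
    have e : ∑ j, a j * w j ^ M * p j * w j ^ (i : ℕ) =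
        -(ε (M + (K + i)) * h + ∑ l : Fin K, ε (M + (i + l)) * q l) := by
      have e1 : ∑ j, a j * w j ^ M * p j * w j ^ (i : ℕ) =
          (∑ j, a j * w j ^ (M + (K + i))) * h +
            ∑ l : Fin K, (∑ j, a j * w j ^ (M + (i + l))) * q l := by
        simp only [hp, Finset.sum_mul]
        rw [Finset.sum_comm, ← Finset.sum_add_distrib]
        refine Finset.sum_congr rfl fun j _ => ?_
        rw [mul_add, add_mul, Finset.mul_sum, Finset.sum_mul]
        congr 1
        · ring
        · exact Finset.sum_congr rfl fun l _ => by ring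
      have e2 := hq i
      simp only [hε, sub_mul, Finset.sum_sub_distrib]
      rw [e1]
      simp only [← add_assoc]
      linear_combination e2
    rw [e, norm_neg, mul_add, Finset.mul_sum]
    refine (norm_add_le _ _).trans (add_le_add ?_ (norm_sum_le_of_le _ fun l _ => ?_))
    · rw [norm_mul]
      gcongr
      exact hεle _
    · rw [norm_mul]
      gcongr
      exact hεle _
  have h1 := norm_amplitude_le hδ hδ2 (fun j => (hw j).le) hsep hsum j
  rw [norm_mul, norm_mul, norm_pow, hw, one_pow, mul_one] at h1
  have h2 : J * ‖p j‖ ≤ K * (2 / δ) ^ K * (T / M * (‖h‖ + ∑ l, ‖q l‖)) :=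
    (mul_le_mul_of_nonneg_right (ha j) (norm_nonneg _)).trans h1
  rw [div_mul_eq_mul_div, le_div_iff₀ hJ, mul_comm]
  exact h2

/-- Once the noise is small, the coefficients of an approximate annihilator are bounded. -/
lemma sum_norm_le_of_annihilates {K : ℕ} {w : Fin K → ℂ} {a : Fin K → ℂ} {r : ℕ → ℂ}
    {δ J T G : ℝ} (hδ : 0 < δ) (hδ2 : δ ≤ 2) (hw : ∀ j, ‖w j‖ = 1)
    (hsep : ∀ i j, i ≠ j → δ ≤ ‖w i - w j‖) (hJ : 0 < J) (ha : ∀ j, J ≤ ‖a j‖) (hT : 0 ≤ T)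
    {M : ℕ} (hM : 1 ≤ M) (hr : ∀ k : ℕ, 1 ≤ k → ‖r k - ∑ j, a j * w j ^ k‖ ≤ T / k)
    (hG : G = K * (2 / δ) ^ K) (hsmall : K * G * (G / J * (T / M)) ≤ 1 / 2)
    {q : Fin K → ℂ} {h : ℂ} (hq : ∀ i : Fin K, ∑ l : Fin K, r (M + i + l) * q l + r (M + K + i) * h = 0) :
    ∑ l, ‖q l‖ ≤ (2 * (K * G) + 1) * ‖h‖ := by
  have hp := norm_eval_node_le_of_annihilates hδ hδ2 hw hsep hJ ha hT hM hr hq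
  rw [← hG] at hp
  set S := ∑ l, ‖q l‖ with hS
  have hS0 : 0 ≤ S := Finset.sum_nonneg fun _ _ => norm_nonneg _
  have hcoef : ∀ l, ‖q l‖ ≤ G * (G / J * (T / M * (‖h‖ + S)) + ‖h‖) := by
    rw [hG]
    refine norm_coeff_le_of_eval_le hδ hδ2 (fun j => (hw j).le) hsep (v := w) (fun j => ?_)
    have e : ∑ l : Fin K, q l * w j ^ (l : ℕ) =
        (h * w j ^ K + ∑ l : Fin K, q l * w j ^ (l : ℕ)) - h * w j ^ K := by ring
    rw [e, ← hG]
    refine (norm_sub_le _ _).trans (add_le_add (hp j) ?_)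
    rw [norm_mul, norm_pow, hw, one_pow, mul_one]
  have h1 : S ≤ K * (G * (G / J * (T / M * (‖h‖ + S)) + ‖h‖)) := by
    calc S ≤ ∑ _l : Fin K, G * (G / J * (T / M * (‖h‖ + S)) + ‖h‖) :=
          Finset.sum_le_sum fun l _ => hcoef l
      _ = _ := by simp
  have h2 : K * (G * (G / J * (T / M * (‖h‖ + S)) + ‖h‖)) =
      K * G * (G / J * (T / M)) * (‖h‖ + S) + K * G * ‖h‖ := by ring
  have h3 : K * G * (G / J * (T / M)) * (‖h‖ + S) ≤ 1 / 2 * (‖h‖ + S) := by gcongr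
  linarith

lemma pronyPoly_monic_natDegree {K : ℕ} (q : Fin K → ℂ) :
    (pronyPoly K q).Monic ∧ (pronyPoly K q).natDegree = K := by
  have hdeg : (∑ l : Fin K, C (q l) * X ^ (l : ℕ)).degree < (K : WithBot ℕ) :=
    degree_sum_fin_lt q
  rw [pronyPoly]
  have hm := monic_X_pow_add hdeg
  exact ⟨hm, by
    rw [natDegree_add_eq_left_of_degree_lt (by rwa [degree_X_pow]), natDegree_X_pow]⟩

lemma existsUnique_solvesProny {K : ℕ} {c : ℤ → ℂ} {M : ℕ}
    (h : ∀ q : Fin K → ℂ, (∀ i : Fin K, ∑ l : Fin K, scaledCoeff 0 c (M + i + l) * q l = 0) → q = 0) :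
    ∃! q : Fin K → ℂ, SolvesProny K c M q := by
  set B : Matrix (Fin K) (Fin K) ℂ := Matrix.of fun i l => scaledCoeff 0 c (M + i + l) with hB
  have hmul : ∀ q i, B.mulVecLin q i = ∑ l : Fin K, scaledCoeff 0 c (M + i + l) * q l := by
    intro q i
    rw [Matrix.mulVecLin_apply, Matrix.mulVec, dotProduct]
    rfl
  have hinj : Function.Injective B.mulVecLin := by
    rw [injective_iff_map_eq_zero]
    intro q hq
    exact h q fun i => by rw [← hmul, hq]; rfl
  have hsurj := LinearMap.injective_iff_surjective.1 hinj
  obtain ⟨q, hq⟩ := hsurj fun i : Fin K => -scaledCoeff 0 c (M + K + i)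
  refine ⟨q, fun i => by rw [← hmul, hq], fun q' hq' => hinj ?_⟩
  rw [hq]
  funext i
  rw [hmul]
  exact hq' i

/-- The initial estimates are close to the jumps once `M` is large. -/
lemma exists_initial_estimates (K : ℕ) {J₁ : ℝ} (hJ₁ : 0 < J₁) (J₃ T : ℝ) :
    ∃ M₀ : ℝ, ∀ (c : ℤ → ℂ) (ξ : Fin K → ℝ) (a : Fin K → ℝ),
      (∀ j, J₁ ≤ |a j|) → 0 < J₃ → J₃ ≤ π → (∀ i j, i ≠ j → J₃ ≤ circDist (ξ i) (ξ j)) →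
      (∀ k : ℕ, 1 ≤ k →
        ‖2 * π * (Complex.I * k) * c k - ∑ j, (a j : ℂ) * node (ξ j) ^ k‖ ≤ T / k) →
      ∀ M : ℕ, M₀ ≤ M →
        (∃! q : Fin K → ℂ, SolvesProny K c M q) ∧
        ∀ q : Fin K → ℂ, SolvesProny K c M q →
          ∃ w : Fin K → ℂ, (pronyPoly K q).roots = Finset.univ.val.map w ∧
            ∀ j, circDist (-(w j).arg) (ξ j) ≤ 2 * J₃ / 9 := by
  have hπ := Real.pi_pos
  -- `δ` separates the nodes, `G` bounds the inverse Vandermonde matrix, and `η` is the size of the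
  -- Prony polynomial at the nodes which puts its roots within the required distance.
  set δ : ℝ := 2 / π * J₃ with hδ
  set G : ℝ := K * (2 / δ) ^ K with hG
  set η : ℝ := min ((δ / 4) ^ K / 2) ((δ / 2) ^ (K - 1) * (2 * J₃ / (9 * π))) with hη
  refine ⟨max 1 (max (2 * (K * G * (G / J₁ * T))) (G / J₁ * T * (2 * (K * G) + 2) / η)),
    fun c ξ a ha hJ₃ hJ₃π hsep hT M hM => ?_⟩
  have hδ0 : 0 < δ := by positivity
  have hδ2 : δ ≤ 2 := by
    rw [hδ, div_mul_eq_mul_div, div_le_iff₀ hπ]; linarith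
  have hG0 : 0 ≤ G := by positivity
  have hη0 : 0 < η := lt_min (by positivity) (by positivity)
  have hT0 : 0 ≤ T := by
    have := (norm_nonneg _).trans (hT 1 le_rfl)
    simpa using this
  have hM1 : 1 ≤ M := by
    have : (1 : ℝ) ≤ M := (le_max_left _ _).trans hM
    exact_mod_cast this
  have hM' : (0 : ℝ) < M := by exact_mod_cast hM1
  have hMa : 2 * (K * G * (G / J₁ * T)) ≤ M :=
    (le_max_left _ _).trans ((le_max_right _ _).trans hM)
  have hMb : G / J₁ * T * (2 * (K * G) + 2) / η ≤ M :=
    (le_max_right _ _).trans ((le_max_right _ _).trans hM)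
  have hsmall : K * G * (G / J₁ * (T / M)) ≤ 1 / 2 := by
    have e : K * G * (G / J₁ * (T / M)) = K * G * (G / J₁ * T) / M := by ring
    rw [e, div_le_div_iff₀ hM' (by norm_num)]
    linarith
  have hnear : G / J₁ * (T / M * (1 + (2 * (K * G) + 1))) ≤ η := by
    have e : G / J₁ * (T / M * (1 + (2 * (K * G) + 1))) =
        G / J₁ * T * (2 * (K * G) + 2) / M := by ring
    rw [e, div_le_iff₀ hM']
    rwa [div_le_iff₀ hη0, mul_comm (M : ℝ)] at hMb
  have hw : ∀ j, ‖node (ξ j)‖ = 1 := fun j => norm_node _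
  have hsepw : ∀ i j, i ≠ j → δ ≤ ‖node (ξ i) - node (ξ j)‖ := by
    intro i j hij
    have h1 := (hsep i j hij).trans (circDist_le_norm_node_sub (ξ i) (ξ j))
    rw [hδ]
    calc 2 / π * J₃ ≤ 2 / π * (π / 2 * ‖node (ξ i) - node (ξ j)‖) := by gcongr
      _ = _ := by field_simp
  have ha' : ∀ j, J₁ ≤ ‖(a j : ℂ)‖ := fun j => by rw [Complex.norm_real]; exact ha j
  have hr : ∀ k : ℕ, 1 ≤ k →
      ‖scaledCoeff 0 c k - ∑ j, (a j : ℂ) * node (ξ j) ^ k‖ ≤ T / k := by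
    intro k hk
    rw [scaledCoeff, zero_add, pow_one]
    exact hT k hk
  refine ⟨existsUnique_solvesProny fun q hq => ?_, fun q hq => ?_⟩
  · -- A solution of the homogeneous system vanishes.
    have h1 := sum_norm_le_of_annihilates (h := 0) hδ0 hδ2 hw hsepw hJ₁ ha' hT0 hM1 hr hG hsmall
      (q := q) (fun i => by rw [hq i, mul_zero, add_zero])
    rw [norm_zero, mul_zero] at h1
    funext l
    have h2 := Finset.single_le_sum (f := fun l => ‖q l‖) (fun l _ => norm_nonneg _)
      (Finset.mem_univ l)
    exact norm_le_zero_iff.1 (h2.trans h1)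
  · have hq1 : ∀ i : Fin K, ∑ l : Fin K, scaledCoeff 0 c (M + i + l) * q l +
        scaledCoeff 0 c (M + K + i) * 1 = 0 := fun i => by rw [hq i]; ring
    have h1 := sum_norm_le_of_annihilates hδ0 hδ2 hw hsepw hJ₁ ha' hT0 hM1 hr hG hsmall hq1
    have h2 := norm_eval_node_le_of_annihilates hδ0 hδ2 hw hsepw hJ₁ ha' hT0 hM1 hr hq1
    rw [norm_one, mul_one] at h1
    rw [← hG, norm_one] at h2
    obtain ⟨hmonic, hdeg⟩ := pronyPoly_monic_natDegree q
    have hcard : (pronyPoly K q).roots.card = K := by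
      rw [IsAlgClosed.card_roots_eq_natDegree, hdeg]
    obtain ⟨κ, hκ⟩ := exists_eq_map_univ _ hcard
    have h3 : ∀ j, ∏ k, ‖node (ξ j) - κ k‖ ≤ η := by
      intro j
      have e := norm_eval_eq_mul_prod_roots (pronyPoly K q) κ hκ (node (ξ j))
      rw [hmonic.leadingCoeff, norm_one, one_mul] at e
      have e2 : (pronyPoly K q).eval (node (ξ j)) =
          1 * node (ξ j) ^ K + ∑ l : Fin K, q l * node (ξ j) ^ (l : ℕ) := by
        rw [pronyPoly, eval_add, eval_finsetSum]
        simp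
      rw [← e, e2]
      refine (h2 j).trans (le_trans ?_ hnear)
      gcongr
    obtain ⟨σ, hσ⟩ := exists_perm_norm_sub_le (fun j => node (ξ j)) κ hδ0 hsepw (fun _ => η) h3
      (fun _ => lt_of_le_of_lt (min_le_left _ _) (half_lt_self (by positivity)))
    refine ⟨κ ∘ σ, ?_, fun j => ?_⟩
    · rw [hκ, ← Multiset.map_map, Multiset.map_univ_val_equiv σ]
    · refine (circDist_neg_arg_le _ _).trans ?_
      have h4 : ‖κ (σ j) - node (ξ j)‖ ≤ 2 * J₃ / (9 * π) := by
        refine (hσ j).2.trans ?_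
        rw [div_le_iff₀ (by positivity), mul_comm]
        exact min_le_right _ _
      calc π * ‖κ (σ j) - node (ξ j)‖ ≤ π * (2 * J₃ / (9 * π)) := by gcongr
        _ = _ := by field_simp

end PiecewiseFourier

end

theorem mainTheorem3 (d d₁ K : ℕ) (hd : 2 * d + 1 ≤ d₁) (J₁ : ℝ) (hJ₁ : 0 < J₁) :
    ∃ φ : Fin d → ℝ,
      (StrictMono fun i => |φ i|) ∧ (laguerre 1 d).roots = Finset.univ.val.map φ ∧
    ∃ C₁ C₂ C₃ C₄ C₅ : ℝ, 0 < C₁ ∧ 0 < C₂ ∧ 0 < C₃ ∧ 0 < C₄ ∧ 0 < C₅ ∧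
    ∃ M₀ : ℝ → ℝ → ℝ → ℝ,
    ∀ (f : ℝ → ℝ) (ξ : Fin K → ℝ) (A : ℕ → Fin K → ℝ) (J₂ J₃ T : ℝ),
      HasJumps d₁ f ξ A →
      (∀ j, J₁ ≤ |A 0 j| ∧ |A 0 j| ≤ J₂) →
      0 < J₃ → J₃ ≤ Real.pi →
      (∀ i j, i ≠ j → J₃ ≤ circDist (ξ i) (ξ j)) →
      (∀ k : ℕ, 1 ≤ k →
        ‖2 * Real.pi * (Complex.I * k) * fc f k - ∑ j, (A 0 j : ℂ) * node (ξ j) ^ k‖ ≤ T / k) →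
      -- initial estimates of the jumps
      (∀ M : ℕ, M₀ J₂ J₃ T ≤ M →
        (∃! q : Fin K → ℂ, SolvesProny K (fc f) M q) ∧
        ∀ q : Fin K → ℂ, SolvesProny K (fc f) M q →
          ∃ w : Fin K → ℂ, (pronyPoly K q).roots = Finset.univ.val.map w ∧
            ∀ j, circDist (-(w j).arg) (ξ j) ≤ 2 * J₃ / 9) ∧
      -- localization and resolution of the jump `ξ j`
      (∀ (j : Fin K) (c R : ℝ),
        circDist c (ξ j) ≤ J₃ / 3 →
        (∀ i, i ≠ j → 7 * J₃ / 9 ≤ circDist c (ξ i)) →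
        ((SmoothPartBound d₁ f ξ A R ∧ ‖fc f 0‖ ≤ R) ∨
          SmoothPartBound d₁ (fun x => f x * locBump J₃ c x)
            (fun _ : Fin 1 => ξ j) (fun l _ => A l j) R) →
        ∀ (H : ℝ), H = sizeH d d₁ (fun l => A l j) (R + (J₂ + T) / J₃ ^ (d₁ + 1)) →
        ∀ (M : ℕ), C₅ * H < M →
        ∀ (ct : ℤ → ℂ), ct = truncConv f (locBump J₃ c) M →
          -- the model roots
          ((∀ i, ∃ s : ℝ, 1 ≤ s ∧ modelRoot φ (node (ξ j)) M i = s * node (ξ j)) ∧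
            ∀ i i', i < i' →
              C₁ / M ≤ ‖modelRoot φ (node (ξ j)) M i - modelRoot φ (node (ξ j)) M i'‖) ∧
          -- all roots of the eliminant
          (eliminant d ct M).roots.card = d + 1 ∧
          (∀ κ : Fin (d + 1) → ℂ, (eliminant d ct M).roots = Finset.univ.val.map κ →
            (Monotone fun i => ‖κ i‖) →
            (∀ i, i ≠ 0 → ‖κ i - modelRoot φ (node (ξ j)) M i‖ ≤ C₂ * H / (M : ℝ) ^ 2) ∧
            ‖κ 0 - node (ξ j)‖ ≤ C₃ * H / (M : ℝ) ^ (d + 2)) ∧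
          -- the reconstructed parameters
          (∀ w : ℂ, IsClosestRoot (eliminant d ct M) w →
            ‖w - node (ξ j)‖ ≤ C₃ * H / (M : ℝ) ^ (d + 2) ∧
            circDist (-w.arg) (ξ j) ≤ C₃ * H / (M : ℝ) ^ (d + 2) ∧
            (∃! B : Fin (d + 1) → ℂ, SolvesMagnitudes d ct M w B) ∧
            ∀ B : Fin (d + 1) → ℂ, SolvesMagnitudes d ct M w B →
              ∀ l : Fin (d + 1),
                ‖B l - (A (l : ℕ) j : ℂ)‖ ≤ C₄ * H ^ 2 * (M : ℝ) ^ (((l : ℕ) : ℤ) - (d : ℤ) - 1))) := by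
  obtain ⟨φ, hφ, hpos, hroots⟩ := exists_roots_laguerre d
  have hroot : ∀ i, (laguerre 1 d).eval (φ i) = 0 := fun i => by
    have h : φ i ∈ (laguerre 1 d).roots := by
      rw [hroots]; exact Multiset.mem_map_of_mem φ (Finset.mem_univ_val i)
    exact (Polynomial.mem_roots'.1 h).2
  have habs : (fun i => |φ i|) = φ := funext fun i => abs_of_pos (hpos i)
  refine ⟨φ, by rw [habs]; exact hφ, hroots, ?_⟩
  obtain ⟨C₀, Ca, hC₀, hCa, hloc⟩ := exists_localization d d₁ K hd hJ₁
  obtain ⟨C₁, C₂, Cb, hC₁, hC₂, hCb, helim⟩ :=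
    exists_eliminant_roots_near d d₁ hd hJ₁ hC₀ φ hφ hpos hroot
  obtain ⟨C₄, Cc, hC₄, hCc, hmag⟩ := exists_magnitudes d d₁ hd hC₀ hC₂
  choose M₀ hM₀ using fun J₃ T => exists_initial_estimates K hJ₁ J₃ T
  have hπ := Real.pi_pos
  have hπ1 : 1 ≤ Real.pi := by linarith [Real.pi_gt_three]
  refine ⟨C₁, C₂, Real.pi * C₂, C₄, max Ca (max Cb Cc), hC₁, hC₂, by positivity, hC₄,
    by positivity, fun _ J₃ T => M₀ J₃ T, fun f ξ A J₂ J₃ T hf hA hJ₃ hJ₃π hsep hT => ⟨?_, ?_⟩⟩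
  · exact hM₀ J₃ T (fc f) ξ (A 0) (fun j => (hA j).1) hJ₃ hJ₃π hsep hT
  intro j c R hcj hci hcase H hH M hM ct hct
  obtain ⟨hH1, hAH, happrox⟩ :=
    hloc f ξ A J₂ J₃ T hf hA hJ₃ hJ₃π hsep hT j c R hcj hci hcase H hH
  have hH0 : 0 ≤ H := by linarith
  have hMa : Ca * H < M := lt_of_le_of_lt
    (mul_le_mul_of_nonneg_right (le_max_left _ _) hH0) hM
  have hMb : Cb * H < M := lt_of_le_of_lt
    (mul_le_mul_of_nonneg_right ((le_max_left _ _).trans (le_max_right _ _)) hH0) hM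
  have hMc : Cc * H < M := lt_of_le_of_lt
    (mul_le_mul_of_nonneg_right ((le_max_right _ _).trans (le_max_right _ _)) hH0) hM
  have hct' := happrox M hMa
  rw [← hct] at hct'
  obtain ⟨h1, h2, h3, h4, h5⟩ := helim (node (ξ j)) (fun l => A l j) H ct M (norm_node _)
    (hA j).1 hH1 hAH hMb hct'
  have hC₃ : C₂ * H / (M : ℝ) ^ (d + 2) ≤ Real.pi * C₂ * H / (M : ℝ) ^ (d + 2) := by
    gcongr
    exact le_mul_of_one_le_left hC₂.le hπ1
  refine ⟨⟨h1, h2⟩, h3, fun κ hκ hmono => ⟨(h4 κ hκ hmono).1, (h4 κ hκ hmono).2.trans hC₃⟩,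
    fun w hw => ?_⟩
  have hw' := h5 w hw
  refine ⟨hw'.trans hC₃, ?_, hmag (node (ξ j)) w (fun l => A l j) H ct M (norm_node _) hH1 hAH
    hMc hct' hw'⟩
  calc circDist (-w.arg) (ξ j) ≤ Real.pi * ‖w - node (ξ j)‖ := circDist_neg_arg_le w (ξ j)
    _ ≤ Real.pi * (C₂ * H / (M : ℝ) ^ (d + 2)) := by gcongr
    _ = _ := by ring
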